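/- Let $\alpha_0,\beta_0>0$ and $0<\gamma_0<1$. Suppose that the resonance set $$\Sigma=\Big\{(p,q): p,q\ge 1 \text{ integers},\ q(1+\alpha_0p^2)-\beta_0p\sqrt{1+\gamma_0\alpha_0p^2}=0\Big\}$$ has exactly one element $(p_0,q_0)$, and that there is no resonance at $p=+\infty$, i.e. $\alpha_0q^2\neq\gamma_0\beta_0^2$ for every integer $q$. Put $s=\sqrt{1+\gamma_0\alpha_0p_0^2}$, $E=2-\gamma_0+5\alpha_0p_0^2+4\gamma_0\alpha_0^2p_0^4$, $$\alpha_1=\frac{\beta_0(1+3\alpha_0p_0^2)s^3}{4\alpha_0p_0q_0E},\qquad \beta_1=-\frac{\beta_0(1+2\alpha_0p_0^2+3\gamma_0\alpha_0p_0^2+4\gamma_0\alpha_0^2p_0^4)s^2}{4\alpha_0p_0q_0E},$$ $$\beta_2=\beta_0\Big(-\frac{s^4}{4(1+4\gamma_0\alpha_0p_0^2)}-\beta_1s+\frac{\alpha_1}{2}s^2\Big),$$ and assume $\beta_2\neq0$. Put $$L(\mu,\nu,B)=-\frac1{\beta_2}\Big\{-\big(2p_0q_0s-\gamma_0\beta_0p_0^2\big)\mu+2s^2\nu+\beta_0s^2B\Big\}.$$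 Let $k\ge2$ be an integer, let $H^k$ be the Sobolev space of real functions of $(x,t)$ on $(\mathbb R/2\pi\mathbb Z)^2$, let $H^{k,o}_{\natural\natural}\subset H^k$ be the functions odd in $x$, and let $H^{k,e}_{\natural\natural,0}\subset H^k$ be the functions even in $x$ whose Fourier coefficients at $e^{iqt}$, $q\ne0$, vanish. Then there are $\varepsilon,C>0$ and a real function $f$, depending only on $\alpha_0,\beta_0,\gamma_0,k$, such that for all real $\mu,\nu,B$ with $\sigma:=|\mu|+|\nu|+|B|<\varepsilon$ one has $$|f(\mu,\nu,B)-L(\mu,\nu,B)|\le C\sigma^2,$$ and, whenever $f(\mu,\nu,B)\ge0$ (in particular whenever $L(\mu,\nu,B)\ge C\sigma^2$), the following holds with $|A|:=\sqrt{f(\mu,\nu,B)}$. There is a pair $U_0=(\eta_0,u_0)$ such that, for every $\tau\in\mathbb R$, the time shift $\mathcal T_\tau U_0(x,t)=U_0(x,t+\tau)$ lies in $H^{k,e}_{\natural\natural,0}\times H^{k,o}_{\natural\natural}$ and is a (distributional) doubly $2\pi$-periodic solution of the rescaled Bona–Smith system $$\eta_t+\beta u_x-\alpha\eta_{xxt}+\beta(u\eta)_x=0,\qquad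 u_t+\beta\eta_x-\gamma\alpha\beta\eta_{xxx}-\alpha u_{xxt}+\beta uu_x=0$$ with $\alpha=\alpha_0+\mu$, $\beta=\beta_0+\nu$, $\gamma=\gamma_0$. The average of $\eta_0$ over the torus is $B$, and $$\eta_0(x,t)=2|A|\cos q_0t\cos p_0x+B+r_1(x,t),\qquad u_0(x,t)=2s|A|\sin q_0t\sin p_0x+r_2(x,t),$$ $$\|r_j\|_{H^k}\le C|A|\,(|\mu|+|\nu|+|A|+|B|)\qquad(j=1,2).$$ If $f(\mu,\nu,B)>0$, the solution is nontrivial: $(\eta_0,u_0)\neq(B,0)$. -/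

import Mathlib

open MeasureTheory
open scoped ContDiff

noncomputable section

namespace BonaSmith

/-- The resonance set: pairs `(p, q)` of positive integers with
`q (1 + α p²) - β p √(1 + γ α p²) = 0`. -/
def resonanceSet (α β γ : ℝ) : Set (ℕ × ℕ) :=
  {z | 1 ≤ z.1 ∧ 1 ≤ z.2 ∧
    (z.2 : ℝ) * (1 + α * (z.1 : ℝ) ^ 2)
      - β * (z.1 : ℝ) * Real.sqrt (1 + γ * α * (z.1 : ℝ) ^ 2) = 0}

/-- One period cell of the torus `(ℝ / 2πℤ)²`; points are written `z = (x, t)`. -/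
def cell : Set (ℝ × ℝ) :=
  Set.Ioc (-Real.pi) Real.pi ×ˢ Set.Ioc (-Real.pi) Real.pi

/-- `w` is `2π`-periodic in `x` and in `t`. -/
def DoublyPeriodic (w : ℝ × ℝ → ℝ) : Prop :=
  ∀ x t : ℝ, w (x + 2 * Real.pi, t) = w (x, t) ∧ w (x, t + 2 * Real.pi) = w (x, t)

/-- The Fourier coefficient of `w` at `exp (i (p x + q t))`. -/
def fourierCoef (w : ℝ × ℝ → ℝ) (p q : ℤ) : ℂ :=
  (1 / (4 * (Real.pi : ℂ) ^ 2)) *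
    ∫ z in cell, (w z : ℂ) *
      Complex.exp (-(Complex.I * ((p : ℂ) * (z.1 : ℂ) + (q : ℂ) * (z.2 : ℂ))))

/-- The terms of the squared `H^k` norm on the torus. -/
def sobolevTerm (k : ℕ) (w : ℝ × ℝ → ℝ) (m : ℤ × ℤ) : ℝ :=
  (1 + (m.1 : ℝ) ^ 2 + (m.2 : ℝ) ^ 2) ^ k * ‖fourierCoef w m.1 m.2‖ ^ 2

/-- `w` belongs to `H^k((ℝ / 2πℤ)²)`. -/
structure MemH (k : ℕ) (w : ℝ × ℝ → ℝ) : Prop where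
  periodic : DoublyPeriodic w
  memLp : MemLp w 2 (volume.restrict cell)
  summable : Summable (sobolevTerm k w)

/-- The norm of `H^k((ℝ / 2πℤ)²)`, meaningful on functions satisfying `MemH k`. -/
def sobolevNorm (k : ℕ) (w : ℝ × ℝ → ℝ) : ℝ :=
  Real.sqrt (∑' m : ℤ × ℤ, sobolevTerm k w m)

/-- Functions in `H^k` that are even in `x` and have no Fourier mode `(0, q)` with `q ≠ 0`. -/
structure MemHEvenZero (k : ℕ) (w : ℝ × ℝ → ℝ) : Prop where
  mem : MemH k w
  even : ∀ x t : ℝ, w (-x, t) = w (x, t)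
  zero_modes : ∀ q : ℤ, q ≠ 0 → fourierCoef w 0 q = 0

/-- Functions in `H^k` that are odd in `x`. -/
structure MemHOdd (k : ℕ) (w : ℝ × ℝ → ℝ) : Prop where
  mem : MemH k w
  odd : ∀ x t : ℝ, w (-x, t) = -w (x, t)

/-- Partial derivative in `x`. -/
def dx (φ : ℝ × ℝ → ℝ) : ℝ × ℝ → ℝ := fun z => deriv (fun x => φ (x, z.2)) z.1

/-- Partial derivative in `t`. -/
def dt (φ : ℝ × ℝ → ℝ) : ℝ × ℝ → ℝ := fun z => deriv (fun t => φ (z.1, t)) z.2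

/-- `(η, u)` solves, in the sense of distributions on the torus, the rescaled Bona-Smith system
`η_t + β u_x - α η_xxt + β (u η)_x = 0`,
`u_t + β η_x - γ α β η_xxx - α u_xxt + β u u_x = 0`, where `u u_x = (u² / 2)_x`. -/
def IsWeakSolution (α β γ : ℝ) (η u : ℝ × ℝ → ℝ) : Prop :=
  ∀ φ : ℝ × ℝ → ℝ, ContDiff ℝ ∞ φ → DoublyPeriodic φ →
    (∫ z in cell, (-(η z * dt φ z) - β * (u z * dx φ z) + α * (η z * dx (dx (dt φ)) z)
        - β * (u z * η z * dx φ z))) = 0 ∧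
    (∫ z in cell, (-(u z * dt φ z) - β * (η z * dx φ z)
        + γ * α * β * (η z * dx (dx (dx φ)) z) + α * (u z * dx (dx (dt φ)) z)
        - β * (u z ^ 2 / 2 * dx φ z))) = 0

/-- The time shift `T_τ`. -/
def timeShift (τ : ℝ) (w : ℝ × ℝ → ℝ) : ℝ × ℝ → ℝ := fun z => w (z.1, z.2 + τ)

/-- The average of `w` over the torus. -/
def average (w : ℝ × ℝ → ℝ) : ℝ := (1 / (4 * Real.pi ^ 2)) * ∫ z in cell, w z

/-- `√(1 + γ α p²)`. -/
def kernelSlope (α γ : ℝ) (p : ℕ) : ℝ := Real.sqrt (1 + γ * α * (p : ℝ) ^ 2)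

/-- `4 α p q (2 - γ + 5 α p² + 4 γ α² p⁴)`. -/
def secondHarmonicDenom (α γ : ℝ) (p q : ℕ) : ℝ :=
  4 * α * p * q * (2 - γ + 5 * α * (p : ℝ) ^ 2 + 4 * γ * α ^ 2 * (p : ℝ) ^ 4)

/-- The coefficient of `A² e^{2iqt} cos 2px` in the second order part of `η`. -/
def coefAlpha1 (α β γ : ℝ) (p q : ℕ) : ℝ :=
  β * (1 + 3 * α * (p : ℝ) ^ 2) * kernelSlope α γ p ^ 3 / secondHarmonicDenom α γ p q

/-- The coefficient of `i A² e^{2iqt} sin 2px` in the second order part of `u`. -/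
def coefBeta1 (α β γ : ℝ) (p q : ℕ) : ℝ :=
  -(β * (1 + 2 * α * (p : ℝ) ^ 2 + 3 * γ * α * (p : ℝ) ^ 2 + 4 * γ * α ^ 2 * (p : ℝ) ^ 4)
    * kernelSlope α γ p ^ 2) / secondHarmonicDenom α γ p q

/-- The cubic coefficient `β₂` of the bifurcation equation. -/
def coefBeta2 (α β γ : ℝ) (p q : ℕ) : ℝ :=
  β * (-(kernelSlope α γ p ^ 4 / (4 * (1 + 4 * γ * α * (p : ℝ) ^ 2)))
    - coefBeta1 α β γ p q * kernelSlope α γ p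
    + coefAlpha1 α β γ p q / 2 * kernelSlope α γ p ^ 2)

/-- The linear expression in `(μ, ν, B)`, divided by `β₂`, giving `|A|²` at principal order. -/
def principalAmplitudeSq (α β γ : ℝ) (p q : ℕ) (μ ν B : ℝ) : ℝ :=
  -(1 / coefBeta2 α β γ p q) *
    (-(2 * p * q * kernelSlope α γ p - γ * β * (p : ℝ) ^ 2) * μ
      + (2 + 2 * γ * α * (p : ℝ) ^ 2) * ν
      + β * (1 + γ * α * (p : ℝ) ^ 2) * B)

end BonaSmith

end

/-! The solution is sought as a cosine series in `p x + q t` whose real coefficients, symmetric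
under `m ↦ -m`, lie in a weighted `ℓ¹` space. The weight is submultiplicative, so this space is a
convolution algebra, and it embeds in `H^k`. With `s(p) = √(1 + γ α p²)`, put `v = h + u`, where `h`
has coefficients `s(p)` times those of `η - B`. Since `h` is even and `u` odd in `x`, they are
recovered from `v` as its even and odd parts, and the two equations become one scalar equation with
symbol `λ(p, q) = q (1 + α p²) + β p s(p)`. Its only zeros with `p ≠ 0` are `±(p₀, -q₀)`.

There is no small-divisor loss. Away from these two zeros and from `p = 0`, `|λ| ≥ c (1 + |q|) p²`
(`exists_symbol_lower_bound`): for fixed `q`, the quotient `λ / (1 + α p²)` tends to a limit which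
is nonzero because there is no resonance at infinity, and for large `q` the time derivative
dominates. All perturbing and nonlinear terms carry a numerator of size at most `(1 + |q|) p²`, so
after division by `λ` everything is bounded and a Lyapunov-Schmidt reduction needs only the ordinary
implicit function theorem.

Write `v = A V + A² Z`, with `V` on odd and `Z` on even multiples of `p₀` in the space frequency. A
quadratic interaction respects this grading, so after dividing the odd equation by `A` and the even
one by `A²`, only `ρ = A²` remains. The unknowns are `V`, `Z`, `ρ` and the parameters `μ`, `ν`, `B`;
the equations are the nonresonant odd one, the even one and the scalar resonant one. At zero
parameters the solution is the kernel vector, the second order correction and `ρ = 0`; the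
linearisation is triangular with scalar entry `κ = p₀ β₂ / 2`, nonzero by assumption
(`exists_bifurcating_branch`, `kappa_eq`). The function `f` is the component `ρ` of the branch. The
expansion of the resonant equation gives its linear part (`linear_terms`), and where `f ≥ 0` the
choice `A = √f` gives a real solution.

It remains to undo the projections (`solution_unprojected`, `solution_fourier`) and to read the
coefficient identities as a weak formulation (`isWeakSolution_cosSeries`). -/

noncomputable section

namespace BonaSmith

/-! ### Operators on `ℓ¹` prescribed on basis vectors. -/

section SummableSequences

variable {ι : Type*} {F : Type*} [NormedAddCommGroup F] [NormedSpace ℝ F]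

/-- The space of absolutely summable real families. -/
abbrev SummableFamily (ι : Type*) := lp (fun _ : ι => ℝ) 1

theorem hasSum_norm_summableFamily (a : SummableFamily ι) : HasSum (fun i => |a i|) ‖a‖ := by
  simpa using lp.hasSum_norm (p := 1) (by simp) a

/-- Evaluation of a summable family at an index. -/
def coordCLM (i : ι) : SummableFamily ι →L[ℝ] ℝ := lp.evalCLM ℝ (fun _ : ι => ℝ) 1 i

@[simp] theorem coordCLM_apply (i : ι) (a : SummableFamily ι) : coordCLM i a = a i := rfl

variable [DecidableEq ι]

/-- The basis vector of the summable families at an index. -/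
def basisVec (i : ι) : SummableFamily ι := lp.single 1 i (1 : ℝ)

theorem basisVec_apply (i j : ι) : (basisVec i : ι → ℝ) j = if j = i then 1 else 0 := by
  by_cases h : j = i
  · subst h; simp [basisVec]
  · simp [basisVec, h, lp.single_apply]

theorem norm_basisVec (i : ι) : ‖basisVec i‖ = 1 := by
  simp [basisVec, lp.norm_single]

theorem hasSum_basisVec (a : SummableFamily ι) : HasSum (fun i => a i • basisVec i) a := by
  have h := lp.hasSum_single (p := 1) (by simp) a
  convert h using 2 with i
  rw [basisVec, ← lp.single_smul]; simp

/-- The linear map on summable families with prescribed bounded values on the basis. -/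
def liftBounded [CompleteSpace F] (t : ι → F) (C : ℝ) (h : ∀ i, ‖t i‖ ≤ C) :
    SummableFamily ι →L[ℝ] F :=
  have hs : ∀ a : SummableFamily ι, Summable fun i => ‖a i • t i‖ := fun a =>
    Summable.of_nonneg_of_le (fun _ => norm_nonneg _)
      (fun i => by
        rw [norm_smul]
        exact mul_le_mul_of_nonneg_left (h i) (norm_nonneg _))
      ((hasSum_norm_summableFamily a).summable.mul_right C)
  LinearMap.mkContinuous
    { toFun := fun a => ∑' i, a i • t i
      map_add' := fun a b => by
        rw [← (hs a).of_norm.tsum_add (hs b).of_norm]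
        exact tsum_congr fun i => by simp [add_smul]
      map_smul' := fun c a => by
        rw [RingHom.id_apply, ← (hs a).of_norm.tsum_const_smul]
        exact tsum_congr fun i => by simp [mul_smul] } C
    (fun a => by
      refine (norm_tsum_le_tsum_norm (hs a)).trans ?_
      rw [mul_comm, ← (hasSum_norm_summableFamily a).tsum_eq, ← tsum_mul_right]
      refine (hs a).tsum_le_tsum (fun i => ?_)
        ((hasSum_norm_summableFamily a).summable.mul_right C)
      rw [norm_smul]
      exact mul_le_mul_of_nonneg_left (h i) (norm_nonneg _))

theorem norm_liftBounded_le [CompleteSpace F] (t : ι → F) (C : ℝ) (hC : 0 ≤ C)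
    (h : ∀ i, ‖t i‖ ≤ C) : ‖liftBounded t C h‖ ≤ C := by
  unfold liftBounded
  exact LinearMap.mkContinuous_norm_le _ hC _

@[simp] theorem liftBounded_basisVec [CompleteSpace F] (t : ι → F) (C : ℝ) (h : ∀ i, ‖t i‖ ≤ C)
    (i : ι) : liftBounded t C h (basisVec i) = t i := by
  change ∑' j, (basisVec i : ι → ℝ) j • t j = t i
  rw [tsum_eq_single i]
  · simp [basisVec_apply]
  · intro j hj; simp [basisVec_apply, hj]

theorem hasSum_map_basisVec (T : SummableFamily ι →L[ℝ] F) (a : SummableFamily ι) :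
    HasSum (fun i => a i • T (basisVec i)) (T a) := by
  simpa using (hasSum_basisVec a).mapL T

theorem hasSum_liftBounded [CompleteSpace F] (t : ι → F) (C : ℝ) (h : ∀ i, ‖t i‖ ≤ C)
    (a : SummableFamily ι) : HasSum (fun i => a i • t i) (liftBounded t C h a) := by
  simpa using hasSum_map_basisVec (liftBounded t C h) a

theorem summableFamily_clm_ext {S T : SummableFamily ι →L[ℝ] F}
    (h : ∀ i, S (basisVec i) = T (basisVec i)) : S = T := by
  ext a
  refine (hasSum_map_basisVec S a).unique ?_
  simpa [h] using hasSum_map_basisVec T a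

/-- Multiplication of a summable family by a bounded symbol. -/
def diagonalOp (φ : ι → ℝ) (C : ℝ) (h : ∀ i, |φ i| ≤ C) :
    SummableFamily ι →L[ℝ] SummableFamily ι :=
  liftBounded (fun i => φ i • basisVec i) C
    (fun i => by rw [norm_smul, norm_basisVec, mul_one]; exact h i)

/-- Permutation of the indices of a summable family. -/
def reindexOp (σ : ι → ι) : SummableFamily ι →L[ℝ] SummableFamily ι :=
  liftBounded (fun i => basisVec (σ i)) 1 (fun _ => (norm_basisVec _).le)

@[simp] theorem diagonalOp_basisVec (φ : ι → ℝ) (C : ℝ) (h : ∀ i, |φ i| ≤ C) (i : ι) :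
    diagonalOp φ C h (basisVec i) = φ i • basisVec i :=
  liftBounded_basisVec _ _ _ _

@[simp] theorem reindexOp_basisVec (σ : ι → ι) (i : ι) :
    reindexOp σ (basisVec i) = basisVec (σ i) :=
  liftBounded_basisVec _ _ _ _

@[simp] theorem diagonalOp_apply (φ : ι → ℝ) (C : ℝ) (h : ∀ i, |φ i| ≤ C) (a : SummableFamily ι)
    (i : ι) : diagonalOp φ C h a i = φ i * a i := by
  have : (coordCLM i).comp (diagonalOp φ C h) = φ i • coordCLM i := by
    refine summableFamily_clm_ext fun j => ?_
    by_cases hij : i = j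
    · subst hij; simp [basisVec_apply]
    · simp [basisVec_apply, hij]
  simpa using congrArg (fun T => T a) this

/-- The operator moves basis vectors by `σ`, so coordinates are read through the inverse of `σ`,
which is `σ` itself for an involution. -/
theorem reindexOp_apply {σ : ι → ι} (hσ : Function.Involutive σ) (a : SummableFamily ι)
    (i : ι) : reindexOp σ a i = a (σ i) := by
  have : (coordCLM i).comp (reindexOp σ) = coordCLM (σ i) := by
    refine summableFamily_clm_ext fun j => ?_
    by_cases hij : i = σ j
    · subst hij; simp [basisVec_apply, hσ j]
    · have : σ i ≠ j := fun h => hij (by rw [← h, hσ i])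
      simp [basisVec_apply, hij, this]
  simpa using congrArg (fun T => T a) this

end SummableSequences

/-! ### The weighted convolution algebra. -/

section Weighted

/-- Absolutely summable families indexed by the frequencies of the torus. -/
abbrev Seq := SummableFamily (ℤ × ℤ)

/-- The submultiplicative weight `(1 + |p| + |q|)^k`. -/
def weight (k : ℕ) (m : ℤ × ℤ) : ℝ := (1 + |(m.1 : ℝ)| + |(m.2 : ℝ)|) ^ k

theorem one_le_weight (k : ℕ) (m : ℤ × ℤ) : 1 ≤ weight k m := by
  refine one_le_pow₀ ?_
  have := abs_nonneg (m.1 : ℝ)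
  have := abs_nonneg (m.2 : ℝ)
  linarith

theorem weight_pos (k : ℕ) (m : ℤ × ℤ) : 0 < weight k m :=
  lt_of_lt_of_le one_pos (one_le_weight k m)

theorem weight_ne_zero (k : ℕ) (m : ℤ × ℤ) : weight k m ≠ 0 := (weight_pos k m).ne'

/-- By the triangle inequality and nonnegativity of the cross terms in the product. This is what
makes weighted `ℓ¹` closed under convolution. -/
theorem weight_add_le (k : ℕ) (m n : ℤ × ℤ) : weight k (m + n) ≤ weight k m * weight k n := by
  rw [weight, weight, weight, ← mul_pow]
  refine pow_le_pow_left₀ (by positivity) ?_ k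
  have h1 := abs_add_le (m.1 : ℝ) n.1
  have h2 := abs_add_le (m.2 : ℝ) n.2
  have := mul_nonneg (abs_nonneg (m.1 : ℝ)) (abs_nonneg (n.1 : ℝ))
  have := mul_nonneg (abs_nonneg (m.1 : ℝ)) (abs_nonneg (n.2 : ℝ))
  have := mul_nonneg (abs_nonneg (m.2 : ℝ)) (abs_nonneg (n.1 : ℝ))
  have := mul_nonneg (abs_nonneg (m.2 : ℝ)) (abs_nonneg (n.2 : ℝ))
  simp only [Prod.fst_add, Prod.snd_add, Int.cast_add]
  nlinarith

theorem weight_neg (k : ℕ) (m : ℤ × ℤ) : weight k (-m) = weight k m := by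
  simp [weight]

theorem weight_reflect (k : ℕ) (m : ℤ × ℤ) : weight k (-m.1, m.2) = weight k m := by
  simp [weight]

theorem sobolev_weight_le (k : ℕ) (m : ℤ × ℤ) :
    (1 + (m.1 : ℝ) ^ 2 + (m.2 : ℝ) ^ 2) ^ k ≤ weight k m ^ 2 := by
  rw [weight, ← pow_mul, mul_comm k 2, pow_mul]
  refine pow_le_pow_left₀ (by positivity) ?_ k
  have := abs_nonneg (m.1 : ℝ)
  have := abs_nonneg (m.2 : ℝ)
  rw [← sq_abs (m.1 : ℝ), ← sq_abs (m.2 : ℝ)]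
  nlinarith [mul_nonneg (abs_nonneg (m.1 : ℝ)) (abs_nonneg (m.2 : ℝ))]

/-- Convolution of Fourier coefficients, for coefficients multiplied by the weight. -/
def conv (k : ℕ) : Seq →L[ℝ] Seq →L[ℝ] Seq :=
  -- A sequence stores coefficients already multiplied by the weight, so the product of two unit
  -- vectors acquires this ratio, at most `1` by submultiplicativity.
  have h : ∀ i j, ‖(weight k (i + j) / (weight k i * weight k j)) • basisVec (i + j)‖ ≤ 1 :=
    fun i j => by
      rw [norm_smul, norm_basisVec, mul_one, Real.norm_eq_abs, abs_of_nonneg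
        (div_nonneg (weight_pos _ _).le (mul_pos (weight_pos _ _) (weight_pos _ _)).le)]
      exact div_le_one_of_le₀ (weight_add_le k i j)
        (mul_pos (weight_pos _ _) (weight_pos _ _)).le
  liftBounded (fun i => liftBounded
    (fun j => (weight k (i + j) / (weight k i * weight k j)) • basisVec (i + j)) 1 (h i)) 1
    (fun i => norm_liftBounded_le _ _ zero_le_one _)

theorem conv_basisVec (k : ℕ) (i j : ℤ × ℤ) : conv k (basisVec i) (basisVec j) =
    (weight k (i + j) / (weight k i * weight k j)) • basisVec (i + j) := by
  simp [conv]

/-- The normalised basis vector, whose Fourier coefficient at `i` is `1`. -/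
def modeVec (k : ℕ) (i : ℤ × ℤ) : Seq := weight k i • basisVec i

theorem basisVec_eq_modeVec (k : ℕ) (i : ℤ × ℤ) : basisVec i = (weight k i)⁻¹ • modeVec k i := by
  rw [modeVec, smul_smul, inv_mul_cancel₀ (weight_ne_zero k i), one_smul]

theorem conv_modeVec (k : ℕ) (i j : ℤ × ℤ) :
    conv k (modeVec k i) (modeVec k j) = modeVec k (i + j) := by
  simp only [modeVec, map_smul, _root_.smul_apply, conv_basisVec, smul_smul]
  congr 1
  have := weight_ne_zero k i
  have := weight_ne_zero k j
  field_simp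

theorem modeVec_apply (k : ℕ) (i j : ℤ × ℤ) :
    (modeVec k i : ℤ × ℤ → ℝ) j = if j = i then weight k i else 0 := by
  simp [modeVec, basisVec_apply]

/-- Continuous linear maps on weighted sequences are determined by the normalised basis. -/
theorem seq_clm_ext {F : Type*} [NormedAddCommGroup F] [NormedSpace ℝ F] (k : ℕ)
    {S T : Seq →L[ℝ] F} (h : ∀ i, S (modeVec k i) = T (modeVec k i)) : S = T :=
  summableFamily_clm_ext fun i => by simp [basisVec_eq_modeVec k i, h]

theorem seq_bilinear_ext {F : Type*} [NormedAddCommGroup F] [NormedSpace ℝ F] (k : ℕ)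
    {S T : Seq →L[ℝ] Seq →L[ℝ] F}
    (h : ∀ i j, S (modeVec k i) (modeVec k j) = T (modeVec k i) (modeVec k j)) : S = T :=
  seq_clm_ext k fun i => seq_clm_ext k fun j => h i j

@[simp] theorem diagonalOp_modeVec (k : ℕ) (φ : ℤ × ℤ → ℝ) (C : ℝ) (h : ∀ i, |φ i| ≤ C)
    (i : ℤ × ℤ) : diagonalOp φ C h (modeVec k i) = φ i • modeVec k i := by
  simp [modeVec, smul_comm (φ i)]

theorem reindexOp_modeVec (k : ℕ) {σ : ℤ × ℤ → ℤ × ℤ} (hσ : ∀ m, weight k (σ m) = weight k m)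
    (i : ℤ × ℤ) : reindexOp σ (modeVec k i) = modeVec k (σ i) := by
  simp [modeVec, hσ]

/-- A weight-preserving additive involution of the frequencies commutes with convolution. -/
theorem reindexOp_conv (k : ℕ) {σ : ℤ × ℤ → ℤ × ℤ} (hσ : ∀ m, weight k (σ m) = weight k m)
    (hadd : ∀ m n, σ (m + n) = σ m + σ n) (a b : Seq) :
    reindexOp σ (conv k a b) = conv k (reindexOp σ a) (reindexOp σ b) := by
  have : (ContinuousLinearMap.compL ℝ Seq Seq Seq (reindexOp σ)).comp (conv k) =
      (conv k).bilinearComp (reindexOp σ) (reindexOp σ) := by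
    refine seq_bilinear_ext k fun i j => ?_
    simp [conv_modeVec, reindexOp_modeVec k hσ, hadd]
  simpa using congrArg (fun T => T a b) this

/-- The support of a convolution lies in the sum of the supports. -/
theorem conv_apply_eq_zero (k : ℕ) {A B : Set (ℤ × ℤ)} {a b : Seq} (ha : ∀ i ∉ A, a i = 0)
    (hb : ∀ j ∉ B, b j = 0) {m : ℤ × ℤ} (hm : ∀ i ∈ A, ∀ j ∈ B, i + j ≠ m) :
    conv k a b m = 0 := by
  have h1 := (hasSum_map_basisVec (((coordCLM m).comp
    (ContinuousLinearMap.apply ℝ Seq b)).comp (conv k)) a)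
  refine (h1.unique ?_ : _ = (0 : ℝ))
  convert hasSum_zero with i
  by_cases hi : i ∈ A
  · have h2 := hasSum_map_basisVec ((coordCLM m).comp (conv k (basisVec i))) b
    have h3 : ((coordCLM m).comp (conv k (basisVec i))) b = 0 := by
      refine h2.unique ?_
      convert hasSum_zero with j
      by_cases hj : j ∈ B
      · have := (hm i hi j hj).symm
        simp [conv_basisVec, basisVec_apply, this]
      · simp [hb j hj]
    rw [smul_eq_mul, mul_eq_zero]
    exact Or.inr h3
  · simp [ha i hi]

end Weighted

/-! ### An abstract bifurcation theorem for graded quadratic equations. -/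

section Bifurcation

open Filter Topology Asymptotics

variable {E : Type*} [NormedAddCommGroup E] [NormedSpace ℝ E]

/-- The perturbation of the linear operator produced by the parameters `(μ, ν, B)`. -/
def linPert (T₁ T₂ T₃ T₄ : E →L[ℝ] E) (b μ ν B : ℝ) (v : E) : E :=
  μ • T₁ v + ν • T₂ v + ((b + ν) * μ) • T₃ v + ((b + ν) * B) • T₄ v

/-- The part of the bifurcation system driving the modes of odd grade. -/
def oddForcing (T₁ T₂ T₃ T₄ : E →L[ℝ] E) (q : E →L[ℝ] E →L[ℝ] E) (b μ ν B : ℝ) (V Z : E)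
    (ρ : ℝ) : E :=
  linPert T₁ T₂ T₃ T₄ b μ ν B V + ((b + ν) * ρ) • (q V Z + q Z V)

/-- The part of the bifurcation system driving the modes of even grade. -/
def evenForcing (T₁ T₂ T₃ T₄ : E →L[ℝ] E) (q : E →L[ℝ] E →L[ℝ] E) (b μ ν B : ℝ) (V Z : E)
    (ρ : ℝ) : E :=
  linPert T₁ T₂ T₃ T₄ b μ ν B Z + (b + ν) • (q V V + ρ • q Z Z)

/-- The triangular linear equivalence that inverts the linearised bifurcation system. -/
theorem triangular_isInvertible (a c : E) (T : E →L[ℝ] E) {κ : ℝ} (hκ : κ ≠ 0)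
    (L : E × E × ℝ →L[ℝ] E × E × ℝ)
    (hL : ∀ y, L y = (y.1 + y.2.2 • a, y.2.1 + T y.1 + y.2.2 • c, κ * y.2.2)) :
    L.IsInvertible := by
  let pr : E × E × ℝ →L[ℝ] ℝ := κ⁻¹ • (ContinuousLinearMap.snd ℝ E ℝ).comp
    (ContinuousLinearMap.snd ℝ E (E × ℝ))
  let pV : E × E × ℝ →L[ℝ] E := ContinuousLinearMap.fst ℝ E (E × ℝ) - pr.smulRight a
  let pZ : E × E × ℝ →L[ℝ] E := (ContinuousLinearMap.fst ℝ E ℝ).comp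
    (ContinuousLinearMap.snd ℝ E (E × ℝ)) - T.comp pV - pr.smulRight c
  refine ⟨ContinuousLinearEquiv.equivOfInverse L (pV.prod (pZ.prod pr)) ?_ ?_, rfl⟩
  · rintro ⟨v, z, r⟩
    simp [hL, pV, pZ, pr, hκ]
    abel
  · rintro ⟨v, z, r⟩
    simp [hL, pV, pZ, pr, hκ]
    abel

/-- The implicit function theorem at zero parameters and `(V, Z, ρ) = (e, Z₀, 0)`. There the
resonant equation is `b ρ τ (q V Z + q Z V) = 0`, whose derivative is `κ` in `ρ` and zero in `V` and
`Z`. The last estimate is the first order expansion of `ρ` in the parameters. -/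
theorem exists_bifurcating_branch [CompleteSpace E] (T₁ T₂ T₃ T₄ P₁ P₂ : E →L[ℝ] E)
    (q : E →L[ℝ] E →L[ℝ] E) (τ : E →L[ℝ] ℝ) (b : ℝ) (e Z₀ : E) {κ : ℝ}
    (hZ₀ : Z₀ = -(b • P₂ (q e e))) (hκ : κ = b * τ (q e Z₀ + q Z₀ e)) (hκ0 : κ ≠ 0) :
    ∃ ε > 0, ∃ C > 0, ∃ ψ : ℝ × ℝ × ℝ → E × E × ℝ, ∀ μ ν B : ℝ, |μ| + |ν| + |B| < ε →
      ∃ V Z : E, ∃ ρ : ℝ, ψ (μ, ν, B) = (V, Z, ρ) ∧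
        V + P₁ (oddForcing T₁ T₂ T₃ T₄ q b μ ν B V Z ρ) = e ∧
        Z + P₂ (evenForcing T₁ T₂ T₃ T₄ q b μ ν B V Z ρ) = 0 ∧
        τ (oddForcing T₁ T₂ T₃ T₄ q b μ ν B V Z ρ) = 0 ∧
        ‖V - e‖ ≤ C * (|μ| + |ν| + |B|) ∧ ‖Z‖ ≤ C ∧
        |κ * ρ + (μ * τ (T₁ e) + ν * τ (T₂ e) + b * μ * τ (T₃ e) + b * B * τ (T₄ e))| ≤
          C * (|μ| + |ν| + |B|) ^ 2 := by
  let F : (ℝ × ℝ × ℝ) × (E × E × ℝ) → E × E × ℝ := fun x =>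
    (x.2.1 + P₁ (oddForcing T₁ T₂ T₃ T₄ q b x.1.1 x.1.2.1 x.1.2.2 x.2.1 x.2.2.1 x.2.2.2),
      x.2.2.1 + P₂ (evenForcing T₁ T₂ T₃ T₄ q b x.1.1 x.1.2.1 x.1.2.2 x.2.1 x.2.2.1 x.2.2.2),
      τ (oddForcing T₁ T₂ T₃ T₄ q b x.1.1 x.1.2.1 x.1.2.2 x.2.1 x.2.2.1 x.2.2.2))
  let u : (ℝ × ℝ × ℝ) × (E × E × ℝ) := (0, (e, Z₀, 0))
  have hFc : ContDiff ℝ 1 F := by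
    unfold F oddForcing evenForcing linPert
    fun_prop
  have hF : HasStrictFDerivAt F (fderiv ℝ F u) u :=
    (hFc.contDiffAt).hasStrictFDerivAt one_ne_zero
  have hFu : F u = (e, 0, 0) := by
    simp [F, u, oddForcing, evenForcing, linPert, hZ₀]
  -- The off-diagonal entries of the derivative: `a` and `c` are the effects of `ρ` on the odd and
  -- even equations, `T` the effect of `V` on the even one.
  let a : E := b • P₁ (q e Z₀ + q Z₀ e)
  let c : E := b • P₂ (q Z₀ Z₀)
  let T : E →L[ℝ] E := b • P₂.comp (q e + q.flip e)
  have hinv : (fderiv ℝ F u ∘L ContinuousLinearMap.inr ℝ (ℝ × ℝ × ℝ) (E × E × ℝ)).IsInvertible := by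
    refine triangular_isInvertible a c T hκ0 _ fun y => ?_
    -- The partial derivative is computed along a line: with the parameters at zero, `F` is a cubic
    -- polynomial in `t`, and its linear coefficient is the triangular map.
    have h1 : HasDerivAt (fun t : ℝ => F (u + t • ((0, y) : (ℝ × ℝ × ℝ) × (E × E × ℝ))))
        (fderiv ℝ F u (0, y)) 0 := by
      have hl : HasDerivAt (fun t : ℝ => u + t • ((0, y) : (ℝ × ℝ × ℝ) × (E × E × ℝ)))
          (0, y) 0 := by
        simpa using ((hasDerivAt_id (0 : ℝ)).smul_const
          ((0, y) : (ℝ × ℝ × ℝ) × (E × E × ℝ))).const_add u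
      have hF' : HasFDerivAt F (fderiv ℝ F u)
          (u + (0 : ℝ) • ((0, y) : (ℝ × ℝ × ℝ) × (E × E × ℝ))) := by
        simpa using hF.hasFDerivAt
      exact hF'.comp_hasDerivAt (0 : ℝ) hl
    have h2 : (fun t : ℝ => F (u + t • ((0, y) : (ℝ × ℝ × ℝ) × (E × E × ℝ)))) = fun t =>
        F u + t • (y.1 + y.2.2 • a, y.2.1 + T y.1 + y.2.2 • c, κ * y.2.2) +
        (t * t) • (b • P₁ (y.2.2 • (q e y.2.1 + q y.1 Z₀ + q Z₀ y.1 + q y.2.1 e)),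
          b • P₂ (q y.1 y.1 + y.2.2 • (q Z₀ y.2.1 + q y.2.1 Z₀)),
          b * τ (y.2.2 • (q e y.2.1 + q y.1 Z₀ + q Z₀ y.1 + q y.2.1 e))) +
        (t * t * t) • (b • P₁ (y.2.2 • (q y.1 y.2.1 + q y.2.1 y.1)),
          b • P₂ (y.2.2 • q y.2.1 y.2.1),
          b * τ (y.2.2 • (q y.1 y.2.1 + q y.2.1 y.1))) := by
      funext t
      rw [hFu]
      simp only [F, u, oddForcing, evenForcing, linPert, a, c, T, hκ, Prod.fst_add, Prod.snd_add,
        Prod.smul_fst, Prod.smul_snd, Prod.fst_zero, Prod.snd_zero, smul_zero, add_zero, zero_add,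
        zero_smul, mul_zero, map_add, map_smul, _root_.add_apply, _root_.smul_apply, smul_eq_mul,
        ContinuousLinearMap.comp_apply, ContinuousLinearMap.flip_apply, Prod.mk_add_mk,
        Prod.smul_mk, Prod.mk.injEq]
      refine ⟨?_, ?_, ?_⟩
      · module
      · nth_rw 1 [hZ₀]
        module
      · ring
    have h3 : HasDerivAt (fun t : ℝ => F (u + t • ((0, y) : (ℝ × ℝ × ℝ) × (E × E × ℝ))))
        (y.1 + y.2.2 • a, y.2.1 + T y.1 + y.2.2 • c, κ * y.2.2) 0 := by
      rw [h2]
      have hid := hasDerivAt_id' (0 : ℝ)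
      have := (((hid.smul_const
        (y.1 + y.2.2 • a, y.2.1 + T y.1 + y.2.2 • c, κ * y.2.2)).const_add (F u)).add
        ((hid.mul hid).smul_const (b • P₁ (y.2.2 • (q e y.2.1 + q y.1 Z₀ + q Z₀ y.1 + q y.2.1 e)),
          b • P₂ (q y.1 y.1 + y.2.2 • (q Z₀ y.2.1 + q y.2.1 Z₀)),
          b * τ (y.2.2 • (q e y.2.1 + q y.1 Z₀ + q Z₀ y.1 + q y.2.1 e))))).add
        (((hid.mul hid).mul hid).smul_const (b • P₁ (y.2.2 • (q y.1 y.2.1 + q y.2.1 y.1)),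
          b • P₂ (y.2.2 • q y.2.1 y.2.1),
          b * τ (y.2.2 • (q y.1 y.2.1 + q y.2.1 y.1))))
      exact this.congr_deriv (by simp)
    exact h1.unique h3
  let ψ := hF.implicitFunctionOfProdDomain hinv
  have hψd := hF.hasStrictFDerivAt_implicitFunctionOfProdDomain hinv
  have hψ0 : ψ 0 = (e, Z₀, 0) :=
    (hF.eventually_apply_eq_iff_implicitFunctionOfProdDomain hinv).self_of_nhds.mp rfl
  have hev := hF.eventually_apply_implicitFunctionOfProdDomain hinv
  have hdiff : DifferentiableAt ℝ ψ 0 := hψd.hasFDerivAt.differentiableAt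
  have hO : (fun x => ψ x - (e, Z₀, 0)) =O[𝓝 0] fun x : ℝ × ℝ × ℝ => x := by
    simpa [hψ0] using hdiff.isBigO_sub
  have hOV : (fun x => (ψ x).1 - e) =O[𝓝 0] fun x : ℝ × ℝ × ℝ => x :=
    (isBigO_of_le _ fun x => norm_fst_le (ψ x - (e, Z₀, 0))).trans hO
  have hOρ : (fun x => (ψ x).2.2) =O[𝓝 0] fun x : ℝ × ℝ × ℝ => x := by
    refine (isBigO_of_le _ fun x => ?_).trans hO
    have h : (ψ x - (e, Z₀, 0)).2.2 = (ψ x).2.2 := by simp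
    rw [← h]
    exact (norm_snd_le (ψ x - (e, Z₀, 0)).2).trans (norm_snd_le (ψ x - (e, Z₀, 0)))
  have hOZ : (fun x => (ψ x).2.1) =O[𝓝 0] fun _ : ℝ × ℝ × ℝ => (1 : ℝ) :=
    (hdiff.continuousAt.snd.fst).isBigO_one ℝ
  have hOμ : (fun x : ℝ × ℝ × ℝ => x.1) =O[𝓝 0] fun x : ℝ × ℝ × ℝ => x :=
    isBigO_of_le _ fun x => norm_fst_le x
  have hOν : (fun x : ℝ × ℝ × ℝ => x.2.1) =O[𝓝 0] fun x : ℝ × ℝ × ℝ => x :=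
    isBigO_of_le _ fun x => (norm_fst_le x.2).trans (norm_snd_le x)
  have hOB : (fun x : ℝ × ℝ × ℝ => x.2.2) =O[𝓝 0] fun x : ℝ × ℝ × ℝ => x :=
    isBigO_of_le _ fun x => (norm_snd_le x.2).trans (norm_snd_le x)
  -- The principal part minus the exact resonant expression, which vanishes on the branch, is a sum
  -- of products of two small factors: a parameter times `V - e` (`e1`), products of two parameters
  -- (`e2`), and `ρ` times the deviation of its coefficient from `κ` (`e3`).
  have key : (fun x : ℝ × ℝ × ℝ => κ * (ψ x).2.2 + (x.1 * τ (T₁ e) + x.2.1 * τ (T₂ e)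
        + b * x.1 * τ (T₃ e) + b * x.2.2 * τ (T₄ e))
        - τ (oddForcing T₁ T₂ T₃ T₄ q b x.1 x.2.1 x.2.2 (ψ x).1 (ψ x).2.1 (ψ x).2.2))
      =O[𝓝 0] fun x : ℝ × ℝ × ℝ => ‖x‖ * ‖x‖ := by
    have hlin : ∀ S : E →L[ℝ] E, (fun x => τ (S ((ψ x).1 - e))) =O[𝓝 0] fun x => ‖x‖ :=
      fun S => (((τ.comp S).isBigO_comp _ _).trans hOV).norm_right
    have hg : (fun x : ℝ × ℝ × ℝ => (b + x.2.1) * τ (q (ψ x).1 (ψ x).2.1 + q (ψ x).2.1 (ψ x).1) - κ)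
        =O[𝓝 0] fun x => ‖x‖ := by
      have : DifferentiableAt ℝ (fun x : ℝ × ℝ × ℝ => (b + x.2.1) *
          τ (q (ψ x).1 (ψ x).2.1 + q (ψ x).2.1 (ψ x).1)) 0 := by
        fun_prop
      have := this.isBigO_sub
      simp only [hψ0, Prod.fst_zero, Prod.snd_zero, add_zero, ← hκ, sub_zero] at this
      exact this.norm_right
    have e1 := ((hOμ.norm_right.mul (hlin T₁)).add (hOν.norm_right.mul (hlin T₂))).add
      (((hOμ.norm_right.mul (hlin T₃)).const_mul_left b).add
      ((hOB.norm_right.mul (hlin T₄)).const_mul_left b))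
    have hb : ∀ S : E →L[ℝ] E, (fun x => τ (S (ψ x).1)) =O[𝓝 0] fun _ : ℝ × ℝ × ℝ => (1 : ℝ) :=
      fun S => ((τ.comp S).continuous.continuousAt.comp hdiff.continuousAt.fst).isBigO_one ℝ
    have e2 := ((hOν.norm_right.mul hOμ.norm_right).mul (hb T₃)).add
      ((hOν.norm_right.mul hOB.norm_right).mul (hb T₄))
    simp only [mul_one] at e2
    have e3 := hOρ.norm_right.mul hg
    refine ((e1.add (e2.add e3)).neg_left).congr_left fun x => ?_
    simp only [oddForcing, linPert, map_add, map_smul, map_sub, smul_eq_mul]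
    ring
  obtain ⟨C₁, hC₁⟩ := hOV.bound
  obtain ⟨C₂, hC₂⟩ := hOZ.bound
  obtain ⟨C₃, hC₃⟩ := key.bound
  obtain ⟨ε, hε, hall⟩ := Metric.eventually_nhds_iff.mp (hev.and (hC₁.and (hC₂.and hC₃)))
  refine ⟨ε, hε, max 1 (max C₁ (max C₂ C₃)), by positivity, ψ, fun μ ν B hσ => ?_⟩
  have hx : ‖((μ, ν, B) : ℝ × ℝ × ℝ)‖ ≤ |μ| + |ν| + |B| := by
    have := abs_nonneg μ
    have := abs_nonneg ν
    have := abs_nonneg B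
    simp only [Prod.norm_def, Real.norm_eq_abs, sup_le_iff]
    exact ⟨by linarith, by linarith, by linarith⟩
  have hd : dist ((μ, ν, B) : ℝ × ℝ × ℝ) 0 < ε := by
    rw [dist_zero_right]; exact hx.trans_lt hσ
  obtain ⟨h0, h1, h2, h3⟩ := hall hd
  have h0' : F ((μ, ν, B), ψ (μ, ν, B)) = (e, 0, 0) := by rw [← hFu]; exact h0
  obtain ⟨g1, g2, g3⟩ : _ ∧ _ ∧ _ := by simpa only [F, Prod.mk.injEq] using h0'
  refine ⟨_, _, _, rfl, g1, g2, g3, ?_, ?_, ?_⟩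
  · refine h1.trans ?_
    have : C₁ ≤ max 1 (max C₁ (max C₂ C₃)) := by simp
    gcongr
  · refine h2.trans ?_
    simp
  · rw [g3, sub_zero, norm_mul, norm_norm, ← pow_two] at h3
    refine h3.trans ?_
    have : C₃ ≤ max 1 (max C₁ (max C₂ C₃)) := by simp
    gcongr

end Bifurcation

/-! ### Lower bounds for the symbol: absence of small divisors. -/

section Symbol

open Filter Topology

/-- `√(1 + γ α p²)` at an integer wave number. -/
def slope (α γ : ℝ) (p : ℤ) : ℝ := Real.sqrt (1 + γ * α * (p : ℝ) ^ 2)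

/-- The symbol of the diagonalised linear operator at the frequency `(p, q)`. -/
def symbol (α β γ : ℝ) (m : ℤ × ℤ) : ℝ :=
  (m.2 : ℝ) * (1 + α * (m.1 : ℝ) ^ 2) + β * m.1 * slope α γ m.1

theorem slope_neg (α γ : ℝ) (p : ℤ) : slope α γ (-p) = slope α γ p := by simp [slope]

theorem symbol_neg (α β γ : ℝ) (m : ℤ × ℤ) : symbol α β γ (-m) = -symbol α β γ m := by
  simp only [symbol, Prod.fst_neg, Prod.snd_neg, slope_neg]
  push_cast
  ring

theorem one_le_slope {α γ : ℝ} (hα : 0 < α) (hγ : 0 < γ) (p : ℤ) : 1 ≤ slope α γ p := by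
  rw [slope, Real.one_le_sqrt]
  have : 0 ≤ γ * α * (p : ℝ) ^ 2 := by positivity
  linarith

theorem slope_sq {α γ : ℝ} (hα : 0 < α) (hγ : 0 < γ) (p : ℤ) :
    slope α γ p ^ 2 = 1 + γ * α * (p : ℝ) ^ 2 :=
  Real.sq_sqrt (by positivity)

/-- The finitely many terms before the eventual bound have a positive minimum. -/
theorem exists_pos_lower_bound {f : ℕ → ℝ} (hf : ∀ n, 0 < f n)
    (h : ∃ δ > 0, ∀ᶠ n in atTop, δ ≤ f n) : ∃ c > 0, ∀ n, c ≤ f n := by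
  obtain ⟨δ, hδ, h⟩ := h
  obtain ⟨N, hN⟩ := eventually_atTop.mp h
  obtain ⟨i, -, hi⟩ := (Finset.range (N + 1)).exists_min_image f ⟨0, by simp⟩
  refine ⟨min δ (f i), lt_min hδ (hf i), fun n => ?_⟩
  rcases le_total N n with hn | hn
  · exact (min_le_left _ _).trans (hN n hn)
  · exact (min_le_right _ _).trans (hi n (by simpa using Nat.lt_succ_of_le hn))

variable {α β γ : ℝ} {p₀ q₀ : ℕ}

/-- In the variable `x = p⁻²` the ratio is `β √(x + γ α) / (x + α)`, continuous at `x = 0`. -/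
theorem tendsto_slope_ratio (hα : 0 < α) :
    Tendsto (fun p : ℕ => β * p * slope α γ p / (1 + α * (p : ℝ) ^ 2)) atTop
      (𝓝 (β * Real.sqrt (γ * α) / α)) := by
  have h0 : Tendsto (fun p : ℕ => ((p : ℝ)⁻¹) ^ 2) atTop (𝓝 0) := by
    simpa using (tendsto_inv_atTop_nhds_zero_nat (𝕜 := ℝ)).pow 2
  have h1 : Tendsto (fun x : ℝ => β * Real.sqrt (x + γ * α) / (x + α)) (𝓝 0)
      (𝓝 (β * Real.sqrt (0 + γ * α) / (0 + α))) := by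
    refine ContinuousAt.tendsto ?_
    have : (0 : ℝ) + α ≠ 0 := by simpa using hα.ne'
    fun_prop (disch := assumption)
  rw [zero_add, zero_add] at h1
  refine (h1.comp h0).congr' ?_
  filter_upwards [eventually_ge_atTop 1] with p hp
  have hp0 : (0 : ℝ) < p := by exact_mod_cast hp
  have h2 : slope α γ p = p * Real.sqrt (((p : ℝ)⁻¹) ^ 2 + γ * α) := by
    rw [slope, ← Real.sqrt_sq hp0.le, ← Real.sqrt_mul (by positivity), Real.sqrt_sq hp0.le]
    congr 1
    push_cast
    field_simp
  simp only [Function.comp_apply, h2]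
  have h3 : 1 + α * (p : ℝ) ^ 2 = p ^ 2 * (((p : ℝ)⁻¹) ^ 2 + α) := by field_simp
  rw [h3]
  field_simp

/-- For fixed `q`, the symbol divided by `1 + α p²` tends to `q - β √(γ α) / α`, nonzero because `α
q² ≠ γ β²`. Each single term is nonzero off the unique resonance, so compactness in `p` gives the
bound. -/
theorem exists_lower_bound_of_time_freq (hα : 0 < α) (hγ : 0 < γ)
    (hres : resonanceSet α β γ = {(p₀, q₀)}) (hinf : ∀ q : ℕ, α * (q : ℝ) ^ 2 ≠ γ * β ^ 2)
    (q : ℕ) (hq : 1 ≤ q) : ∃ c > 0, ∀ p : ℕ, 1 ≤ p → (p, q) ≠ (p₀, q₀) →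
      c * (1 + α * (p : ℝ) ^ 2) ≤ |q * (1 + α * (p : ℝ) ^ 2) - β * p * slope α γ p| := by
  have hD : ∀ p : ℕ, 0 < 1 + α * (p : ℝ) ^ 2 := fun p => by positivity
  have hne : (q : ℝ) - β * Real.sqrt (γ * α) / α ≠ 0 := by
    intro h
    have h1 : α * q = β * Real.sqrt (γ * α) := by field_simp at h; linarith
    have h2 : α ^ 2 * (q : ℝ) ^ 2 = β ^ 2 * (γ * α) := by
      rw [← Real.sq_sqrt (by positivity : 0 ≤ γ * α), ← mul_pow, h1, mul_pow]
    refine hinf q (mul_left_cancel₀ hα.ne' ?_)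
    linarith
  classical
  -- The value `1` at the excluded indices keeps `f` positive everywhere and costs nothing.
  let f : ℕ → ℝ := fun p => if 1 ≤ p ∧ (p, q) ≠ (p₀, q₀) then
    |q - β * p * slope α γ p / (1 + α * (p : ℝ) ^ 2)| else 1
  have hdiv : ∀ p : ℕ, |q - β * p * slope α γ p / (1 + α * (p : ℝ) ^ 2)| * (1 + α * (p : ℝ) ^ 2)
      = |q * (1 + α * (p : ℝ) ^ 2) - β * p * slope α γ p| := fun p => by
    rw [← abs_of_pos (hD p), ← abs_mul, abs_of_pos (hD p), sub_mul, div_mul_cancel₀ _ (hD p).ne']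
  have hf : ∀ p, 0 < f p := by
    intro p
    by_cases h : 1 ≤ p ∧ (p, q) ≠ (p₀, q₀)
    · simp only [f, if_pos h]
      have hnr : (p, q) ∉ resonanceSet α β γ := by rw [hres]; exact h.2
      have : |q * (1 + α * (p : ℝ) ^ 2) - β * p * slope α γ p| ≠ 0 := by
        rw [abs_ne_zero]
        intro h0
        exact hnr ⟨h.1, hq, by simpa [slope] using h0⟩
      rw [← hdiv] at this
      exact lt_of_le_of_ne (abs_nonneg _) (left_ne_zero_of_mul this).symm
    · simp only [f, if_neg h]
      exact one_pos
  obtain ⟨c, hc, hcf⟩ := exists_pos_lower_bound hf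
    ⟨min 1 (|(q : ℝ) - β * Real.sqrt (γ * α) / α| / 2), by positivity, by
      have ht := ((tendsto_const_nhds (x := (q : ℝ))).sub
        (tendsto_slope_ratio (β := β) (γ := γ) hα)).abs
      filter_upwards [ht.eventually (eventually_ge_nhds (half_lt_self (abs_pos.mpr hne)))] with p hp
      by_cases h : 1 ≤ p ∧ (p, q) ≠ (p₀, q₀)
      · simp only [f, if_pos h]; exact (min_le_right _ _).trans hp
      · simp only [f, if_neg h]; exact min_le_left _ _⟩
  refine ⟨c, hc, fun p hp hpq => ?_⟩
  rw [← hdiv]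
  refine mul_le_mul_of_nonneg_right ?_ (hD p).le
  have := hcf p
  simpa only [f, if_pos (And.intro hp hpq)] using this

/-- From `2 |p| s ≤ p² + s²`; the constant only converts the result into a multiple of `1 + α p²`.
-/
theorem mul_slope_le (hα : 0 < α) (hγ : 0 < γ) (p : ℤ) :
    |(p : ℝ)| * slope α γ p ≤ (1 / 2 + (1 + γ * α) / (2 * α)) * (1 + α * (p : ℝ) ^ 2) := by
  have h1 := sq_nonneg (|(p : ℝ)| - slope α γ p)
  have h2 := slope_sq hα hγ p
  have h3 := sq_abs (p : ℝ)
  have h4 : (1 / 2 + (1 + γ * α) / (2 * α)) * (1 + α * (p : ℝ) ^ 2) =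
      (1 + (1 + γ * α) * (p : ℝ) ^ 2) / 2 + (α * (p : ℝ) ^ 2 / 2 + (1 + γ * α) / (2 * α)) := by
    field_simp
    ring
  rw [h4]
  have h5 : 0 ≤ α * (p : ℝ) ^ 2 / 2 + (1 + γ * α) / (2 * α) := by positivity
  nlinarith

/-- Uniformity in `q`: beyond a threshold `N` the term `q (1 + α p²)` is at least twice the other
one, and below `N` finitely many bounds at fixed `q` are combined. -/
theorem exists_lower_bound_of_opposite_signs (hα : 0 < α) (hβ : 0 < β) (hγ : 0 < γ)
    (hres : resonanceSet α β γ = {(p₀, q₀)}) (hinf : ∀ q : ℕ, α * (q : ℝ) ^ 2 ≠ γ * β ^ 2) :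
    ∃ c > 0, ∀ p q : ℕ, 1 ≤ p → 1 ≤ q → (p, q) ≠ (p₀, q₀) →
      c * ((1 + q) * (p : ℝ) ^ 2) ≤ |q * (1 + α * (p : ℝ) ^ 2) - β * p * slope α γ p| := by
  choose! c hc hcq using exists_lower_bound_of_time_freq hα hγ hres hinf
  let f : ℕ → ℝ := fun q => if 1 ≤ q then c q / (1 + q) else 1
  have hf : ∀ q, 0 < f q := by
    intro q
    by_cases h : 1 ≤ q
    · simp only [f, if_pos h]
      have := hc q h
      positivity
    · simp [f, if_neg h]
  obtain ⟨N, hN⟩ := exists_nat_gt (2 * β * (1 / 2 + (1 + γ * α) / (2 * α)))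
  classical
  obtain ⟨d, hd, hdf⟩ := exists_pos_lower_bound (f := fun q => if q < N then f q else 1)
    (fun q => by split_ifs; exacts [hf q, one_pos])
    ⟨1, one_pos, by
      filter_upwards [eventually_ge_atTop N] with q hq
      simp [not_lt.mpr hq]⟩
  -- The factor `1 / 4` gives `(1 + q) / 4 ≤ q / 2` for `q ≥ 1`, for use when `q ≥ N`; the factor
  -- `α` replaces `1 + α p²` by `p²`.
  refine ⟨min d (1 / 4) * α, by positivity, fun p q hp hq hpq => ?_⟩
  have hDp : α * (p : ℝ) ^ 2 ≤ 1 + α * (p : ℝ) ^ 2 := by linarith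
  have hDpos : 0 < 1 + α * (p : ℝ) ^ 2 := by positivity
  have hq1 : (1 : ℝ) ≤ q := by exact_mod_cast hq
  have hle : min d (1 / 4) * α * ((1 + q) * (p : ℝ) ^ 2) ≤
      min d (1 / 4) * (1 + q) * (1 + α * (p : ℝ) ^ 2) := by
    calc _ = min d (1 / 4) * (1 + q) * (α * (p : ℝ) ^ 2) := by ring
      _ ≤ _ := by gcongr
  refine hle.trans ?_
  rcases lt_or_ge q N with hqN | hqN
  · have h1 : min d (1 / 4) ≤ c q / (1 + q) := by
      refine (min_le_left _ _).trans ?_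
      simpa [f, hqN, hq] using hdf q
    rw [le_div_iff₀ (by positivity)] at h1
    exact (mul_le_mul_of_nonneg_right h1 hDpos.le).trans (hcq q hq p hp hpq)
  · have h1 := mul_slope_le hα hγ (p : ℤ)
    rw [Int.cast_natCast, abs_of_nonneg (Nat.cast_nonneg p)] at h1
    have h2 : (N : ℝ) ≤ q := by exact_mod_cast hqN
    have h3 : β * p * slope α γ p ≤ q / 2 * (1 + α * (p : ℝ) ^ 2) := by
      calc β * p * slope α γ p = β * (p * slope α γ p) := by ring
        _ ≤ β * ((1 / 2 + (1 + γ * α) / (2 * α)) * (1 + α * (p : ℝ) ^ 2)) := by gcongr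
        _ = (2 * β * (1 / 2 + (1 + γ * α) / (2 * α))) / 2 * (1 + α * (p : ℝ) ^ 2) := by ring
        _ ≤ q / 2 * (1 + α * (p : ℝ) ^ 2) := by
          gcongr
          linarith
    refine le_trans ?_ (le_abs_self _)
    have h4 : min d (1 / 4) * (1 + q) ≤ q / 2 := by
      have : min d (1 / 4) * (1 + q) ≤ 1 / 4 * (1 + q) := by
        gcongr
        exact min_le_right _ _
      linarith
    have := mul_le_mul_of_nonneg_right h4 hDpos.le
    linarith

theorem mul_abs_le_slope (hα : 0 < α) (hγ : 0 < γ) (p : ℤ) :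
    Real.sqrt (γ * α) * |(p : ℝ)| ≤ slope α γ p := by
  rw [slope, ← Real.sqrt_sq_eq_abs, ← Real.sqrt_mul (by positivity)]
  exact Real.sqrt_le_sqrt (by linarith)

/-- For `p > 0` and `q ≥ 0` both terms of the symbol are nonnegative and `s ≥ √(γ α) |p|` suffices;
for `q < 0` they compete and the previous bound applies. The case `p < 0` follows by oddness of the
symbol. -/
theorem exists_symbol_lower_bound (hα : 0 < α) (hβ : 0 < β) (hγ : 0 < γ)
    (hres : resonanceSet α β γ = {(p₀, q₀)}) (hinf : ∀ q : ℕ, α * (q : ℝ) ^ 2 ≠ γ * β ^ 2) :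
    ∃ c > 0, ∀ m : ℤ × ℤ, m.1 ≠ 0 → m ≠ ((p₀ : ℤ), -(q₀ : ℤ)) → m ≠ (-(p₀ : ℤ), (q₀ : ℤ)) →
      c * ((1 + |(m.2 : ℝ)|) * (m.1 : ℝ) ^ 2) ≤ |symbol α β γ m| := by
  obtain ⟨c, hc, hcb⟩ := exists_lower_bound_of_opposite_signs hα hβ hγ hres hinf
  have hg : 0 < Real.sqrt (γ * α) := Real.sqrt_pos.mpr (by positivity)
  set d := min c (min α (β * Real.sqrt (γ * α))) with hd
  have hd0 : 0 < d := by positivity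
  have hdc : d ≤ c := min_le_left _ _
  have hdα : d ≤ α := (min_le_right _ _).trans (min_le_left _ _)
  have hdβ : d ≤ β * Real.sqrt (γ * α) := (min_le_right _ _).trans (min_le_right _ _)
  have main : ∀ (p : ℕ) (q : ℤ), 1 ≤ p → ((p : ℤ), q) ≠ ((p₀ : ℤ), -(q₀ : ℤ)) →
      d * ((1 + |(q : ℝ)|) * (p : ℝ) ^ 2) ≤ |symbol α β γ ((p : ℤ), q)| := by
    intro p q hp hne
    have hp0 : (0 : ℝ) < p := by exact_mod_cast hp
    rcases lt_or_ge q 0 with hq | hq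
    · obtain ⟨r, rfl⟩ : ∃ r : ℕ, q = -(r : ℤ) := ⟨q.natAbs, by omega⟩
      have h1 := hcb p r hp (by omega) (by
        rintro ⟨⟩
        exact hne rfl)
      refine (mul_le_mul_of_nonneg_right hdc (by positivity)).trans ?_
      have h2 : |symbol α β γ ((p : ℤ), -(r : ℤ))| =
          |r * (1 + α * (p : ℝ) ^ 2) - β * p * slope α γ p| := by
        rw [← abs_neg]
        congr 1
        simp only [symbol]
        push_cast
        ring
      rw [h2]
      simpa using h1
    · have hq' : (0 : ℝ) ≤ q := by exact_mod_cast hq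
      refine le_trans ?_ (le_abs_self _)
      rw [abs_of_nonneg hq']
      have h1 := mul_abs_le_slope hα hγ (p : ℤ)
      rw [Int.cast_natCast, abs_of_pos hp0] at h1
      have h2 : d * (p : ℝ) ^ 2 ≤ β * p * slope α γ p := by
        calc d * (p : ℝ) ^ 2 ≤ β * Real.sqrt (γ * α) * (p : ℝ) ^ 2 := by gcongr
          _ = β * p * (Real.sqrt (γ * α) * p) := by ring
          _ ≤ _ := by gcongr
      have h3 : q * (d * (p : ℝ) ^ 2) ≤ q * (1 + α * (p : ℝ) ^ 2) := by
        refine mul_le_mul_of_nonneg_left ?_ hq'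
        have : d * (p : ℝ) ^ 2 ≤ α * (p : ℝ) ^ 2 := by gcongr
        linarith
      simp only [symbol, Int.cast_natCast]
      linarith
  refine ⟨d, hd0, fun m hm h1 h2 => ?_⟩
  rcases lt_or_gt_of_ne hm with h | h
  · have := main m.1.natAbs (-m.2) (by omega) (by
      intro h3
      apply h2
      have h4 := congrArg Prod.fst h3
      have h5 := congrArg Prod.snd h3
      simp only at h4 h5
      ext <;> simp only <;> omega)
    have hm' : ((m.1.natAbs : ℤ), -m.2) = -m := by
      ext
      · simp; omega
      · simp
    rw [hm', symbol_neg, abs_neg] at this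
    simpa [Nat.cast_natAbs] using this
  · have := main m.1.natAbs m.2 (by omega) (by
      intro h3
      apply h1
      have h4 := congrArg Prod.fst h3
      have h5 := congrArg Prod.snd h3
      simp only at h4 h5
      ext <;> simp only <;> omega)
    have hm' : ((m.1.natAbs : ℤ), m.2) = m := by
      ext
      · simp; omega
      · simp
    rw [hm'] at this
    simpa [Nat.cast_natAbs] using this

end Symbol

/-! ### Fourier coefficients, parities and symmetrised projections. -/

section Coefficients

theorem seq_add_apply (a b : Seq) (m : ℤ × ℤ) : (a + b) m = a m + b m := rfl

theorem seq_neg_apply (a : Seq) (m : ℤ × ℤ) : (-a) m = -a m := rfl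

theorem seq_smul_apply (c : ℝ) (a : Seq) (m : ℤ × ℤ) : (c • a) m = c * a m := rfl

/-- The Fourier coefficient encoded by a weighted sequence. -/
def coef (k : ℕ) (m : ℤ × ℤ) : Seq →L[ℝ] ℝ := (weight k m)⁻¹ • coordCLM m

theorem coef_apply (k : ℕ) (m : ℤ × ℤ) (a : Seq) : coef k m a = (weight k m)⁻¹ * a m := rfl

theorem coef_modeVec (k : ℕ) (m i : ℤ × ℤ) : coef k m (modeVec k i) = if m = i then 1 else 0 := by
  by_cases h : m = i
  · subst h; simp [coef_apply, modeVec_apply, weight_ne_zero]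
  · simp [coef_apply, modeVec_apply, h]

theorem coef_diagonalOp (k : ℕ) (φ : ℤ × ℤ → ℝ) (C : ℝ) (h : ∀ i, |φ i| ≤ C) (m : ℤ × ℤ)
    (a : Seq) : coef k m (diagonalOp φ C h a) = φ m * coef k m a := by
  simp only [coef_apply, diagonalOp_apply]
  ring

theorem coef_conv_modeVec (k : ℕ) (m i : ℤ × ℤ) (a : Seq) :
    coef k m (conv k (modeVec k i) a) = coef k (m - i) a := by
  have : (coef k m).comp (conv k (modeVec k i)) = coef k (m - i) := by
    refine seq_clm_ext k fun j => ?_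
    simp only [ContinuousLinearMap.comp_apply, conv_modeVec, coef_modeVec]
    simp only [sub_eq_iff_eq_add']
  exact congrArg (fun T => T a) this

theorem conv_comm (k : ℕ) (a b : Seq) : conv k a b = conv k b a := by
  have : conv k = (conv k).flip := by
    refine seq_bilinear_ext k fun i j => ?_
    simp [conv_modeVec, add_comm]
  simpa using congrArg (fun T => T a b) this

theorem abs_coef_mul_weight (k : ℕ) (m : ℤ × ℤ) (a : Seq) :
    weight k m * |coef k m a| = |a m| := by
  rw [coef_apply, abs_mul, abs_inv, abs_of_pos (weight_pos k m), ← mul_assoc,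
    mul_inv_cancel₀ (weight_ne_zero k m), one_mul]

/-- The reflection `p ↦ -p` of frequencies. -/
def flipX (m : ℤ × ℤ) : ℤ × ℤ := (-m.1, m.2)

theorem flipX_involutive : Function.Involutive flipX := fun m => by simp [flipX]

/-- Reflection in `x` of a sequence of coefficients. -/
def reflX : Seq →L[ℝ] Seq := reindexOp flipX

/-- Reflection in `x` and `t` of a sequence of coefficients. -/
def reflXT : Seq →L[ℝ] Seq := reindexOp Neg.neg

/-- The part of a sequence that is even in `x`. -/
def evenPart : Seq →L[ℝ] Seq := (2⁻¹ : ℝ) • (ContinuousLinearMap.id ℝ Seq + reflX)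

/-- The part of a sequence that is odd in `x`. -/
def oddPart : Seq →L[ℝ] Seq := (2⁻¹ : ℝ) • (ContinuousLinearMap.id ℝ Seq - reflX)

@[simp] theorem reflX_apply (a : Seq) (m : ℤ × ℤ) : reflX a m = a (flipX m) :=
  reindexOp_apply flipX_involutive a m

@[simp] theorem reflXT_apply (a : Seq) (m : ℤ × ℤ) : reflXT a m = a (-m) :=
  reindexOp_apply neg_involutive a m

@[simp] theorem evenPart_apply (a : Seq) (m : ℤ × ℤ) :
    evenPart a m = (a m + a (flipX m)) / 2 := by
  change 2⁻¹ * (a m + reflX a m) = _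
  rw [reflX_apply, inv_mul_eq_div]

@[simp] theorem oddPart_apply (a : Seq) (m : ℤ × ℤ) :
    oddPart a m = (a m - a (flipX m)) / 2 := by
  change 2⁻¹ * (a m - reflX a m) = _
  rw [reflX_apply, inv_mul_eq_div]

theorem weight_flipX (k : ℕ) (m : ℤ × ℤ) : weight k (flipX m) = weight k m := weight_reflect k m

theorem coef_evenPart (k : ℕ) (m : ℤ × ℤ) (a : Seq) :
    coef k m (evenPart a) = (coef k m a + coef k (flipX m) a) / 2 := by
  simp only [coef_apply, evenPart_apply, weight_flipX]
  ring

theorem coef_oddPart (k : ℕ) (m : ℤ × ℤ) (a : Seq) :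
    coef k m (oddPart a) = (coef k m a - coef k (flipX m) a) / 2 := by
  simp only [coef_apply, oddPart_apply, weight_flipX]
  ring

theorem coef_reflXT (k : ℕ) (m : ℤ × ℤ) (a : Seq) : coef k m (reflXT a) = coef k (-m) a := by
  simp only [coef_apply, reflXT_apply, weight_neg]

theorem reflXT_conv (k : ℕ) (a b : Seq) :
    reflXT (conv k a b) = conv k (reflXT a) (reflXT b) :=
  reindexOp_conv k (weight_neg k) (fun m n => neg_add m n) a b

theorem reflX_conv (k : ℕ) (a b : Seq) : reflX (conv k a b) = conv k (reflX a) (reflX b) :=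
  reindexOp_conv k (weight_flipX k) (fun m n => by simp [flipX, add_comm]) a b

theorem reflX_evenPart (a : Seq) : reflX (evenPart a) = evenPart a := by
  ext m
  simp [flipX_involutive m, add_comm]

theorem reflX_oddPart (a : Seq) : reflX (oddPart a) = -oddPart a := by
  ext m
  simp only [reflX_apply, oddPart_apply, flipX_involutive m, lp.coeFn_neg, Pi.neg_apply]
  ring

open Classical in
/-- Symmetrisation and restriction to a set of frequencies. -/
def proj (S : Set (ℤ × ℤ)) : Seq →L[ℝ] Seq :=
  ((2⁻¹ : ℝ) • (ContinuousLinearMap.id ℝ Seq + reflXT)).comp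
    (diagonalOp (fun m => if m ∈ S then 1 else 0) 1 (fun m => by split_ifs <;> simp))

open Classical in
theorem proj_apply (S : Set (ℤ × ℤ)) (a : Seq) (m : ℤ × ℤ) :
    proj S a m = ((if m ∈ S then a m else 0) + (if -m ∈ S then a (-m) else 0)) / 2 := by
  rw [proj, ContinuousLinearMap.comp_apply]
  have h : ∀ i : ℤ × ℤ, |(if i ∈ S then 1 else 0 : ℝ)| ≤ 1 := fun i => by split_ifs <;> simp
  change 2⁻¹ * (diagonalOp _ 1 h a m + reflXT (diagonalOp _ 1 h a) m) = _
  simp only [reflXT_apply, diagonalOp_apply, inv_mul_eq_div, ite_mul, one_mul, zero_mul]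

end Coefficients

/-! ### The bifurcation problem for the scalar unknown `v`. -/

/-- The data of the bifurcation problem: the base parameters, the unique resonance and the
resulting lower bound of the symbol. -/
structure ResonantData where
  α : ℝ
  β : ℝ
  γ : ℝ
  p₀ : ℕ
  q₀ : ℕ
  k : ℕ
  c : ℝ
  hα : 0 < α
  hβ : 0 < β
  hγ : 0 < γ
  hγ' : γ < 1
  hp₀ : 1 ≤ p₀
  hq₀ : 1 ≤ q₀
  hc : 0 < c
  resonance : (q₀ : ℝ) * (1 + α * (p₀ : ℝ) ^ 2) = β * p₀ * slope α γ p₀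
  bound : ∀ m : ℤ × ℤ, m.1 ≠ 0 → m ≠ ((p₀ : ℤ), -(q₀ : ℤ)) → m ≠ (-(p₀ : ℤ), (q₀ : ℤ)) →
    c * ((1 + |(m.2 : ℝ)|) * (m.1 : ℝ) ^ 2) ≤ |symbol α β γ m|

namespace ResonantData

variable (R : ResonantData)

/-- The resonant frequency. -/
def m₀ : ℤ × ℤ := (R.p₀, -R.q₀)

/-- The symbol, replaced by `1` and `-1` at the two resonant frequencies. -/
def regSymbol (m : ℤ × ℤ) : ℝ :=
  if m = R.m₀ then 1 else if m = -R.m₀ then -1 else symbol R.α R.β R.γ m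

theorem m₀_ne_neg : R.m₀ ≠ -R.m₀ := by
  have := R.hp₀
  intro h
  have h1 := congrArg Prod.fst h
  simp only [m₀, Prod.neg_mk] at h1
  omega

theorem regSymbol_m₀ : R.regSymbol R.m₀ = 1 := if_pos rfl

theorem regSymbol_neg_m₀ : R.regSymbol (-R.m₀) = -1 := by
  rw [regSymbol, if_neg R.m₀_ne_neg.symm, if_pos rfl]

theorem regSymbol_of_ne {m : ℤ × ℤ} (h : m ≠ R.m₀) (h' : m ≠ -R.m₀) :
    R.regSymbol m = symbol R.α R.β R.γ m := by
  rw [regSymbol, if_neg h, if_neg h']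

theorem symbol_m₀ : symbol R.α R.β R.γ R.m₀ = 0 := by
  have := R.resonance
  simp only [symbol, m₀]
  push_cast
  linarith

/-- At the two resonant frequencies the regularised symbol has modulus `1` and `(1 + |q|) p²` equals
`K`, so there the constant `K⁻¹` works. -/
theorem regSymbol_lower : ∃ c > 0, ∀ m : ℤ × ℤ, m.1 ≠ 0 →
    c * ((1 + |(m.2 : ℝ)|) * (m.1 : ℝ) ^ 2) ≤ |R.regSymbol m| := by
  have hp : (0 : ℝ) < R.p₀ := by exact_mod_cast R.hp₀
  set K : ℝ := (1 + R.q₀) * (R.p₀ : ℝ) ^ 2 with hK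
  have hK0 : 0 < K := by positivity
  have hm0 : (1 + |(R.m₀.2 : ℝ)|) * (R.m₀.1 : ℝ) ^ 2 = K := by simp [m₀, hK]
  refine ⟨min R.c K⁻¹, lt_min R.hc (inv_pos.mpr hK0), fun m hm => ?_⟩
  by_cases h : m = R.m₀ ∨ m = -R.m₀
  · have h1 : (1 + |(m.2 : ℝ)|) * (m.1 : ℝ) ^ 2 = K := by
      rcases h with h | h
      · rw [h, hm0]
      · rw [h, ← hm0]; simp
    have h2 : |R.regSymbol m| = 1 := by
      rcases h with h | h
      · rw [h, regSymbol_m₀, abs_one]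
      · rw [h, regSymbol_neg_m₀, abs_neg, abs_one]
    rw [h1, h2]
    calc min R.c K⁻¹ * K ≤ K⁻¹ * K := by gcongr; exact min_le_right _ _
      _ = 1 := inv_mul_cancel₀ hK0.ne'
  · push Not at h
    rw [R.regSymbol_of_ne h.1 h.2]
    refine (mul_le_mul_of_nonneg_right (min_le_left _ _) (by positivity)).trans
      (R.bound m hm h.1 ?_)
    intro h2
    exact h.2 (by rw [h2]; simp [m₀])

theorem regSymbol_ne_zero {m : ℤ × ℤ} (hm : m.1 ≠ 0) : R.regSymbol m ≠ 0 := by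
  obtain ⟨c, hc, h⟩ := R.regSymbol_lower
  have : (0 : ℝ) < c * ((1 + |(m.2 : ℝ)|) * (m.1 : ℝ) ^ 2) := by positivity
  exact abs_pos.mp (this.trans_le (h m hm))

theorem regSymbol_neg (m : ℤ × ℤ) : R.regSymbol (-m) = -R.regSymbol m := by
  by_cases h : m = R.m₀
  · rw [h, regSymbol_m₀, regSymbol_neg_m₀]
  · by_cases h' : m = -R.m₀
    · rw [h', neg_neg, regSymbol_m₀, regSymbol_neg_m₀, neg_neg]
    · rw [R.regSymbol_of_ne h h', R.regSymbol_of_ne (fun h2 => h' (by rw [← h2, neg_neg]))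
        (fun h2 => h (neg_injective h2)), symbol_neg]

/-- A numerator divided by the regularised symbol, without the modes `p = 0`. -/
def quotSymbol (φ : ℤ × ℤ → ℝ) (m : ℤ × ℤ) : ℝ := if m.1 = 0 then 0 else φ m / R.regSymbol m

/-- Numerator and denominator have the same scale `(1 + |q|) p²`: the resulting multipliers are
bounded and no derivative is lost. -/
theorem quotSymbol_bound {φ : ℤ × ℤ → ℝ} (h : ∃ K, ∀ m : ℤ × ℤ,
    |φ m| ≤ K * ((1 + |(m.2 : ℝ)|) * (m.1 : ℝ) ^ 2)) : ∃ C, ∀ m, |R.quotSymbol φ m| ≤ C := by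
  obtain ⟨K, hK⟩ := h
  obtain ⟨c, hc, hb⟩ := R.regSymbol_lower
  refine ⟨|K| / c, fun m => ?_⟩
  by_cases hm : m.1 = 0
  · simp only [quotSymbol, if_pos hm, abs_zero]; positivity
  · have h0 : (0 : ℝ) < (1 + |(m.2 : ℝ)|) * (m.1 : ℝ) ^ 2 := by positivity
    rw [quotSymbol, if_neg hm, abs_div, div_le_div_iff₀ (abs_pos.mpr (R.regSymbol_ne_zero hm)) hc]
    calc |φ m| * c ≤ |K| * ((1 + |(m.2 : ℝ)|) * (m.1 : ℝ) ^ 2) * c := by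
          gcongr
          exact (hK m).trans (by gcongr; exact le_abs_self K)
      _ = |K| * (c * ((1 + |(m.2 : ℝ)|) * (m.1 : ℝ) ^ 2)) := by ring
      _ ≤ |K| * |R.regSymbol m| := by gcongr; exact hb m hm

/-- `q p²`. -/
def num₁ (m : ℤ × ℤ) : ℝ := (m.2 : ℝ) * (m.1 : ℝ) ^ 2

/-- `p √(1 + γ α p²)`. -/
def num₂ (m : ℤ × ℤ) : ℝ := (m.1 : ℝ) * slope R.α R.γ m.1

/-- `γ p³ / √(1 + γ α p²)`. -/
def num₃ (m : ℤ × ℤ) : ℝ := R.γ * (m.1 : ℝ) ^ 3 / slope R.α R.γ m.1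

theorem num₁_bound : ∃ K, ∀ m : ℤ × ℤ, |num₁ m| ≤ K * ((1 + |(m.2 : ℝ)|) * (m.1 : ℝ) ^ 2) := by
  refine ⟨1, fun m => ?_⟩
  rw [num₁, abs_mul, abs_of_nonneg (sq_nonneg (m.1 : ℝ)), one_mul]
  gcongr
  linarith

theorem slope_le (p : ℤ) (hp : p ≠ 0) :
    slope R.α R.γ p ≤ (1 + R.γ * R.α) * |(p : ℝ)| := by
  have h1 : (1 : ℝ) ≤ |(p : ℝ)| := by exact_mod_cast Int.one_le_abs hp
  have hga : 0 < R.γ * R.α := mul_pos R.hγ R.hα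
  rw [slope, Real.sqrt_le_left (by positivity), mul_pow, sq_abs]
  have h2 : (1 : ℝ) ≤ (p : ℝ) ^ 2 := by rw [← sq_abs]; nlinarith
  nlinarith [mul_pos hga hga, mul_nonneg (mul_pos hga hga).le (by linarith : (0 : ℝ) ≤ (p : ℝ) ^ 2),
    mul_nonneg hga.le (by linarith : (0 : ℝ) ≤ (p : ℝ) ^ 2)]

theorem num₂_bound : ∃ K, ∀ m : ℤ × ℤ, |R.num₂ m| ≤ K * ((1 + |(m.2 : ℝ)|) * (m.1 : ℝ) ^ 2) := by
  have hga : 0 < R.γ * R.α := mul_pos R.hγ R.hα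
  refine ⟨1 + R.γ * R.α, fun m => ?_⟩
  by_cases hm : m.1 = 0
  · simp [num₂, hm]
  · have hs : 0 ≤ slope R.α R.γ m.1 := Real.sqrt_nonneg _
    rw [num₂, abs_mul, abs_of_nonneg hs]
    calc |(m.1 : ℝ)| * slope R.α R.γ m.1 ≤ |(m.1 : ℝ)| * ((1 + R.γ * R.α) * |(m.1 : ℝ)|) := by
          gcongr; exact R.slope_le m.1 hm
      _ = (1 + R.γ * R.α) * (1 * (m.1 : ℝ) ^ 2) := by rw [← sq_abs (m.1 : ℝ)]; ring
      _ ≤ _ := by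
        gcongr
        linarith [abs_nonneg (m.2 : ℝ)]

/-- The bound `√(γ α) |p| ≤ s` lets the denominator absorb one of the three powers of `p`. -/
theorem num₃_bound : ∃ K, ∀ m : ℤ × ℤ, |R.num₃ m| ≤ K * ((1 + |(m.2 : ℝ)|) * (m.1 : ℝ) ^ 2) := by
  have hga : 0 < R.γ * R.α := mul_pos R.hγ R.hα
  have hg : 0 < Real.sqrt (R.γ * R.α) := Real.sqrt_pos.mpr hga
  have hγ := R.hγ
  refine ⟨R.γ / Real.sqrt (R.γ * R.α), fun m => ?_⟩
  have hs1 := one_le_slope R.hα R.hγ m.1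
  have hs : 0 < slope R.α R.γ m.1 := one_pos.trans_le hs1
  rw [num₃, abs_div, abs_of_pos hs, abs_mul, abs_of_pos R.hγ, abs_pow, div_le_iff₀ hs]
  calc R.γ * |(m.1 : ℝ)| ^ 3
      = R.γ / Real.sqrt (R.γ * R.α) * (1 * (m.1 : ℝ) ^ 2) *
        (Real.sqrt (R.γ * R.α) * |(m.1 : ℝ)|) := by
        rw [← sq_abs (m.1 : ℝ)]; field_simp
    _ ≤ R.γ / Real.sqrt (R.γ * R.α) * ((1 + |(m.2 : ℝ)|) * (m.1 : ℝ) ^ 2) *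
        slope R.α R.γ m.1 := by
        gcongr
        · linarith [abs_nonneg (m.2 : ℝ)]
        · exact mul_abs_le_slope R.hα R.hγ m.1

/-- The multiplier with symbol `q p² / λ`. -/
def op₁ : Seq →L[ℝ] Seq :=
  diagonalOp (R.quotSymbol num₁) _ (R.quotSymbol_bound num₁_bound).choose_spec

/-- The multiplier with symbol `p √(1 + γ α p²) / λ`. -/
def op₂ : Seq →L[ℝ] Seq :=
  diagonalOp (R.quotSymbol R.num₂) _ (R.quotSymbol_bound R.num₂_bound).choose_spec

/-- The multiplier with symbol `γ p³ / (√(1 + γ α p²) λ)`. -/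
def op₃ : Seq →L[ℝ] Seq :=
  diagonalOp (R.quotSymbol R.num₃) _ (R.quotSymbol_bound R.num₃_bound).choose_spec

/-- The multiplier with symbol `1 / √(1 + γ α p²)`. -/
def smoothing : Seq →L[ℝ] Seq :=
  diagonalOp (fun m => (slope R.α R.γ m.1)⁻¹) 1 (fun m => by
    have := one_le_slope R.hα R.hγ m.1
    rw [abs_inv, abs_of_pos (one_pos.trans_le this)]
    exact inv_le_one_of_one_le₀ this)

/-- The quadratic nonlinearity of the diagonalised system. -/
def nonlin : Seq →L[ℝ] Seq →L[ℝ] Seq :=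
  (conv R.k).bilinearComp oddPart (R.smoothing.comp evenPart) +
    (2⁻¹ : ℝ) • (ContinuousLinearMap.compL ℝ Seq Seq Seq R.smoothing).comp
      ((conv R.k).bilinearComp oddPart oddPart)

theorem nonlin_apply (a b : Seq) : R.nonlin a b =
    conv R.k (oddPart a) (R.smoothing (evenPart b)) +
      (2⁻¹ : ℝ) • R.smoothing (conv R.k (oddPart a) (oddPart b)) := by
  simp [nonlin]

/-- The frequencies whose first component is an odd multiple of `p₀`. -/
def oddGrade : Set (ℤ × ℤ) := {m | (2 * R.p₀ : ℤ) ∣ m.1 - R.p₀}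

/-- The frequencies whose first component is an even multiple of `p₀`. -/
def evenGrade : Set (ℤ × ℤ) := {m | (2 * R.p₀ : ℤ) ∣ m.1}

/-- The projection on the non-resonant modes of odd grade. -/
def projOdd : Seq →L[ℝ] Seq := proj (R.oddGrade \ {R.m₀, -R.m₀})

/-- The projection on the modes of even grade with `p ≠ 0`. -/
def projEven : Seq →L[ℝ] Seq := proj {m | m ∈ R.evenGrade ∧ m.1 ≠ 0}

/-- The kernel vector of the linearisation. -/
def kerVec : Seq := slope R.α R.γ R.p₀ • (modeVec R.k R.m₀ + modeVec R.k (-R.m₀))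

/-- The quadratic form of the fixed point equation. -/
def quad : Seq →L[ℝ] Seq →L[ℝ] Seq := (ContinuousLinearMap.compL ℝ Seq Seq Seq R.op₂).comp R.nonlin

theorem quad_apply (a b : Seq) : R.quad a b = R.op₂ (R.nonlin a b) := rfl

/-- The second order part of the bifurcating solution. -/
def secondOrder : Seq := -(R.β • R.projEven (R.quad R.kerVec R.kerVec))

end ResonantData

theorem oddPart_modeVec (k : ℕ) (i : ℤ × ℤ) :
    oddPart (modeVec k i) = (2⁻¹ : ℝ) • (modeVec k i - modeVec k (flipX i)) := by
  simp [oddPart, reflX, reindexOp_modeVec k (weight_flipX k)]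

theorem evenPart_modeVec (k : ℕ) (i : ℤ × ℤ) :
    evenPart (modeVec k i) = (2⁻¹ : ℝ) • (modeVec k i + modeVec k (flipX i)) := by
  simp [evenPart, reflX, reindexOp_modeVec k (weight_flipX k)]

theorem coef_proj_of_mem (k : ℕ) {S : Set (ℤ × ℤ)} {m : ℤ × ℤ} (h : m ∈ S) (h' : -m ∈ S)
    (a : Seq) : coef k m (proj S a) = (coef k m a + coef k (-m) a) / 2 := by
  simp only [coef_apply, proj_apply, if_pos h, if_pos h', weight_neg]
  ring

theorem coef_proj_of_notMem (k : ℕ) {S : Set (ℤ × ℤ)} {m : ℤ × ℤ} (h : m ∉ S) (h' : -m ∉ S)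
    (a : Seq) : coef k m (proj S a) = 0 := by
  simp [coef_apply, proj_apply, h, h']

theorem coef_reflXT_eq (k : ℕ) (m : ℤ × ℤ) {a : Seq} (h : reflXT a = a) :
    coef k (-m) a = coef k m a := by rw [← coef_reflXT, h]

theorem reflXT_diagonalOp {φ : ℤ × ℤ → ℝ} {C : ℝ} {h : ∀ i, |φ i| ≤ C} {a : Seq}
    (hφ : ∀ m, φ (-m) = φ m) (ha : reflXT a = a) :
    reflXT (diagonalOp φ C h a) = diagonalOp φ C h a := by
  ext m
  have : a (-m) = a m := by rw [← reflXT_apply, ha]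
  rw [reflXT_apply, diagonalOp_apply, diagonalOp_apply, this, hφ]

theorem reflXT_reflX (a : Seq) : reflXT (reflX a) = reflX (reflXT a) := by
  ext m
  simp [flipX]

theorem reflXT_evenPart {a : Seq} (ha : reflXT a = a) : reflXT (evenPart a) = evenPart a := by
  rw [evenPart, _root_.smul_apply, _root_.add_apply, map_smul, map_add, reflXT_reflX,
    ContinuousLinearMap.id_apply, ha]

theorem reflXT_oddPart {a : Seq} (ha : reflXT a = a) : reflXT (oddPart a) = oddPart a := by
  rw [oddPart, _root_.smul_apply, _root_.sub_apply, map_smul, map_sub, reflXT_reflX,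
    ContinuousLinearMap.id_apply, ha]

/-! ### Second harmonics and the cubic coefficient. -/

namespace ResonantData

variable (R : ResonantData)

/-- The Fourier coefficient at the frequency `(a p₀, b q₀)`. -/
def gridCoef (a b : ℤ) : Seq →L[ℝ] ℝ := coef R.k (a * R.p₀, b * R.q₀)

theorem m₀_eq : R.m₀ = (1 * (R.p₀ : ℤ), -1 * (R.q₀ : ℤ)) := by simp [m₀]

theorem p₀_ne_zero : (R.p₀ : ℤ) ≠ 0 := by exact_mod_cast (Nat.one_le_iff_ne_zero.mp R.hp₀)

theorem q₀_ne_zero : (R.q₀ : ℤ) ≠ 0 := by exact_mod_cast (Nat.one_le_iff_ne_zero.mp R.hq₀)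

theorem gridCoef_kerVec (a b : ℤ) : R.gridCoef a b R.kerVec =
    if (a = 1 ∧ b = -1) ∨ (a = -1 ∧ b = 1) then slope R.α R.γ R.p₀ else 0 := by
  have h1 : ((a * (R.p₀ : ℤ), b * (R.q₀ : ℤ)) = R.m₀) ↔ (a = 1 ∧ b = -1) := by
    rw [m₀_eq, Prod.mk.injEq, mul_left_inj' R.p₀_ne_zero, mul_left_inj' R.q₀_ne_zero]
  have h2 : ((a * (R.p₀ : ℤ), b * (R.q₀ : ℤ)) = -R.m₀) ↔ (a = -1 ∧ b = 1) := by
    rw [m₀_eq, Prod.neg_mk, ← neg_mul, ← neg_mul, neg_neg, Prod.mk.injEq,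
      mul_left_inj' R.p₀_ne_zero, mul_left_inj' R.q₀_ne_zero]
  simp only [gridCoef, kerVec, map_smul, map_add, coef_modeVec, h1, h2, smul_eq_mul]
  by_cases h3 : a = 1 ∧ b = -1
  · have : ¬(a = -1 ∧ b = 1) := by omega
    simp [h3]
  · by_cases h4 : a = -1 ∧ b = 1
    · simp [h4]
    · simp [h3, h4]

theorem gridCoef_oddPart (a b : ℤ) (v : Seq) : R.gridCoef a b (oddPart v) =
    (R.gridCoef a b v - R.gridCoef (-a) b v) / 2 := by
  simp [gridCoef, coef_oddPart, flipX]

theorem gridCoef_evenPart (a b : ℤ) (v : Seq) : R.gridCoef a b (evenPart v) =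
    (R.gridCoef a b v + R.gridCoef (-a) b v) / 2 := by
  simp [gridCoef, coef_evenPart, flipX]

theorem gridCoef_smoothing (a b : ℤ) (v : Seq) : R.gridCoef a b (R.smoothing v) =
    R.gridCoef a b v / slope R.α R.γ (a * R.p₀) := by
  simp only [gridCoef, smoothing, coef_diagonalOp, div_eq_inv_mul]

/-- The odd part of the kernel vector has the four modes `(±p₀, ±q₀)`, so convolving with it is a
signed sum of four lattice shifts. The same holds for the smoothed even part below, where the slope
cancels. -/
theorem gridCoef_conv_oddPart_kerVec (a b : ℤ) (v : Seq) :
    R.gridCoef a b (conv R.k (oddPart R.kerVec) v) = slope R.α R.γ R.p₀ / 2 *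
      (R.gridCoef (a - 1) (b + 1) v + R.gridCoef (a + 1) (b - 1) v
        - R.gridCoef (a + 1) (b + 1) v - R.gridCoef (a - 1) (b - 1) v) := by
  simp only [kerVec, map_smul, map_add, oddPart_modeVec, _root_.add_apply, _root_.smul_apply,
    map_sub, _root_.sub_apply, gridCoef, coef_conv_modeVec, smul_eq_mul, m₀, flipX,
    Prod.mk_sub_mk, Prod.neg_mk]
  ring_nf

theorem gridCoef_conv_smoothing_kerVec (a b : ℤ) (v : Seq) :
    R.gridCoef a b (conv R.k v (R.smoothing (evenPart R.kerVec))) = 1 / 2 *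
      (R.gridCoef (a - 1) (b + 1) v + R.gridCoef (a + 1) (b - 1) v
        + R.gridCoef (a + 1) (b + 1) v + R.gridCoef (a - 1) (b - 1) v) := by
  have hs : slope R.α R.γ R.p₀ ≠ 0 := (one_pos.trans_le (one_le_slope R.hα R.hγ _)).ne'
  rw [conv_comm]
  simp only [kerVec, map_smul, map_add, evenPart_modeVec, _root_.add_apply, _root_.smul_apply,
    smoothing, diagonalOp_modeVec, gridCoef, coef_conv_modeVec, smul_eq_mul, m₀, flipX,
    Prod.mk_sub_mk, Prod.neg_mk, slope_neg]
  ring_nf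
  rw [mul_inv_cancel₀ hs]
  ring

theorem gridCoef_nonlin_kerVec_left (a b : ℤ) (v : Seq) :
    R.gridCoef a b (R.nonlin R.kerVec v) =
      R.gridCoef a b (conv R.k (oddPart R.kerVec) (R.smoothing (evenPart v))) +
      1 / 2 * (R.gridCoef a b (conv R.k (oddPart R.kerVec) (oddPart v))
        / slope R.α R.γ (a * R.p₀)) := by
  rw [nonlin_apply, map_add, map_smul, gridCoef_smoothing, smul_eq_mul]
  norm_num

theorem gridCoef_nonlin_kerVec_right (a b : ℤ) (v : Seq) :
    R.gridCoef a b (R.nonlin v R.kerVec) =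
      R.gridCoef a b (conv R.k (oddPart v) (R.smoothing (evenPart R.kerVec))) +
      1 / 2 * (R.gridCoef a b (conv R.k (oddPart R.kerVec) (oddPart v))
        / slope R.α R.γ (a * R.p₀)) := by
  rw [nonlin_apply, map_add, map_smul, gridCoef_smoothing, smul_eq_mul,
    conv_comm R.k (oddPart v) (oddPart R.kerVec)]
  norm_num

theorem gridCoef_op₂ (a b : ℤ) (v : Seq) : R.gridCoef a b (R.op₂ v) =
    R.quotSymbol R.num₂ (a * R.p₀, b * R.q₀) * R.gridCoef a b v := by
  simp only [gridCoef, op₂, coef_diagonalOp]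

theorem gridCoef_secondOrder_zero (b : ℤ) : R.gridCoef 0 b R.secondOrder = 0 := by
  have : R.gridCoef 0 b (R.projEven (R.quad R.kerVec R.kerVec)) = 0 :=
    coef_proj_of_notMem _ (by simp) (by simp) _
  simp [secondOrder, this]

/-- The mean over opposite frequencies comes from the symmetrisation built into `proj`; the two
terms are later identified by `reflXT`-invariance. -/
theorem gridCoef_secondOrder {a : ℤ} (b : ℤ) (ha : Even a) (ha0 : a ≠ 0) :
    R.gridCoef a b R.secondOrder = -R.β *
      ((R.quotSymbol R.num₂ (a * R.p₀, b * R.q₀) * R.gridCoef a b (R.nonlin R.kerVec R.kerVec) +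
        R.quotSymbol R.num₂ ((-a : ℤ) * R.p₀, (-b : ℤ) * R.q₀) *
          R.gridCoef (-a) (-b) (R.nonlin R.kerVec R.kerVec)) / 2) := by
  obtain ⟨c, rfl⟩ := ha
  have hp := R.p₀_ne_zero
  have hm : (((c + c) * (R.p₀ : ℤ), b * (R.q₀ : ℤ)) : ℤ × ℤ) ∈ {m | m ∈ R.evenGrade ∧ m.1 ≠ 0} :=
    ⟨⟨c, by ring⟩, mul_ne_zero ha0 hp⟩
  have hm' : -(((c + c) * (R.p₀ : ℤ), b * (R.q₀ : ℤ)) : ℤ × ℤ) ∈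
      {m | m ∈ R.evenGrade ∧ m.1 ≠ 0} :=
    ⟨⟨-c, by simp only [Prod.neg_mk]; ring⟩, by simpa using hm.2⟩
  have h1 : R.gridCoef (c + c) b (R.projEven (R.quad R.kerVec R.kerVec)) = _ :=
    coef_proj_of_mem R.k hm hm' _
  have h2 : ∀ x, coef R.k (-((c + c) * (R.p₀ : ℤ), b * (R.q₀ : ℤ))) x =
      R.gridCoef (-(c + c)) (-b) x := fun x => by rw [gridCoef, neg_mul, neg_mul, Prod.neg_mk]
  rw [secondOrder, map_neg, map_smul, h1, smul_eq_mul, h2, quad_apply]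
  change -(R.β * ((R.gridCoef (c + c) b _ + R.gridCoef (-(c + c)) (-b) _) / 2)) = _
  rw [gridCoef_op₂, gridCoef_op₂, neg_mul R.β]

/-- `√(1 + 4 γ α p₀²)`. -/
def slope₂ : ℝ := slope R.α R.γ (2 * R.p₀)

theorem gridCoef_nonlin_two (b : ℤ) (hb : b = -2 ∨ b = 2 ∨ b = 0) :
    R.gridCoef 2 b (R.nonlin R.kerVec R.kerVec) =
      if b = -2 then slope R.α R.γ R.p₀ / 4 + slope R.α R.γ R.p₀ ^ 2 / (8 * R.slope₂)
      else if b = 2 then -(slope R.α R.γ R.p₀ / 4) + slope R.α R.γ R.p₀ ^ 2 / (8 * R.slope₂)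
      else -(slope R.α R.γ R.p₀ ^ 2 / (4 * R.slope₂)) := by
  have hs : slope R.α R.γ R.p₀ ≠ 0 := (one_pos.trans_le (one_le_slope R.hα R.hγ _)).ne'
  have hs2 : R.slope₂ ≠ 0 := (one_pos.trans_le (one_le_slope R.hα R.hγ _)).ne'
  have h2 : slope R.α R.γ (2 * R.p₀) = R.slope₂ := rfl
  rcases hb with rfl | rfl | rfl <;>
  · simp [gridCoef_nonlin_kerVec_left, gridCoef_conv_oddPart_kerVec, gridCoef_smoothing,
      gridCoef_evenPart, gridCoef_oddPart, gridCoef_kerVec, h2]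
    field_simp
    try ring

theorem slope₂_sq : R.slope₂ ^ 2 = 1 + 4 * R.γ * R.α * (R.p₀ : ℝ) ^ 2 := by
  rw [slope₂, slope_sq R.hα R.hγ]
  push_cast
  ring

theorem reflXT_smoothing {a : Seq} (ha : reflXT a = a) :
    reflXT (R.smoothing a) = R.smoothing a :=
  reflXT_diagonalOp (fun m => by simp [slope_neg]) ha

theorem reflXT_nonlin {a b : Seq} (ha : reflXT a = a) (hb : reflXT b = b) :
    reflXT (R.nonlin a b) = R.nonlin a b := by
  have h1 : reflXT (conv R.k (oddPart a) (oddPart b)) = conv R.k (oddPart a) (oddPart b) := by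
    rw [reflXT_conv, reflXT_oddPart ha, reflXT_oddPart hb]
  rw [nonlin_apply, map_add, map_smul, R.reflXT_smoothing h1, reflXT_conv, reflXT_oddPart ha,
    R.reflXT_smoothing (reflXT_evenPart hb)]

theorem reflXT_kerVec : reflXT R.kerVec = R.kerVec := by
  simp only [kerVec, map_smul, map_add, reflXT, reindexOp_modeVec R.k (weight_neg R.k), neg_neg]
  rw [add_comm]

/-- Up to a nonzero constant, the left side is the product of the symbols at `(2 p₀, ±2 q₀)`.
Eliminating `β p₀` by the resonance relation produces the factor `E`, which is positive as `γ < 1`;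
hence the second harmonic is nonresonant. -/
theorem detTwo_eq : (R.q₀ * (1 + 4 * R.α * (R.p₀ : ℝ) ^ 2)) ^ 2 - (R.β * R.p₀ * R.slope₂) ^ 2 =
    3 * R.α * (R.p₀ : ℝ) ^ 2 * (2 - R.γ + 5 * R.α * (R.p₀ : ℝ) ^ 2 +
      4 * R.γ * R.α ^ 2 * (R.p₀ : ℝ) ^ 4) * (R.q₀ : ℝ) ^ 2 / slope R.α R.γ R.p₀ ^ 2 := by
  have hs : slope R.α R.γ R.p₀ ≠ 0 := (one_pos.trans_le (one_le_slope R.hα R.hγ _)).ne'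
  have h1 : R.β * R.p₀ = R.q₀ * (1 + R.α * (R.p₀ : ℝ) ^ 2) / slope R.α R.γ R.p₀ := by
    rw [eq_div_iff hs, R.resonance]
  have h2 := slope_sq R.hα R.hγ R.p₀
  rw [Int.cast_natCast] at h2
  rw [h1, mul_pow, mul_pow, div_pow, mul_pow, R.slope₂_sq, eq_div_iff (pow_ne_zero 2 hs), sub_mul, div_mul_eq_mul_div,
    div_mul_cancel₀ _ (pow_ne_zero 2 hs), h2]
  ring

theorem quotSymbol_num₂_two (b : ℤ) :
    R.quotSymbol R.num₂ ((2 : ℤ) * R.p₀, b * R.q₀) = 2 * R.p₀ * R.slope₂ /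
      (b * R.q₀ * (1 + 4 * R.α * (R.p₀ : ℝ) ^ 2) + 2 * R.β * R.p₀ * R.slope₂) := by
  have hp := R.hp₀
  have h0 : ((2 : ℤ) * (R.p₀ : ℤ), b * (R.q₀ : ℤ)).1 ≠ 0 := by simp only; omega
  have h1 : ((2 : ℤ) * (R.p₀ : ℤ), b * (R.q₀ : ℤ)) ≠ R.m₀ := by
    simp only [m₀, ne_eq, Prod.mk.injEq]
    omega
  have h2 : ((2 : ℤ) * (R.p₀ : ℤ), b * (R.q₀ : ℤ)) ≠ -R.m₀ := by
    simp only [m₀, Prod.neg_mk, ne_eq, Prod.mk.injEq]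
    omega
  rw [quotSymbol, if_neg h0, R.regSymbol_of_ne h1 h2, num₂, symbol]
  change _ * R.slope₂ / (_ + _ * R.slope₂) = _
  push_cast
  ring_nf

/-- The regularised symbol is odd, which is why it takes opposite values at the two resonances. Odd
numerators thus give even multipliers, preserving symmetric sequences. -/
theorem quotSymbol_neg {φ : ℤ × ℤ → ℝ} (hφ : ∀ m, φ (-m) = -φ m) (m : ℤ × ℤ) :
    R.quotSymbol φ (-m) = R.quotSymbol φ m := by
  simp only [quotSymbol, R.regSymbol_neg, hφ, Prod.fst_neg, neg_eq_zero, neg_div_neg_eq]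

theorem num₁_neg (m : ℤ × ℤ) : num₁ (-m) = -num₁ m := by
  simp only [num₁, Prod.fst_neg, Prod.snd_neg]
  push_cast
  ring

theorem num₂_neg (m : ℤ × ℤ) : R.num₂ (-m) = -R.num₂ m := by
  simp only [num₂, Prod.fst_neg, slope_neg]
  push_cast
  ring

theorem num₃_neg (m : ℤ × ℤ) : R.num₃ (-m) = -R.num₃ m := by
  simp only [num₃, Prod.fst_neg, slope_neg]
  push_cast
  ring

theorem gridCoef_secondOrder_two (b : ℤ) :
    R.gridCoef 2 b R.secondOrder = -R.β * (2 * R.p₀ * R.slope₂ /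
      (b * R.q₀ * (1 + 4 * R.α * (R.p₀ : ℝ) ^ 2) + 2 * R.β * R.p₀ * R.slope₂) *
        R.gridCoef 2 b (R.nonlin R.kerVec R.kerVec)) := by
  have h2 : (((-2 : ℤ) * (R.p₀ : ℤ), (-b) * (R.q₀ : ℤ)) : ℤ × ℤ) =
      -((2 : ℤ) * (R.p₀ : ℤ), b * (R.q₀ : ℤ)) := by simp
  rw [R.gridCoef_secondOrder b even_two two_ne_zero, gridCoef, gridCoef, h2,
    R.quotSymbol_neg R.num₂_neg, coef_reflXT_eq _ _ (R.reflXT_nonlin R.reflXT_kerVec R.reflXT_kerVec),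
    R.quotSymbol_num₂_two]
  ring

theorem gridCoef_secondOrder_neg (b : ℤ) :
    R.gridCoef (-2) b R.secondOrder = R.gridCoef 2 (-b) R.secondOrder := by
  rw [R.gridCoef_secondOrder b (a := -2) (by decide) (by decide),
    R.gridCoef_secondOrder (-b) even_two two_ne_zero]
  rw [neg_neg, neg_neg]
  ring

/-- The first order coefficient of the cubic interaction at the resonant frequency. -/
theorem gridCoef_cubic :
    R.gridCoef 1 (-1) (R.nonlin R.kerVec R.secondOrder) +
      R.gridCoef 1 (-1) (R.nonlin R.secondOrder R.kerVec) =
    slope R.α R.γ R.p₀ / 2 * ((R.gridCoef 2 (-2) R.secondOrder + R.gridCoef 2 2 R.secondOrder) / 2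
      - R.gridCoef 2 0 R.secondOrder) / R.slope₂ +
    (R.gridCoef 2 (-2) R.secondOrder - R.gridCoef 2 2 R.secondOrder) / 2 := by
  have hs : slope R.α R.γ R.p₀ ≠ 0 := (one_pos.trans_le (one_le_slope R.hα R.hγ _)).ne'
  have hs2 : R.slope₂ ≠ 0 := (one_pos.trans_le (one_le_slope R.hα R.hγ _)).ne'
  have h2 : slope R.α R.γ (2 * R.p₀) = R.slope₂ := rfl
  rw [gridCoef_nonlin_kerVec_left, gridCoef_nonlin_kerVec_right]
  simp [gridCoef_conv_oddPart_kerVec, gridCoef_conv_smoothing_kerVec, gridCoef_smoothing,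
    gridCoef_evenPart, gridCoef_oddPart, gridCoef_secondOrder_zero, h2, gridCoef_secondOrder_neg]
  field_simp
  ring

theorem kernelSlope_eq : kernelSlope R.α R.γ R.p₀ = slope R.α R.γ R.p₀ := by
  simp [kernelSlope, slope]

theorem secondHarmonicDenom_pos : 0 < secondHarmonicDenom R.α R.γ R.p₀ R.q₀ := by
  have h1 : (0 : ℝ) < R.p₀ := by exact_mod_cast R.hp₀
  have h2 : (0 : ℝ) < R.q₀ := by exact_mod_cast R.hq₀
  have h3 := R.hα
  have h4 := R.hγ
  have h5 : 0 < 2 - R.γ := by linarith [R.hγ']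
  unfold secondHarmonicDenom
  positivity

/-- The second harmonics of the second order part, in terms of `α₁` and `β₁`. -/
theorem secondOrder_harmonics :
    R.gridCoef 2 (-2) R.secondOrder + R.gridCoef 2 2 R.secondOrder =
      R.slope₂ * coefAlpha1 R.α R.β R.γ R.p₀ R.q₀ ∧
    R.gridCoef 2 (-2) R.secondOrder - R.gridCoef 2 2 R.secondOrder =
      -coefBeta1 R.α R.β R.γ R.p₀ R.q₀ := by
  have hp : (0 : ℝ) < R.p₀ := by exact_mod_cast R.hp₀
  have hq : (0 : ℝ) < R.q₀ := by exact_mod_cast R.hq₀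
  have hα := R.hα
  have hs : slope R.α R.γ R.p₀ ≠ 0 := (one_pos.trans_le (one_le_slope R.hα R.hγ _)).ne'
  have hs2 : R.slope₂ ≠ 0 := (one_pos.trans_le (one_le_slope R.hα R.hγ _)).ne'
  have hE := R.secondHarmonicDenom_pos
  have hdet := R.detTwo_eq
  have hres := R.resonance
  have hsq := slope_sq R.hα R.hγ R.p₀
  have hsq2 := R.slope₂_sq
  have hβ := R.hβ
  rw [Int.cast_natCast] at hsq
  rw [coefAlpha1, coefBeta1, R.kernelSlope_eq]
  rw [gridCoef_secondOrder_two, gridCoef_secondOrder_two,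
    gridCoef_nonlin_two _ _ (Or.inl rfl), gridCoef_nonlin_two _ _ (Or.inr (Or.inl rfl))]
  simp only [if_true, show ((2 : ℤ) = -2) = False by decide, if_false]
  unfold secondHarmonicDenom at hE ⊢
  set s := slope R.α R.γ R.p₀
  set S := R.slope₂
  set α := R.α
  set β := R.β
  set γ := R.γ
  set p : ℝ := (R.p₀ : ℝ)
  set q : ℝ := (R.q₀ : ℝ)
  -- The symbols at `(2 p₀, ∓2 q₀)` are `2 (X ∓ Y)`; both inverses are put over the common
  -- denominator `Y² - X²`, given by `hdet`.
  set Y := q * (1 + 4 * α * p ^ 2) with hY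
  set X := β * p * S with hX
  set E := 2 - γ + 5 * α * p ^ 2 + 4 * γ * α ^ 2 * p ^ 4
  have hE0 : E ≠ 0 := by
    intro h
    rw [h, mul_zero] at hE
    exact lt_irrefl _ hE
  have hd0 : Y ^ 2 - X ^ 2 ≠ 0 := by
    rw [hdet]
    positivity
  have hm : X - Y ≠ 0 := fun h => hd0 (by linear_combination -(X + Y) * h)
  have hpl : X + Y ≠ 0 := fun h => hd0 (by linear_combination (Y - X) * h)
  have e1 : 2 * p * S / (((-2 : ℤ) : ℝ) * q * (1 + 4 * α * p ^ 2) + 2 * β * p * S) =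
      -(p * S * (X + Y)) / (Y ^ 2 - X ^ 2) := by
    have : ((-2 : ℤ) : ℝ) * q * (1 + 4 * α * p ^ 2) + 2 * β * p * S = 2 * (X - Y) := by
      rw [hX, hY]; push_cast; ring
    rw [this, div_eq_div_iff (mul_ne_zero two_ne_zero hm) hd0]
    ring
  have e2 : 2 * p * S / (((2 : ℤ) : ℝ) * q * (1 + 4 * α * p ^ 2) + 2 * β * p * S) =
      p * S * (Y - X) / (Y ^ 2 - X ^ 2) := by
    have : ((2 : ℤ) : ℝ) * q * (1 + 4 * α * p ^ 2) + 2 * β * p * S = 2 * (X + Y) := by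
      rw [hX, hY]; push_cast; ring
    rw [this, div_eq_div_iff (mul_ne_zero two_ne_zero hpl) hd0]
    ring
  have hβp : q * (1 + α * p ^ 2) = β * p * s := hres
  rw [e1, e2, hdet]
  constructor
  · rw [hX, hY]
    field_simp
    linear_combination (-8 * S) * hβp
  · rw [hX, hY]
    field_simp
    linear_combination (-16 * S ^ 2) * hβp + 16 * q * (1 + α * p ^ 2) * hsq2 +
      8 * (q * (1 + 4 * α * p ^ 2)) * hsq

/-- The resonant modes of the products of the kernel vector with the second order part come from the
modes `(±2, b)` with `b ∈ {-2, 0, 2}`, in units of `(p₀, q₀)`. The harmonics `b = ±2` give the terms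
in `α₁` and `β₁`, and `b = 0` gives the remaining term of `β₂`. -/
theorem kappa_eq :
    R.β * coef R.k R.m₀ (R.quad R.kerVec R.secondOrder + R.quad R.secondOrder R.kerVec) =
      R.p₀ / 2 * coefBeta2 R.α R.β R.γ R.p₀ R.q₀ := by
  have hp : (R.p₀ : ℤ) ≠ 0 := R.p₀_ne_zero
  have hβ := R.hβ.ne'
  have hpR : (R.p₀ : ℝ) ≠ 0 := by exact_mod_cast hp
  have hs : slope R.α R.γ R.p₀ ≠ 0 := (one_pos.trans_le (one_le_slope R.hα R.hγ _)).ne'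
  have hs2 : R.slope₂ ≠ 0 := (one_pos.trans_le (one_le_slope R.hα R.hγ _)).ne'
  -- Since the regularised symbol is `1` at `m₀`, the resonant coefficient carries the bare
  -- numerator.
  have h0 : R.quotSymbol R.num₂ R.m₀ = R.p₀ * slope R.α R.γ R.p₀ := by
    rw [quotSymbol, if_neg (by exact hp), R.regSymbol_m₀, div_one, num₂]
    simp [m₀]
  have h1 : R.gridCoef 2 0 R.secondOrder = slope R.α R.γ R.p₀ ^ 2 / (4 * R.slope₂) := by
    rw [gridCoef_secondOrder_two, gridCoef_nonlin_two _ _ (Or.inr (Or.inr rfl))]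
    norm_num
    field_simp
  have h2 : coef R.k R.m₀ = R.gridCoef 1 (-1) := by rw [gridCoef, m₀_eq]
  have h3 : coef R.k R.m₀ (R.quad R.kerVec R.secondOrder + R.quad R.secondOrder R.kerVec) =
      R.p₀ * slope R.α R.γ R.p₀ * (R.gridCoef 1 (-1) (R.nonlin R.kerVec R.secondOrder) +
      R.gridCoef 1 (-1) (R.nonlin R.secondOrder R.kerVec)) := by
    rw [map_add, quad_apply, quad_apply, op₂, coef_diagonalOp, coef_diagonalOp, h0, h2]
    ring
  rw [h3, gridCoef_cubic, R.secondOrder_harmonics.1, R.secondOrder_harmonics.2, h1, coefBeta2,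
    R.kernelSlope_eq, ← R.slope₂_sq]
  field_simp
  ring

end ResonantData

/-! ### Supports of sequences and symmetric projections. -/

section Support

/-- The sequence vanishes outside a set of frequencies. -/
def SupportedOn (S : Set (ℤ × ℤ)) (a : Seq) : Prop := ∀ m ∉ S, a m = 0

variable {S T U : Set (ℤ × ℤ)} {a b : Seq}

theorem SupportedOn.add (ha : SupportedOn S a) (hb : SupportedOn S b) : SupportedOn S (a + b) :=
  fun m hm => by rw [seq_add_apply, ha m hm, hb m hm, add_zero]

theorem SupportedOn.neg (ha : SupportedOn S a) : SupportedOn S (-a) :=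
  fun m hm => by rw [seq_neg_apply, ha m hm, neg_zero]

theorem SupportedOn.smul (ha : SupportedOn S a) (c : ℝ) : SupportedOn S (c • a) :=
  fun m hm => by rw [seq_smul_apply, ha m hm, mul_zero]

theorem SupportedOn.diagonalOp (ha : SupportedOn S a) {φ : ℤ × ℤ → ℝ} {C : ℝ}
    {h : ∀ i, |φ i| ≤ C} : SupportedOn S (diagonalOp φ C h a) :=
  fun m hm => by rw [diagonalOp_apply, ha m hm, mul_zero]

theorem SupportedOn.evenPart (ha : SupportedOn S a) (hS : ∀ m, flipX m ∈ S → m ∈ S) :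
    SupportedOn S (evenPart a) := fun m hm => by
  rw [evenPart_apply, ha m hm, ha _ fun h => hm (hS m h), add_zero, zero_div]

theorem SupportedOn.oddPart (ha : SupportedOn S a) (hS : ∀ m, flipX m ∈ S → m ∈ S) :
    SupportedOn S (oddPart a) := fun m hm => by
  rw [oddPart_apply, ha m hm, ha _ fun h => hm (hS m h), sub_zero, zero_div]

theorem SupportedOn.conv (k : ℕ) (ha : SupportedOn S a) (hb : SupportedOn T b)
    (hU : ∀ i ∈ S, ∀ j ∈ T, i + j ∈ U) : SupportedOn U (conv k a b) := fun _ hm =>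
  conv_apply_eq_zero k ha hb fun i hi j hj h => hm (h ▸ hU i hi j hj)

open Classical in
theorem supportedOn_proj (hS : ∀ m, -m ∈ S → m ∈ S) (a : Seq) : SupportedOn S (proj S a) :=
  fun m hm => by rw [proj_apply, if_neg hm, if_neg fun h => hm (hS m h), add_zero, zero_div]

theorem reflXT_proj (S : Set (ℤ × ℤ)) (a : Seq) : reflXT (proj S a) = proj S a := by
  classical
  ext m
  rw [reflXT_apply, proj_apply, proj_apply, neg_neg, add_comm]

open Classical in
theorem proj_eq_self (ha : SupportedOn S a) (h : reflXT a = a) : proj S a = a := by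
  ext m
  have h1 : (if m ∈ S then a m else 0) = a m := by
    split_ifs with hm
    exacts [rfl, (ha m hm).symm]
  have h2 : (if -m ∈ S then a (-m) else 0) = a (-m) := by
    split_ifs with hm
    exacts [rfl, (ha _ hm).symm]
  have h3 : a (-m) = a m := by rw [← reflXT_apply, h]
  rw [proj_apply, h1, h2, h3]
  ring

end Support

/-! ### The grading by multiples of `p₀`, and removal of the projections. -/

namespace ResonantData

variable (R : ResonantData)

theorem flipX_mem_oddGrade {m : ℤ × ℤ} (h : flipX m ∈ R.oddGrade) : m ∈ R.oddGrade := by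
  obtain ⟨c, hc⟩ := h
  refine ⟨-c - 1, ?_⟩
  simp only [flipX] at hc
  linear_combination -hc

theorem flipX_mem_evenGrade {m : ℤ × ℤ} (h : flipX m ∈ R.evenGrade) : m ∈ R.evenGrade := by
  obtain ⟨c, hc⟩ := h
  refine ⟨-c, ?_⟩
  simp only [flipX] at hc
  linear_combination -hc

theorem odd_add_odd : ∀ i ∈ R.oddGrade, ∀ j ∈ R.oddGrade, i + j ∈ R.evenGrade := by
  rintro i ⟨c, hc⟩ j ⟨d, hd⟩
  refine ⟨c + d + 1, ?_⟩
  rw [Prod.fst_add]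
  linear_combination hc + hd

theorem odd_add_even : ∀ i ∈ R.oddGrade, ∀ j ∈ R.evenGrade, i + j ∈ R.oddGrade := by
  rintro i ⟨c, hc⟩ j ⟨d, hd⟩
  refine ⟨c + d, ?_⟩
  rw [Prod.fst_add]
  linear_combination hc + hd

theorem even_add_odd : ∀ i ∈ R.evenGrade, ∀ j ∈ R.oddGrade, i + j ∈ R.oddGrade :=
  fun i hi j hj => add_comm j i ▸ R.odd_add_even j hj i hi

theorem even_add_even : ∀ i ∈ R.evenGrade, ∀ j ∈ R.evenGrade, i + j ∈ R.evenGrade := by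
  rintro i ⟨c, hc⟩ j ⟨d, hd⟩
  refine ⟨c + d, ?_⟩
  rw [Prod.fst_add]
  linear_combination hc + hd

theorem disjoint_grades {m : ℤ × ℤ} (h : m ∈ R.oddGrade) : m ∉ R.evenGrade := by
  rintro ⟨d, hd⟩
  obtain ⟨c, hc⟩ := h
  have h1 : (R.p₀ : ℤ) * (2 * (d - c) - 1) = 0 := by linear_combination hc - hd
  rcases mul_eq_zero.mp h1 with h2 | h2
  · exact R.p₀_ne_zero h2
  · omega

theorem neg_mem_oddGrade {m : ℤ × ℤ} (h : -m ∈ R.oddGrade) : m ∈ R.oddGrade := by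
  obtain ⟨c, hc⟩ := h
  refine ⟨-c - 1, ?_⟩
  rw [Prod.fst_neg] at hc
  linear_combination -hc

theorem m₀_mem_oddGrade : R.m₀ ∈ R.oddGrade := ⟨0, by simp [m₀]⟩

theorem neg_m₀_mem_oddGrade : -R.m₀ ∈ R.oddGrade := ⟨-1, by simp only [m₀, Prod.neg_mk]; ring⟩

theorem supportedOn_nonlin {S T U : Set (ℤ × ℤ)} {a b : Seq} (ha : SupportedOn S a)
    (hb : SupportedOn T b) (hS : ∀ m, flipX m ∈ S → m ∈ S) (hT : ∀ m, flipX m ∈ T → m ∈ T)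
    (hU : ∀ i ∈ S, ∀ j ∈ T, i + j ∈ U) : SupportedOn U (R.nonlin a b) := by
  rw [nonlin_apply]
  exact ((ha.oddPart hS).conv R.k (hb.evenPart hT).diagonalOp hU).add
    (((ha.oddPart hS).conv R.k (hb.oddPart hT) hU).diagonalOp.smul _)

/-- The linear perturbation of the diagonalised system. -/
def pert (μ ν B : ℝ) (v : Seq) : Seq :=
  linPert R.op₁ R.op₂ (R.op₃.comp evenPart) (R.op₂.comp oddPart) R.β μ ν B v

theorem pert_eq (μ ν B : ℝ) (v : Seq) : R.pert μ ν B v = μ • R.op₁ v + ν • R.op₂ v +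
    ((R.β + ν) * μ) • R.op₃ (evenPart v) + ((R.β + ν) * B) • R.op₂ (oddPart v) := rfl

theorem supportedOn_pert {S : Set (ℤ × ℤ)} {v : Seq} (hv : SupportedOn S v)
    (hS : ∀ m, flipX m ∈ S → m ∈ S) (μ ν B : ℝ) : SupportedOn S (R.pert μ ν B v) := by
  rw [pert_eq]
  exact (((hv.diagonalOp.smul μ).add (hv.diagonalOp.smul ν)).add
    ((hv.evenPart hS).diagonalOp.smul _)).add ((hv.oddPart hS).diagonalOp.smul _)

theorem reflXT_op₁ {a : Seq} (ha : reflXT a = a) : reflXT (R.op₁ a) = R.op₁ a :=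
  reflXT_diagonalOp (R.quotSymbol_neg num₁_neg) ha

theorem reflXT_op₂ {a : Seq} (ha : reflXT a = a) : reflXT (R.op₂ a) = R.op₂ a :=
  reflXT_diagonalOp (R.quotSymbol_neg R.num₂_neg) ha

theorem reflXT_op₃ {a : Seq} (ha : reflXT a = a) : reflXT (R.op₃ a) = R.op₃ a :=
  reflXT_diagonalOp (R.quotSymbol_neg R.num₃_neg) ha

theorem reflXT_pert {v : Seq} (hv : reflXT v = v) (μ ν B : ℝ) :
    reflXT (R.pert μ ν B v) = R.pert μ ν B v := by
  simp only [pert_eq, map_add, map_smul, R.reflXT_op₁ hv, R.reflXT_op₂ hv,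
    R.reflXT_op₃ (reflXT_evenPart hv), R.reflXT_op₂ (reflXT_oddPart hv)]

theorem op_apply_of_eq_zero {m : ℤ × ℤ} (hm : m.1 = 0) (a : Seq) :
    R.op₁ a m = 0 ∧ R.op₂ a m = 0 ∧ R.op₃ a m = 0 := by
  simp [op₁, op₂, op₃, quotSymbol, hm]

theorem pert_apply_of_eq_zero {m : ℤ × ℤ} (hm : m.1 = 0) (μ ν B : ℝ) (v : Seq) :
    R.pert μ ν B v m = 0 := by
  rw [pert_eq]
  simp only [seq_add_apply, seq_smul_apply, (R.op_apply_of_eq_zero hm _).1,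
    (R.op_apply_of_eq_zero hm _).2.1, (R.op_apply_of_eq_zero hm _).2.2]
  ring

theorem supportedOn_kerVec : SupportedOn R.oddGrade R.kerVec := fun m hm => by
  have h1 : m ≠ R.m₀ := fun h => hm (h ▸ R.m₀_mem_oddGrade)
  have h2 : m ≠ -R.m₀ := fun h => hm (h ▸ R.neg_m₀_mem_oddGrade)
  rw [kerVec, seq_smul_apply, seq_add_apply, modeVec_apply, modeVec_apply, if_neg h1, if_neg h2]
  simp

/-- The projected equations of the bifurcation problem. -/
structure IsBranchPoint (μ ν B : ℝ) (V Z : Seq) (ρ : ℝ) : Prop where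
  odd : V + R.projOdd (oddForcing R.op₁ R.op₂ (R.op₃.comp evenPart) (R.op₂.comp oddPart) R.quad
    R.β μ ν B V Z ρ) = R.kerVec
  even : Z + R.projEven (evenForcing R.op₁ R.op₂ (R.op₃.comp evenPart) (R.op₂.comp oddPart) R.quad
    R.β μ ν B V Z ρ) = 0
  resonant : coef R.k R.m₀ (oddForcing R.op₁ R.op₂ (R.op₃.comp evenPart) (R.op₂.comp oddPart)
    R.quad R.β μ ν B V Z ρ) = 0

section Solution

variable {R} {μ ν B ρ : ℝ} {V Z : Seq}

theorem solution_odd (h : R.IsBranchPoint μ ν B V Z ρ) :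
    SupportedOn R.oddGrade V ∧ reflXT V = V := by
  have h₁ := h.odd
  rw [← eq_sub_iff_add_eq, sub_eq_add_neg] at h₁
  have hneg : ∀ m, -m ∈ R.oddGrade \ {R.m₀, -R.m₀} → m ∈ R.oddGrade \ {R.m₀, -R.m₀} := by
    rintro m ⟨hm, hm'⟩
    refine ⟨R.neg_mem_oddGrade hm, fun h => hm' ?_⟩
    rcases h with h | h
    · rw [h]; exact Or.inr rfl
    · rw [Set.mem_singleton_iff.mp h, neg_neg]; exact Or.inl rfl
  constructor
  · rw [h₁]
    exact R.supportedOn_kerVec.add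
      (SupportedOn.neg fun m hm => supportedOn_proj hneg _ m fun h => hm h.1)
  · rw [h₁, map_add, map_neg, R.reflXT_kerVec, projOdd, reflXT_proj]

theorem solution_even (h : R.IsBranchPoint μ ν B V Z ρ) :
    SupportedOn {m | m ∈ R.evenGrade ∧ m.1 ≠ 0} Z ∧ reflXT Z = Z := by
  have h₂ := h.even
  rw [← eq_sub_iff_add_eq, zero_sub] at h₂
  constructor
  · rw [h₂]
    refine SupportedOn.neg (supportedOn_proj ?_ _)
    rintro m ⟨⟨c, hc⟩, hm⟩
    exact ⟨⟨-c, by rw [Prod.fst_neg] at hc; linear_combination -hc⟩, by simpa using hm⟩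
  · rw [h₂, map_neg, projEven, reflXT_proj]

/-- The projections act as the identity on the forcing terms: these are symmetric, have the right
grade, vanish at `p = 0` in the even case, and vanish at `±m₀` in the odd case by the resonant
equation and symmetry. -/
theorem solution_unprojected (h : R.IsBranchPoint μ ν B V Z ρ) :
    V + (R.pert μ ν B V + ((R.β + ν) * ρ) • R.op₂ (R.nonlin V Z + R.nonlin Z V)) = R.kerVec ∧
    Z + (R.pert μ ν B Z + (R.β + ν) • R.op₂ (R.nonlin V V + ρ • R.nonlin Z Z)) = 0 ∧
    (R.pert μ ν B V + ((R.β + ν) * ρ) • R.op₂ (R.nonlin V Z + R.nonlin Z V)) R.m₀ = 0 := by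
  obtain ⟨hV, hV'⟩ := solution_odd h
  obtain ⟨hZ, hZ'⟩ := solution_even h
  obtain ⟨h₁, h₂, h₃⟩ := h
  have hZe : SupportedOn R.evenGrade Z := fun m hm => hZ m fun h => hm h.1
  have fO : ∀ m, flipX m ∈ R.oddGrade → m ∈ R.oddGrade := fun m => R.flipX_mem_oddGrade
  have fE : ∀ m, flipX m ∈ R.evenGrade → m ∈ R.evenGrade := fun m => R.flipX_mem_evenGrade
  set X := R.pert μ ν B V + ((R.β + ν) * ρ) • R.op₂ (R.nonlin V Z + R.nonlin Z V) with hX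
  set Y := R.pert μ ν B Z + (R.β + ν) • R.op₂ (R.nonlin V V + ρ • R.nonlin Z Z) with hY
  have hXf : oddForcing R.op₁ R.op₂ (R.op₃.comp evenPart) (R.op₂.comp oddPart) R.quad
      R.β μ ν B V Z ρ = X := by
    rw [hX, map_add]; rfl
  have hYf : evenForcing R.op₁ R.op₂ (R.op₃.comp evenPart) (R.op₂.comp oddPart) R.quad
      R.β μ ν B V Z ρ = Y := by
    rw [hY, map_add, map_smul]; rfl
  rw [hXf] at h₁ h₃
  rw [hYf] at h₂
  have hXr : reflXT X = X := by
    rw [hX, map_add, map_smul, R.reflXT_pert hV', R.reflXT_op₂]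
    rw [map_add, R.reflXT_nonlin hV' hZ', R.reflXT_nonlin hZ' hV']
  have hYr : reflXT Y = Y := by
    rw [hY, map_add, map_smul, R.reflXT_pert hZ', R.reflXT_op₂]
    rw [map_add, map_smul, R.reflXT_nonlin hV' hV', R.reflXT_nonlin hZ' hZ']
  have hXs : SupportedOn R.oddGrade X :=
    (R.supportedOn_pert hV fO μ ν B).add
      (((R.supportedOn_nonlin hV hZe fO fE R.odd_add_even).add
        (R.supportedOn_nonlin hZe hV fE fO R.even_add_odd)).diagonalOp.smul _)
  have hYs : SupportedOn R.evenGrade Y :=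
    (R.supportedOn_pert hZe fE μ ν B).add
      (((R.supportedOn_nonlin hV hV fO fO R.odd_add_odd).add
        ((R.supportedOn_nonlin hZe hZe fE fE R.even_add_even).smul ρ)).diagonalOp.smul _)
  have hX0 : X R.m₀ = 0 := by
    rw [coef_apply] at h₃
    exact (mul_eq_zero.mp h₃).resolve_left (inv_ne_zero (weight_ne_zero _ _))
  have hX0' : X (-R.m₀) = 0 := by rw [← reflXT_apply, hXr, hX0]
  have hXp : R.projOdd X = X := proj_eq_self (fun m hm => by
    by_cases h : m ∈ R.oddGrade
    · have h' : m ∈ ({R.m₀, -R.m₀} : Set (ℤ × ℤ)) := by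
        by_contra h'
        exact hm ⟨h, h'⟩
      rcases h' with h' | h'
      · rw [h', hX0]
      · rw [Set.mem_singleton_iff.mp h', hX0']
    · exact hXs m h) hXr
  have hYp : R.projEven Y = Y := proj_eq_self (fun m hm => by
    by_cases h : m ∈ R.evenGrade
    · have h' : m.1 = 0 := by
        by_contra h'
        exact hm ⟨h, h'⟩
      rw [hY, seq_add_apply, seq_smul_apply, R.pert_apply_of_eq_zero h',
        (R.op_apply_of_eq_zero h' _).2.1]
      ring
    · exact hYs m h) hYr
  rw [hXp] at h₁
  rw [hYp] at h₂
  exact ⟨h₁, h₂, hX0⟩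

variable {A : ℝ}

/-- The scalar equation satisfied at each frequency by `v = A V + A² Z`. -/
theorem solution_symbol (h : R.IsBranchPoint μ ν B V Z ρ) (hA : A ^ 2 = ρ)
    (m : ℤ × ℤ) (hm : m.1 ≠ 0) :
    symbol R.α R.β R.γ m * coef R.k m (A • V + A ^ 2 • Z) +
      (μ * num₁ m + ν * R.num₂ m) * coef R.k m (A • V + A ^ 2 • Z) +
      (R.β + ν) * μ * R.num₃ m * coef R.k m (evenPart (A • V + A ^ 2 • Z)) +
      (R.β + ν) * R.num₂ m * (B * coef R.k m (oddPart (A • V + A ^ 2 • Z)) +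
        coef R.k m (R.nonlin (A • V + A ^ 2 • Z) (A • V + A ^ 2 • Z))) = 0 := by
  obtain ⟨g₁, g₂, g₃⟩ := solution_unprojected h
  obtain ⟨hV, hV'⟩ := solution_odd h
  obtain ⟨hZ, hZ'⟩ := solution_even h
  set v := A • V + A ^ 2 • Z with hv
  set Φ := R.pert μ ν B v + (R.β + ν) • R.op₂ (R.nonlin v v) with hΦ
  -- With `ρ = A²`, the mixed terms of order `A³` join the odd forcing and the terms of orders `A²`
  -- and `A⁴` form the even forcing.
  have hΦ' : Φ = A • (R.pert μ ν B V + ((R.β + ν) * ρ) • R.op₂ (R.nonlin V Z + R.nonlin Z V)) +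
      A ^ 2 • (R.pert μ ν B Z + (R.β + ν) • R.op₂ (R.nonlin V V + ρ • R.nonlin Z Z)) := by
    rw [hΦ, hv, ← hA]
    simp only [pert_eq, map_add, map_smul, _root_.add_apply, _root_.smul_apply]
    module
  have hsum : v + Φ = A • R.kerVec := by
    have e1 : v + Φ = A • (V + (R.pert μ ν B V +
          ((R.β + ν) * ρ) • R.op₂ (R.nonlin V Z + R.nonlin Z V))) +
        A ^ 2 • (Z + (R.pert μ ν B Z + (R.β + ν) • R.op₂ (R.nonlin V V + ρ • R.nonlin Z Z))) := by
      rw [hΦ', hv]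
      module
    rw [e1, g₁, g₂, smul_zero, add_zero]
  have hr := R.regSymbol_ne_zero hm
  have hq : ∀ φ : ℤ × ℤ → ℝ, R.regSymbol m * R.quotSymbol φ m = φ m := fun φ => by
    rw [quotSymbol, if_neg hm, mul_div_cancel₀ _ hr]
  have hcoef : R.regSymbol m * coef R.k m Φ =
      (μ * num₁ m + ν * R.num₂ m) * coef R.k m v +
      (R.β + ν) * μ * R.num₃ m * coef R.k m (evenPart v) +
      (R.β + ν) * R.num₂ m * (B * coef R.k m (oddPart v) + coef R.k m (R.nonlin v v)) := by
    rw [hΦ, pert_eq]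
    simp only [map_add, map_smul, smul_eq_mul, op₁, op₂, op₃, coef_diagonalOp]
    rw [← hq num₁, ← hq R.num₂, ← hq R.num₃]
    ring
  have hkey : symbol R.α R.β R.γ m * coef R.k m v + R.regSymbol m * coef R.k m Φ = 0 := by
    -- At the resonances the true symbol is zero, unlike the regularised one, so there the equation
    -- is just the vanishing of `Φ`.
    have hres : ∀ m, (m = R.m₀ ∨ m = -R.m₀) → symbol R.α R.β R.γ m = 0 ∧ Φ m = 0 := by
      have hX0 := g₃
      have hZm : Z R.m₀ = 0 := hZ _ fun h => R.disjoint_grades R.m₀_mem_oddGrade h.1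
      have hY0 : (R.pert μ ν B Z + (R.β + ν) • R.op₂ (R.nonlin V V + ρ • R.nonlin Z Z)) R.m₀ = 0 := by
        have := congrArg (fun a : Seq => a R.m₀) g₂
        simp only [seq_add_apply _ (_ + _), hZm, zero_add] at this
        exact this
      have h0 : Φ R.m₀ = 0 := by
        rw [hΦ', seq_add_apply, seq_smul_apply, seq_smul_apply, hX0, hY0]
        ring
      have hΦr : reflXT Φ = Φ := by
        have hvr : reflXT v = v := by rw [hv, map_add, map_smul, map_smul, hV', hZ']
        rw [hΦ, map_add, map_smul, R.reflXT_pert hvr, R.reflXT_op₂ (R.reflXT_nonlin hvr hvr)]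
      rintro m (rfl | rfl)
      · exact ⟨R.symbol_m₀, h0⟩
      · exact ⟨by rw [symbol_neg, R.symbol_m₀, neg_zero], by rw [← reflXT_apply, hΦr, h0]⟩
    by_cases h : m = R.m₀ ∨ m = -R.m₀
    · rw [(hres m h).1, coef_apply _ _ Φ, (hres m h).2]
      ring
    · push Not at h
      have h4 : coef R.k m v + coef R.k m Φ = 0 := by
        rw [← map_add, hsum, map_smul, kerVec, map_smul, map_add, coef_modeVec, coef_modeVec,
          if_neg h.1, if_neg h.2, add_zero, smul_zero, smul_zero]
      rw [R.regSymbol_of_ne h.1 h.2, ← mul_add, h4, mul_zero]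
  rw [hcoef] at hkey
  linear_combination hkey

/-- The Fourier coefficients of `η`. -/
def etaSeq (R : ResonantData) (B : ℝ) (v : Seq) : Seq :=
  R.smoothing (evenPart v) + B • modeVec R.k 0

theorem coef_oddPart_flipX (k : ℕ) (m : ℤ × ℤ) (a : Seq) :
    coef k (flipX m) (oddPart a) = -coef k m (oddPart a) := by
  rw [coef_oddPart, coef_oddPart, flipX_involutive]
  ring

theorem coef_evenPart_flipX (k : ℕ) (m : ℤ × ℤ) (a : Seq) :
    coef k (flipX m) (evenPart a) = coef k m (evenPart a) := by
  rw [coef_evenPart, coef_evenPart, flipX_involutive]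
  ring

theorem coef_reflX (k : ℕ) (m : ℤ × ℤ) (a : Seq) : coef k m (reflX a) = coef k (flipX m) a := by
  simp only [coef_apply, reflX_apply, weight_flipX]

theorem reflX_smoothing (R : ResonantData) {a : Seq} (h : reflX a = a) :
    reflX (R.smoothing a) = R.smoothing a := by
  ext m
  have : a (flipX m) = a m := by rw [← reflX_apply, h]
  rw [reflX_apply, smoothing, diagonalOp_apply, diagonalOp_apply, this]
  simp [flipX, slope_neg]

theorem conv_modeVec_zero (k : ℕ) (a : Seq) : conv k a (modeVec k 0) = a := by
  have : (conv k).flip (modeVec k 0) = ContinuousLinearMap.id ℝ Seq :=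
    seq_clm_ext k fun i => by simp [conv_modeVec]
  exact congrArg (fun T => T a) this

/-- The Fourier form of the first equation. -/
def FirstFourier (α β : ℝ) (k : ℕ) (η u : Seq) : Prop := ∀ m : ℤ × ℤ,
  (m.2 : ℝ) * (1 + α * (m.1 : ℝ) ^ 2) * coef k m η +
    β * m.1 * (coef k m u + coef k m (conv k u η)) = 0

/-- The Fourier form of the second equation. -/
def SecondFourier (α β γ : ℝ) (k : ℕ) (η u : Seq) : Prop := ∀ m : ℤ × ℤ,
  (m.2 : ℝ) * (1 + α * (m.1 : ℝ) ^ 2) * coef k m u +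
    β * m.1 * ((1 + γ * α * (m.1 : ℝ) ^ 2) * coef k m η + coef k m (conv k u u) / 2) = 0

/-- Undoing the diagonalisation: half the sum of the scalar equations at `(p, q)` and `(-p, q)` is
`s` times the first equation, and half the difference is the second. The slope stays at the base
parameter `α`; its correction for `α + μ` is the term `num₃`. -/
theorem solution_fourier (h : R.IsBranchPoint μ ν B V Z ρ) (hA : A ^ 2 = ρ) :
    FirstFourier (R.α + μ) (R.β + ν) R.k (etaSeq R B (A • V + A ^ 2 • Z))
      (oddPart (A • V + A ^ 2 • Z)) ∧
    SecondFourier (R.α + μ) (R.β + ν) R.γ R.k (etaSeq R B (A • V + A ^ 2 • Z))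
      (oddPart (A • V + A ^ 2 • Z)) := by
  have key := solution_symbol h hA
  have hv0 : ∀ m : ℤ × ℤ, m.1 = 0 → (A • V + A ^ 2 • Z) m = 0 := by
    intro m hm
    rw [seq_add_apply, seq_smul_apply, seq_smul_apply,
      (solution_even h).1 m fun h => h.2 hm, (solution_odd h).1 m]
    · ring
    · intro h
      exact R.disjoint_grades h ⟨0, by rw [hm, mul_zero]⟩
  set v := A • V + A ^ 2 • Z
  have hmain : ∀ m : ℤ × ℤ, m.1 ≠ 0 →
      (m.2 : ℝ) * (1 + (R.α + μ) * (m.1 : ℝ) ^ 2) * coef R.k m (etaSeq R B v) +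
      (R.β + ν) * m.1 * (coef R.k m (oddPart v) + coef R.k m (conv R.k (oddPart v) (etaSeq R B v)))
        = 0 ∧
      (m.2 : ℝ) * (1 + (R.α + μ) * (m.1 : ℝ) ^ 2) * coef R.k m (oddPart v) +
      (R.β + ν) * m.1 * ((1 + R.γ * (R.α + μ) * (m.1 : ℝ) ^ 2) * coef R.k m (etaSeq R B v) +
        coef R.k m (conv R.k (oddPart v) (oddPart v)) / 2) = 0 := by
    intro m hm
    have e1 := key m hm
    have e2 := key (flipX m) (by simpa [flipX] using hm)
    have hsl : slope R.α R.γ (flipX m).1 = slope R.α R.γ m.1 := slope_neg _ _ _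
    have hN1 : coef R.k (flipX m) (conv R.k (oddPart v) (R.smoothing (evenPart v))) =
        -coef R.k m (conv R.k (oddPart v) (R.smoothing (evenPart v))) := by
      rw [← coef_reflX, reflX_conv, reflX_oddPart, R.reflX_smoothing (reflX_evenPart v)]
      simp
    have hN2 : coef R.k (flipX m) (conv R.k (oddPart v) (oddPart v)) =
        coef R.k m (conv R.k (oddPart v) (oddPart v)) := by
      rw [← coef_reflX, reflX_conv, reflX_oddPart]
      simp
    have hη : coef R.k m (etaSeq R B v) = coef R.k m (evenPart v) / slope R.α R.γ m.1 := by
      have : m ≠ 0 := fun h => hm (by rw [h]; rfl)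
      rw [etaSeq, map_add, map_smul, coef_modeVec, if_neg this, smoothing, coef_diagonalOp,
        smul_zero, add_zero, inv_mul_eq_div]
    have hconv : coef R.k m (conv R.k (oddPart v) (etaSeq R B v)) =
        coef R.k m (conv R.k (oddPart v) (R.smoothing (evenPart v))) + B * coef R.k m (oddPart v) := by
      rw [etaSeq, map_add, map_smul, conv_modeVec_zero, map_add, map_smul, smul_eq_mul]
    have hsplit : ∀ n, coef R.k n v = coef R.k n (evenPart v) + coef R.k n (oddPart v) := by
      intro n
      rw [coef_evenPart, coef_oddPart]
      ring
    have hs : slope R.α R.γ m.1 ≠ 0 := (one_pos.trans_le (one_le_slope R.hα R.hγ _)).ne'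
    have hs2 := slope_sq R.hα R.hγ m.1
    rw [hη, hconv]
    simp only [hsplit, nonlin_apply, map_add, map_smul, smul_eq_mul, smoothing, symbol, num₁,
      num₂, num₃, coef_diagonalOp] at e1 e2
    rw [← smoothing] at e1 e2
    simp only [coef_evenPart_flipX, coef_oddPart_flipX, hsl, hN1, hN2] at e2
    simp only [flipX, Int.cast_neg] at e2
    set h := coef R.k m (evenPart v)
    set u := coef R.k m (oddPart v)
    set N1 := coef R.k m (conv R.k (oddPart v) (R.smoothing (evenPart v)))
    set N2 := coef R.k m (conv R.k (oddPart v) (oddPart v))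
    set s := slope R.α R.γ m.1
    have ht : s * s⁻¹ = 1 := mul_inv_cancel₀ hs
    rw [div_eq_mul_inv]
    set t := s⁻¹
    constructor
    · linear_combination t / 2 * e1 + t / 2 * e2 -
        (R.β + ν) * m.1 * (u + N1 + B * u) * ht
    · linear_combination e1 / 2 - e2 / 2 - (R.β + ν) * m.1 * N2 / 2 * ht +
        (R.β + ν) * m.1 * s * h * ht - (R.β + ν) * m.1 * h * t * hs2
  have hu0 : ∀ m : ℤ × ℤ, m.1 = 0 → coef R.k m (oddPart v) = 0 := fun m hm => by
    rw [coef_oddPart, coef_apply, coef_apply, hv0 m hm, hv0 (flipX m) (by simp [flipX, hm])]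
    ring
  constructor
  · intro m
    -- At `p = 0` the flux term has a factor `p`, and `η` has only its constant mode there, which is
    -- killed by the factor `q`.
    by_cases hm : m.1 = 0
    · rw [hm]
      by_cases hm2 : m.2 = 0
      · rw [hm2]; simp
      · have h0 : m ≠ 0 := fun h => hm2 (by rw [h]; rfl)
        have : coef R.k m (etaSeq R B v) = 0 := by
          rw [etaSeq, map_add, map_smul, coef_modeVec, if_neg h0, smoothing, coef_diagonalOp,
            coef_evenPart, coef_apply, coef_apply, hv0 m hm, hv0 (flipX m) (by simp [flipX, hm])]
          simp
        rw [this]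
        simp
    · exact (hmain m hm).1
  · intro m
    by_cases hm : m.1 = 0
    · rw [hu0 m hm, hm]
      simp
    · exact (hmain m hm).2

end Solution

end ResonantData

/-! ### From symmetric coefficients to functions on the torus. -/

section CosineSeries

/-- The phase `p x + q t`. -/
def phase (m : ℤ × ℤ) (z : ℝ × ℝ) : ℝ := m.1 * z.1 + m.2 * z.2

theorem continuous_phase (m : ℤ × ℤ) : Continuous (phase m) := by
  unfold phase
  fun_prop

theorem phase_add (m n : ℤ × ℤ) (z : ℝ × ℝ) : phase (m + n) z = phase m z + phase n z := by
  simp only [phase, Prod.fst_add, Prod.snd_add, Int.cast_add]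
  ring

theorem phase_neg (m : ℤ × ℤ) (z : ℝ × ℝ) : phase (-m) z = -phase m z := by
  simp only [phase, Prod.fst_neg, Prod.snd_neg, Int.cast_neg]
  ring

theorem abs_div_weight_le (k : ℕ) (m : ℤ × ℤ) {x : ℝ} (hx : |x| ≤ 1) : ‖x / weight k m‖ ≤ 1 := by
  rw [Real.norm_eq_abs, abs_div, abs_of_pos (weight_pos k m)]
  exact div_le_one_of_le₀ (hx.trans (one_le_weight k m)) (weight_pos k m).le

/-- Evaluation at a point of the cosine series with given coefficients. -/
def cosEval (k : ℕ) (z : ℝ × ℝ) : Seq →L[ℝ] ℝ :=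
  liftBounded (fun m => Real.cos (phase m z) / weight k m) 1
    (fun m => abs_div_weight_le k m (Real.abs_cos_le_one _))

/-- Evaluation at a point of the sine series with given coefficients. -/
def sinEval (k : ℕ) (z : ℝ × ℝ) : Seq →L[ℝ] ℝ :=
  liftBounded (fun m => Real.sin (phase m z) / weight k m) 1
    (fun m => abs_div_weight_le k m (Real.abs_sin_le_one _))

/-- The function on the plane with given cosine coefficients. -/
def cosSeries (k : ℕ) (a : Seq) : ℝ × ℝ → ℝ := fun z => cosEval k z a

theorem cosEval_modeVec (k : ℕ) (z : ℝ × ℝ) (m : ℤ × ℤ) :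
    cosEval k z (modeVec k m) = Real.cos (phase m z) := by
  rw [modeVec, map_smul, cosEval, liftBounded_basisVec, smul_eq_mul,
    mul_div_cancel₀ _ (weight_ne_zero k m)]

theorem sinEval_modeVec (k : ℕ) (z : ℝ × ℝ) (m : ℤ × ℤ) :
    sinEval k z (modeVec k m) = Real.sin (phase m z) := by
  rw [modeVec, map_smul, sinEval, liftBounded_basisVec, smul_eq_mul,
    mul_div_cancel₀ _ (weight_ne_zero k m)]

theorem hasSum_cosSeries (k : ℕ) (a : Seq) (z : ℝ × ℝ) :
    HasSum (fun m => coef k m a * Real.cos (phase m z)) (cosSeries k a z) := by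
  have := hasSum_liftBounded (fun m => Real.cos (phase m z) / weight k m) 1
    (fun m => abs_div_weight_le k m (Real.abs_cos_le_one _)) a
  refine this.congr_fun fun m => ?_
  rw [coef_apply, smul_eq_mul]
  ring

theorem abs_coef_le (k : ℕ) (m : ℤ × ℤ) (a : Seq) : |coef k m a| ≤ |a m| := by
  rw [← abs_coef_mul_weight k m a]
  exact le_mul_of_one_le_left (abs_nonneg _) (one_le_weight k m)

theorem summable_abs_coef (k : ℕ) (a : Seq) : Summable fun m => |coef k m a| :=
  Summable.of_nonneg_of_le (fun _ => abs_nonneg _) (fun m => abs_coef_le k m a)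
    (hasSum_norm_summableFamily a).summable

theorem abs_cosSeries_le (k : ℕ) (a : Seq) (z : ℝ × ℝ) : |cosSeries k a z| ≤ ‖a‖ := by
  have := (cosEval k z).le_of_opNorm_le (norm_liftBounded_le _ _ zero_le_one _) a
  rwa [one_mul] at this

theorem continuous_cosSeries (k : ℕ) (a : Seq) : Continuous (cosSeries k a) := by
  have : cosSeries k a = fun z => ∑' m, coef k m a * Real.cos (phase m z) :=
    funext fun z => (hasSum_cosSeries k a z).tsum_eq.symm
  rw [this]
  refine continuous_tsum (fun m => ?_) (summable_abs_coef k a) fun m z => ?_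
  · exact continuous_const.mul (Real.continuous_cos.comp (continuous_phase m))
  · rw [Real.norm_eq_abs, abs_mul]
    exact mul_le_of_le_one_right (abs_nonneg _) (Real.abs_cos_le_one _)

theorem cosSeries_add (k : ℕ) (a b : Seq) (z : ℝ × ℝ) :
    cosSeries k (a + b) z = cosSeries k a z + cosSeries k b z := map_add _ _ _

theorem cosSeries_sub (k : ℕ) (a b : Seq) (z : ℝ × ℝ) :
    cosSeries k (a - b) z = cosSeries k a z - cosSeries k b z := map_sub _ _ _

theorem cosSeries_smul (k : ℕ) (c : ℝ) (a : Seq) (z : ℝ × ℝ) :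
    cosSeries k (c • a) z = c * cosSeries k a z := map_smul _ _ _

theorem cosSeries_modeVec (k : ℕ) (m : ℤ × ℤ) (z : ℝ × ℝ) :
    cosSeries k (modeVec k m) z = Real.cos (phase m z) := cosEval_modeVec k z m

/-- The terms at `m` and `-m` cancel. This removes the sine products from the addition formula,
making multiplication of cosine series a convolution. -/
theorem sinEval_eq_zero (k : ℕ) (z : ℝ × ℝ) {a : Seq} (ha : reflXT a = a) :
    sinEval k z a = 0 := by
  have h : (sinEval k z).comp reflXT = -sinEval k z := by
    refine seq_clm_ext k fun i => ?_
    simp [reflXT, reindexOp_modeVec k (weight_neg k), sinEval_modeVec, phase_neg]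
  have h1 := congrArg (fun T => T a) h
  simp only [ContinuousLinearMap.comp_apply, ha, _root_.neg_apply] at h1
  linarith

/-- Products of cosine series correspond to convolutions of symmetric coefficients. -/
theorem cosSeries_conv (k : ℕ) {a b : Seq} (ha : reflXT a = a) (hb : reflXT b = b) (z : ℝ × ℝ) :
    cosSeries k (conv k a b) z = cosSeries k a z * cosSeries k b z := by
  have h : (ContinuousLinearMap.compL ℝ Seq Seq ℝ (cosEval k z)).comp (conv k) =
      (ContinuousLinearMap.mul ℝ ℝ).bilinearComp (cosEval k z) (cosEval k z) -
      (ContinuousLinearMap.mul ℝ ℝ).bilinearComp (sinEval k z) (sinEval k z) := by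
    refine seq_bilinear_ext k fun i j => ?_
    simp [conv_modeVec, cosEval_modeVec, sinEval_modeVec, phase_add, Real.cos_add]
  have h1 := congrArg (fun T => T a b) h
  simpa [cosSeries, sinEval_eq_zero k z ha, sinEval_eq_zero k z hb] using h1

theorem cosSeries_flip (k : ℕ) (a : Seq) (x t : ℝ) :
    cosSeries k a (-x, t) = cosSeries k (reflX a) (x, t) := by
  have h : cosEval k (-x, t) = (cosEval k (x, t)).comp reflX := by
    refine seq_clm_ext k fun i => ?_
    simp [reflX, reindexOp_modeVec k (weight_flipX k), cosEval_modeVec, phase, flipX]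
  exact congrArg (fun T => T a) h

theorem doublyPeriodic_cosSeries (k : ℕ) (a : Seq) : DoublyPeriodic (cosSeries k a) := by
  intro x t
  constructor
  · have h : cosEval k (x + 2 * Real.pi, t) = cosEval k (x, t) := by
      refine seq_clm_ext k fun i => ?_
      have : phase i (x + 2 * Real.pi, t) = phase i (x, t) + i.1 * (2 * Real.pi) := by
        simp only [phase]; ring
      rw [cosEval_modeVec, cosEval_modeVec, this, Real.cos_add_int_mul_two_pi]
    exact congrArg (fun T => T a) h
  · have h : cosEval k (x, t + 2 * Real.pi) = cosEval k (x, t) := by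
      refine seq_clm_ext k fun i => ?_
      have : phase i (x, t + 2 * Real.pi) = phase i (x, t) + i.2 * (2 * Real.pi) := by
        simp only [phase]; ring
      rw [cosEval_modeVec, cosEval_modeVec, this, Real.cos_add_int_mul_two_pi]
    exact congrArg (fun T => T a) h

end CosineSeries

/-! ### Integration over the period cell. -/

section CellIntegrals

variable {E : Type*} [NormedAddCommGroup E]

theorem integrableOn_cell {f : ℝ × ℝ → E} (hf : Continuous f) : IntegrableOn f cell := by
  have hK : IsCompact (Set.Icc (-Real.pi) Real.pi ×ˢ Set.Icc (-Real.pi) Real.pi) :=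
    isCompact_Icc.prod isCompact_Icc
  exact (hf.continuousOn.integrableOn_compact hK).mono_set
    (Set.prod_mono Set.Ioc_subset_Icc_self Set.Ioc_subset_Icc_self)

instance isFiniteMeasure_cell : IsFiniteMeasure (volume.restrict cell) := by
  refine ⟨?_⟩
  rw [Measure.restrict_apply_univ, cell, Measure.volume_eq_prod, Measure.prod_prod]
  exact ENNReal.mul_lt_top (by simp) (by simp)

variable [NormedSpace ℝ E]

theorem integral_cell [CompleteSpace E] {f : ℝ × ℝ → E} (hf : Continuous f) :
    ∫ z in cell, f z = ∫ x in -Real.pi..Real.pi, ∫ t in -Real.pi..Real.pi, f (x, t) := by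
  have hpi : -Real.pi ≤ Real.pi := by linarith [Real.pi_pos]
  have h := integrableOn_cell hf
  rw [cell, Measure.volume_eq_prod] at *
  rw [setIntegral_prod _ h, intervalIntegral.integral_of_le hpi]
  simp only [intervalIntegral.integral_of_le hpi]

theorem integral_cell_swap [CompleteSpace E] {f : ℝ × ℝ → E} (hf : Continuous f) :
    ∫ z in cell, f z = ∫ t in -Real.pi..Real.pi, ∫ x in -Real.pi..Real.pi, f (x, t) := by
  have h1 := integral_cell (hf.comp continuous_swap)
  rw [cell, Measure.volume_eq_prod] at h1 ⊢
  rw [← setIntegral_prod_swap]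
  exact h1

theorem integral_cell_timeShift [CompleteSpace E] {f : ℝ × ℝ → E} (hf : Continuous f)
    (hper : ∀ x t : ℝ, f (x, t + 2 * Real.pi) = f (x, t)) (τ : ℝ) :
    ∫ z in cell, f (z.1, z.2 + τ) = ∫ z in cell, f z := by
  rw [integral_cell hf, integral_cell (f := fun z => f (z.1, z.2 + τ)) (by fun_prop)]
  refine intervalIntegral.integral_congr fun x _ => ?_
  simp only
  rw [intervalIntegral.integral_comp_add_right (fun t => f (x, t))]
  have h := (show Function.Periodic (fun t => f (x, t)) (2 * Real.pi) from hper x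
    ).intervalIntegral_add_eq (-Real.pi + τ) (-Real.pi)
  have e1 : -Real.pi + τ + 2 * Real.pi = Real.pi + τ := by ring
  have e2 : -Real.pi + 2 * Real.pi = Real.pi := by ring
  rwa [e1, e2] at h

/-- Termwise integration of a cosine series against a continuous function. -/
theorem hasSum_integral_cosSeries [CompleteSpace E] (k : ℕ) (a : Seq) {g : ℝ × ℝ → E}
    (hg : Continuous g) :
    HasSum (fun m => coef k m a • ∫ z in cell, Real.cos (phase m z) • g z)
      (∫ z in cell, cosSeries k a z • g z) := by
  have hc : ∀ m : ℤ × ℤ, Continuous fun z => Real.cos (phase m z) • g z := fun m =>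
    (Real.continuous_cos.comp (continuous_phase m)).smul hg
  have h := hasSum_integral_of_summable_integral_norm (μ := volume.restrict cell)
    (F := fun m z => coef k m a • (Real.cos (phase m z) • g z))
    (fun m => (integrableOn_cell (hc m)).smul _) (by
      refine Summable.of_nonneg_of_le (fun m => integral_nonneg fun z => norm_nonneg _)
        (fun m => ?_) ((summable_abs_coef k a).mul_right (∫ z in cell, ‖g z‖))
      rw [← integral_const_mul]
      refine integral_mono ((integrableOn_cell (hc m)).smul _).norm
        ((integrableOn_cell hg).norm.const_mul _) fun z => ?_
      simp only [norm_smul, Real.norm_eq_abs]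
      gcongr
      exact mul_le_of_le_one_left (norm_nonneg _) (Real.abs_cos_le_one _))
  simp only [integral_smul] at h
  convert h using 1
  refine integral_congr_ae (Filter.Eventually.of_forall fun z => ?_)
  have := ((hasSum_cosSeries k a z).smul_const (g z)).tsum_eq
  simp only [smul_smul, ← this]

end CellIntegrals

/-! ### Fourier coefficients and Sobolev norms of cosine series. -/

section FourierCoefficients

/-- The complex exponential at a frequency. -/
def expMode (m : ℤ × ℤ) (z : ℝ × ℝ) : ℂ :=
  Complex.exp (Complex.I * ((m.1 : ℂ) * (z.1 : ℂ) + (m.2 : ℂ) * (z.2 : ℂ)))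

theorem continuous_expMode (m : ℤ × ℤ) : Continuous (expMode m) := by
  unfold expMode
  fun_prop

theorem expMode_add (m n : ℤ × ℤ) (z : ℝ × ℝ) : expMode (m + n) z = expMode m z * expMode n z := by
  rw [expMode, expMode, expMode, ← Complex.exp_add]
  congr 1
  simp only [Prod.fst_add, Prod.snd_add, Int.cast_add]
  ring

theorem integral_exp_int_mul (n : ℤ) :
    ∫ x in -Real.pi..Real.pi, Complex.exp (Complex.I * ((n : ℂ) * (x : ℂ))) =
      if n = 0 then 2 * (Real.pi : ℂ) else 0 := by
  split_ifs with h
  · subst h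
    simp
    ring
  · have h0 : Complex.I * (n : ℂ) ≠ 0 :=
      mul_ne_zero Complex.I_ne_zero (Int.cast_ne_zero.mpr h)
    have h1 := integral_exp_mul_complex (a := -Real.pi) (b := Real.pi) h0
    simp only [mul_assoc] at h1
    rw [h1, div_eq_zero_iff]
    left
    have h2 : Complex.I * ((n : ℂ) * (Real.pi : ℂ)) =
        Complex.I * ((n : ℂ) * ((-Real.pi : ℝ) : ℂ)) + n * (2 * Real.pi * Complex.I) := by
      push_cast
      ring
    rw [h2, Complex.exp_add, Complex.exp_int_mul_two_pi_mul_I, mul_one, sub_self]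

theorem integral_expMode (m : ℤ × ℤ) :
    ∫ z in cell, expMode m z = if m = 0 then 4 * (Real.pi : ℂ) ^ 2 else 0 := by
  rw [integral_cell (continuous_expMode m)]
  have h : ∀ x t : ℝ, expMode m (x, t) = Complex.exp (Complex.I * ((m.1 : ℂ) * (x : ℂ))) *
      Complex.exp (Complex.I * ((m.2 : ℂ) * (t : ℂ))) := fun x t => by
    rw [expMode, ← Complex.exp_add]
    congr 1
    ring
  simp only [h, intervalIntegral.integral_const_mul, intervalIntegral.integral_mul_const,
    integral_exp_int_mul]
  by_cases h1 : m.1 = 0 <;> by_cases h2 : m.2 = 0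
  · have : m = 0 := Prod.ext h1 h2
    simp [this]
    ring
  all_goals
    have : m ≠ 0 := fun h => by simp [h] at h1 h2
    simp [h1, h2, this]

theorem ofReal_cos_phase (m : ℤ × ℤ) (z : ℝ × ℝ) :
    ((Real.cos (phase m z) : ℝ) : ℂ) = (expMode m z + expMode (-m) z) / 2 := by
  rw [Complex.ofReal_cos, Complex.cos, expMode, expMode, phase]
  push_cast
  simp only [Prod.fst_neg, Prod.snd_neg, Int.cast_neg]
  congr 3 <;> ring

theorem integral_cos_phase_mul_expMode (m n : ℤ × ℤ) :
    ∫ z in cell, Real.cos (phase m z) • expMode (-n) z =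
      2 * (Real.pi : ℂ) ^ 2 * ((if m = n then 1 else 0) + if m = -n then 1 else 0) := by
  have h : ∀ z, Real.cos (phase m z) • expMode (-n) z =
      (1 / 2 : ℂ) * expMode (m - n) z + (1 / 2 : ℂ) * expMode (-m - n) z := fun z => by
    rw [Complex.real_smul, ofReal_cos_phase, sub_eq_add_neg, sub_eq_add_neg, expMode_add,
      expMode_add]
    ring
  simp only [h]
  rw [integral_add ((integrableOn_cell (continuous_expMode _)).const_mul _)
    ((integrableOn_cell (continuous_expMode _)).const_mul _), integral_const_mul,
    integral_const_mul, integral_expMode, integral_expMode]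
  have e1 : (m - n = 0) ↔ (m = n) := sub_eq_zero
  have e2 : (-m - n = 0) ↔ (m = -n) := by rw [sub_eq_zero, neg_eq_iff_eq_neg]
  simp only [e1, e2]
  split_ifs <;> ring

theorem fourierCoef_eq (w : ℝ × ℝ → ℝ) (p q : ℤ) : fourierCoef w p q =
    (1 / (4 * (Real.pi : ℂ) ^ 2)) * ∫ z in cell, w z • expMode (-(p, q)) z := by
  rw [fourierCoef]
  congr 1
  refine integral_congr_ae (Filter.Eventually.of_forall fun z => ?_)
  simp only [expMode, Complex.real_smul, Int.cast_neg, Prod.neg_mk]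
  congr 2
  ring

/-- Each cosine is half the sum of two opposite exponentials, so termwise integration gives the mean
of the coefficients at `m` and `-m`, and symmetry makes them equal. -/
theorem fourierCoef_cosSeries (k : ℕ) {a : Seq} (ha : reflXT a = a) (m : ℤ × ℤ) :
    fourierCoef (cosSeries k a) m.1 m.2 = (coef k m a : ℂ) := by
  have h1 := hasSum_integral_cosSeries k a (continuous_expMode (-m))
  have h2 : HasSum (fun n => coef k n a • ∫ z in cell, Real.cos (phase n z) • expMode (-m) z)
      (2 * (Real.pi : ℂ) ^ 2 * (coef k m a + coef k (-m) a)) := by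
    have e1 := hasSum_ite_eq m (2 * (Real.pi : ℂ) ^ 2 * (coef k m a : ℂ))
    have e2 := hasSum_ite_eq (-m) (2 * (Real.pi : ℂ) ^ 2 * (coef k (-m) a : ℂ))
    rw [mul_add]
    refine (e1.add e2).congr_fun fun n => ?_
    rw [integral_cos_phase_mul_expMode, Complex.real_smul]
    by_cases h3 : n = m
    · by_cases h4 : n = -m
      · rw [if_pos h3, if_pos h4, if_pos h3, if_pos h4, ← h4, ← h3]
        ring
      · rw [if_pos h3, if_neg h4, if_pos h3, if_neg h4, ← h3]
        ring
    · by_cases h4 : n = -m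
      · rw [if_neg h3, if_pos h4, if_neg h3, if_pos h4, ← h4]
        ring
      · rw [if_neg h3, if_neg h4, if_neg h3, if_neg h4]
        ring
  have hpi : (Real.pi : ℂ) ≠ 0 := Complex.ofReal_ne_zero.mpr Real.pi_ne_zero
  rw [fourierCoef_eq, h1.unique h2, coef_reflXT_eq k m ha]
  field_simp
  ring

/-- A shifted cosine series need not be a cosine series, but its coefficients change only by a
unimodular factor, so Sobolev membership and vanishing modes persist. -/
theorem fourierCoef_timeShift {w : ℝ × ℝ → ℝ} (hw : Continuous w) (hper : DoublyPeriodic w)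
    (τ : ℝ) (p q : ℤ) :
    fourierCoef (timeShift τ w) p q = expMode (0, q) (0, τ) * fourierCoef w p q := by
  have h := integral_cell_timeShift (f := fun z => w z • expMode (-(p, q)) z)
    (hw.smul (continuous_expMode _)) (fun x t => by
      have : expMode (-(p, q)) (x, t + 2 * Real.pi) = expMode (-(p, q)) (x, t) := by
        rw [expMode, expMode, Complex.exp_eq_exp_iff_exists_int]
        exact ⟨-q, by simp only [Prod.neg_mk]; push_cast; ring⟩
      rw [(hper x t).2, this]) τ
  have key : ∫ z in cell, timeShift τ w z • expMode (-(p, q)) z =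
      expMode (0, q) (0, τ) * ∫ z in cell, w (z.1, z.2 + τ) • expMode (-(p, q)) (z.1, z.2 + τ) := by
    rw [← integral_const_mul]
    refine integral_congr_ae (Filter.Eventually.of_forall fun z => ?_)
    have : expMode (-(p, q)) z = expMode (0, q) (0, τ) * expMode (-(p, q)) (z.1, z.2 + τ) := by
      rw [expMode, expMode, expMode, ← Complex.exp_add]
      congr 1
      simp only [Prod.neg_mk]
      push_cast
      ring
    simp only [this, timeShift, Complex.real_smul]
    ring
  rw [fourierCoef_eq, fourierCoef_eq, key, h, mul_left_comm]

theorem norm_expMode (m : ℤ × ℤ) (z : ℝ × ℝ) : ‖expMode m z‖ = 1 := by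
  rw [expMode, mul_comm, show ((m.1 : ℂ) * (z.1 : ℂ) + (m.2 : ℂ) * (z.2 : ℂ)) =
    ((phase m z : ℝ) : ℂ) by simp [phase], Complex.norm_exp_ofReal_mul_I]

/-- The weight dominates the Sobolev weight, so each term is at most `|a m|²`; summing bounds the
`H^k` norm by the `ℓ¹` norm. -/
theorem sobolevTerm_cosSeries_le (k : ℕ) {a : Seq} (ha : reflXT a = a) (m : ℤ × ℤ) :
    sobolevTerm k (cosSeries k a) m ≤ ‖a‖ * |a m| := by
  rw [sobolevTerm, fourierCoef_cosSeries k ha, Complex.norm_real, Real.norm_eq_abs]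
  calc (1 + (m.1 : ℝ) ^ 2 + (m.2 : ℝ) ^ 2) ^ k * |coef k m a| ^ 2
      ≤ weight k m ^ 2 * |coef k m a| ^ 2 := by gcongr; exact sobolev_weight_le k m
    _ = |a m| * |a m| := by rw [← mul_pow, abs_coef_mul_weight, sq]
    _ ≤ ‖a‖ * |a m| := by
      gcongr
      exact lp.norm_apply_le_norm one_ne_zero a m

theorem sobolevTerm_nonneg (k : ℕ) (w : ℝ × ℝ → ℝ) (m : ℤ × ℤ) : 0 ≤ sobolevTerm k w m := by
  unfold sobolevTerm
  positivity

theorem summable_sobolevTerm_cosSeries (k : ℕ) {a : Seq} (ha : reflXT a = a) :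
    Summable (sobolevTerm k (cosSeries k a)) :=
  Summable.of_nonneg_of_le (sobolevTerm_nonneg k _) (sobolevTerm_cosSeries_le k ha)
    ((hasSum_norm_summableFamily a).summable.mul_left ‖a‖)

theorem sobolevNorm_cosSeries_le (k : ℕ) {a : Seq} (ha : reflXT a = a) :
    sobolevNorm k (cosSeries k a) ≤ ‖a‖ := by
  rw [sobolevNorm, Real.sqrt_le_left (norm_nonneg _), sq]
  refine ((summable_sobolevTerm_cosSeries k ha).tsum_le_tsum (sobolevTerm_cosSeries_le k ha)
    ((hasSum_norm_summableFamily a).summable.mul_left ‖a‖)).trans_eq ?_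
  rw [tsum_mul_left, (hasSum_norm_summableFamily a).tsum_eq]

theorem memH_timeShift_cosSeries (k : ℕ) {a : Seq} (ha : reflXT a = a) (τ : ℝ) :
    MemH k (timeShift τ (cosSeries k a)) where
  periodic x t := by
    have h := doublyPeriodic_cosSeries k a x (t + τ)
    refine ⟨h.1, ?_⟩
    simp only [timeShift]
    rw [← h.2]
    congr 2
    ring
  memLp := by
    have hc : Continuous (timeShift τ (cosSeries k a)) :=
      (continuous_cosSeries k a).comp (by fun_prop : Continuous fun z : ℝ × ℝ => (z.1, z.2 + τ))
    exact MemLp.of_bound hc.aestronglyMeasurable ‖a‖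
      (Filter.Eventually.of_forall fun z => abs_cosSeries_le k a _)
  summable := by
    refine (summable_sobolevTerm_cosSeries k ha).congr fun m => ?_
    rw [sobolevTerm, sobolevTerm, fourierCoef_timeShift (continuous_cosSeries k a)
      (doublyPeriodic_cosSeries k a), norm_mul, norm_expMode, one_mul]

end FourierCoefficients

/-! ### Integration by parts against periodic test functions. -/

section TestFunctions

variable {φ : ℝ × ℝ → ℝ}

theorem hasDerivAt_dx (hφ : ContDiff ℝ ∞ φ) (x t : ℝ) :
    HasDerivAt (fun y => φ (y, t)) (dx φ (x, t)) x := by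
  have h : DifferentiableAt ℝ (fun y => φ (y, t)) x :=
    (hφ.differentiable (by simp)).comp (by fun_prop : Differentiable ℝ fun y : ℝ => (y, t)) x
  exact h.hasDerivAt

theorem hasDerivAt_dt (hφ : ContDiff ℝ ∞ φ) (x t : ℝ) :
    HasDerivAt (fun s => φ (x, s)) (dt φ (x, t)) t := by
  have h : DifferentiableAt ℝ (fun s => φ (x, s)) t :=
    (hφ.differentiable (by simp)).comp (by fun_prop : Differentiable ℝ fun s : ℝ => (x, s)) t
  exact h.hasDerivAt

theorem dx_eq_fderiv (hφ : ContDiff ℝ ∞ φ) : dx φ = fun z => fderiv ℝ φ z (1, 0) := by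
  funext z
  have h1 : HasDerivAt (fun y : ℝ => (y, z.2)) ((1 : ℝ), (0 : ℝ)) z.1 :=
    (hasDerivAt_id z.1).prodMk (hasDerivAt_const z.1 z.2)
  have h2 : HasFDerivAt φ (fderiv ℝ φ z) (z.1, z.2) :=
    (hφ.differentiable (by simp) z).hasFDerivAt
  exact (h2.comp_hasDerivAt z.1 h1).deriv

theorem dt_eq_fderiv (hφ : ContDiff ℝ ∞ φ) : dt φ = fun z => fderiv ℝ φ z (0, 1) := by
  funext z
  have h1 : HasDerivAt (fun s : ℝ => (z.1, s)) ((0 : ℝ), (1 : ℝ)) z.2 :=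
    (hasDerivAt_const z.2 z.1).prodMk (hasDerivAt_id z.2)
  have h2 : HasFDerivAt φ (fderiv ℝ φ z) (z.1, z.2) :=
    (hφ.differentiable (by simp) z).hasFDerivAt
  exact (h2.comp_hasDerivAt z.2 h1).deriv

theorem contDiff_dx (hφ : ContDiff ℝ ∞ φ) : ContDiff ℝ ∞ (dx φ) := by
  rw [dx_eq_fderiv hφ]
  exact (hφ.fderiv_right (by simp)).clm_apply contDiff_const

theorem contDiff_dt (hφ : ContDiff ℝ ∞ φ) : ContDiff ℝ ∞ (dt φ) := by
  rw [dt_eq_fderiv hφ]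
  exact (hφ.fderiv_right (by simp)).clm_apply contDiff_const

theorem dt_timeShift (τ : ℝ) (φ : ℝ × ℝ → ℝ) : dt (timeShift τ φ) = timeShift τ (dt φ) := by
  funext z
  exact deriv_comp_add_const (fun s => φ (z.1, s)) τ z.2

theorem dx_timeShift (τ : ℝ) (φ : ℝ × ℝ → ℝ) : dx (timeShift τ φ) = timeShift τ (dx φ) := rfl

theorem DoublyPeriodic.dx (h : DoublyPeriodic φ) : DoublyPeriodic (dx φ) := by
  intro x t
  constructor
  · have h1 : (fun y => φ (y + 2 * Real.pi, t)) = fun y => φ (y, t) := funext fun y => (h y t).1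
    have h2 := deriv_comp_add_const (fun y => φ (y, t)) (2 * Real.pi) x
    rw [h1] at h2
    exact h2.symm
  · have h1 : (fun y => φ (y, t + 2 * Real.pi)) = fun y => φ (y, t) := funext fun y => (h y t).2
    simp only [BonaSmith.dx, h1]

theorem DoublyPeriodic.dt (h : DoublyPeriodic φ) : DoublyPeriodic (dt φ) := by
  intro x t
  constructor
  · have h1 : (fun s => φ (x + 2 * Real.pi, s)) = fun s => φ (x, s) := funext fun s => (h x s).1
    simp only [BonaSmith.dt, h1]
  · have h1 : (fun s => φ (x, s + 2 * Real.pi)) = fun s => φ (x, s) := funext fun s => (h x s).2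
    have h2 := deriv_comp_add_const (fun s => φ (x, s)) (2 * Real.pi) t
    rw [h1] at h2
    exact h2.symm

theorem DoublyPeriodic.timeShift (h : DoublyPeriodic φ) (τ : ℝ) :
    DoublyPeriodic (timeShift τ φ) := by
  intro x t
  refine ⟨(h x (t + τ)).1, ?_⟩
  have := (h x (t + τ)).2
  simp only [BonaSmith.timeShift]
  rw [← this]
  congr 2
  ring

theorem neg_pi_add_two_pi : -Real.pi + 2 * Real.pi = Real.pi := by ring

theorem phase_add_two_pi (m : ℤ × ℤ) (x t : ℝ) :
    phase m (x + 2 * Real.pi, t) = phase m (x, t) + m.1 * (2 * Real.pi) ∧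
    phase m (x, t + 2 * Real.pi) = phase m (x, t) + m.2 * (2 * Real.pi) := by
  constructor <;> simp only [phase] <;> ring

/-- Integration by parts in `x` on the torus. -/
theorem integral_mul_dx {g g' : ℝ × ℝ → ℝ} (hg : Continuous g) (hg' : Continuous g')
    (hd : ∀ x t, HasDerivAt (fun y => g (y, t)) (g' (x, t)) x)
    (hper : ∀ x t, g (x + 2 * Real.pi, t) = g (x, t)) (hφ : ContDiff ℝ ∞ φ)
    (hφp : DoublyPeriodic φ) :
    ∫ z in cell, g z * dx φ z = -∫ z in cell, g' z * φ z := by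
  have hc := hφ.continuous
  have hc' := (contDiff_dx hφ).continuous
  have h0 : ∫ z in cell, (g' z * φ z + g z * dx φ z) = 0 := by
    rw [integral_cell_swap (by fun_prop)]
    refine (intervalIntegral.integral_congr fun t _ => ?_).trans
      (intervalIntegral.integral_zero)
    rw [intervalIntegral.integral_eq_sub_of_hasDerivAt
      (fun x _ => (hd x t).mul (hasDerivAt_dx hφ x t))
      (Continuous.intervalIntegrable (by fun_prop) _ _)]
    have e1 := hper (-Real.pi) t
    have e2 := (hφp (-Real.pi) t).1
    rw [neg_pi_add_two_pi] at e1 e2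
    simp [e1, e2]
  rw [integral_add (integrableOn_cell (by fun_prop)) (integrableOn_cell (by fun_prop))] at h0
  linarith

/-- Integration by parts in `t` on the torus. -/
theorem integral_mul_dt {g g' : ℝ × ℝ → ℝ} (hg : Continuous g) (hg' : Continuous g')
    (hd : ∀ x t, HasDerivAt (fun s => g (x, s)) (g' (x, t)) t)
    (hper : ∀ x t, g (x, t + 2 * Real.pi) = g (x, t)) (hφ : ContDiff ℝ ∞ φ)
    (hφp : DoublyPeriodic φ) :
    ∫ z in cell, g z * dt φ z = -∫ z in cell, g' z * φ z := by
  have hc := hφ.continuous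
  have hc' := (contDiff_dt hφ).continuous
  have h0 : ∫ z in cell, (g' z * φ z + g z * dt φ z) = 0 := by
    rw [integral_cell (by fun_prop)]
    refine (intervalIntegral.integral_congr fun x _ => ?_).trans
      (intervalIntegral.integral_zero)
    rw [intervalIntegral.integral_eq_sub_of_hasDerivAt
      (fun t _ => (hd x t).mul (hasDerivAt_dt hφ x t))
      (Continuous.intervalIntegrable (by fun_prop) _ _)]
    have e1 := hper x (-Real.pi)
    have e2 := (hφp x (-Real.pi)).2
    rw [neg_pi_add_two_pi] at e1 e2
    simp [e1, e2]
  rw [integral_add (integrableOn_cell (by fun_prop)) (integrableOn_cell (by fun_prop))] at h0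
  linarith

theorem hasDerivAt_phase_fst (m : ℤ × ℤ) (x t : ℝ) :
    HasDerivAt (fun y => phase m (y, t)) m.1 x := by
  simpa [phase] using ((hasDerivAt_id x).const_mul (m.1 : ℝ)).add_const ((m.2 : ℝ) * t)

theorem hasDerivAt_phase_snd (m : ℤ × ℤ) (x t : ℝ) :
    HasDerivAt (fun s => phase m (x, s)) m.2 t := by
  simpa [phase] using ((hasDerivAt_id t).const_mul (m.2 : ℝ)).const_add ((m.1 : ℝ) * x)

theorem integral_cos_mul_dx (m : ℤ × ℤ) (hφ : ContDiff ℝ ∞ φ) (hφp : DoublyPeriodic φ) :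
    ∫ z in cell, Real.cos (phase m z) * dx φ z = m.1 * ∫ z in cell, Real.sin (phase m z) * φ z := by
  have hc := continuous_phase m
  rw [integral_mul_dx (g' := fun z => -Real.sin (phase m z) * m.1) (by fun_prop) (by fun_prop)
    (fun x t => (hasDerivAt_phase_fst m x t).cos)
    (fun x t => by rw [(phase_add_two_pi m x t).1, Real.cos_add_int_mul_two_pi]) hφ hφp,
    ← integral_const_mul, ← integral_neg]
  congr 1 with z
  ring

theorem integral_sin_mul_dx (m : ℤ × ℤ) (hφ : ContDiff ℝ ∞ φ) (hφp : DoublyPeriodic φ) :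
    ∫ z in cell, Real.sin (phase m z) * dx φ z =
      -(m.1 * ∫ z in cell, Real.cos (phase m z) * φ z) := by
  have hc := continuous_phase m
  rw [integral_mul_dx (g' := fun z => Real.cos (phase m z) * m.1) (by fun_prop) (by fun_prop)
    (fun x t => (hasDerivAt_phase_fst m x t).sin)
    (fun x t => by rw [(phase_add_two_pi m x t).1, Real.sin_add_int_mul_two_pi]) hφ hφp,
    ← integral_const_mul]
  congr 2 with z
  ring

theorem integral_cos_mul_dt (m : ℤ × ℤ) (hφ : ContDiff ℝ ∞ φ) (hφp : DoublyPeriodic φ) :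
    ∫ z in cell, Real.cos (phase m z) * dt φ z = m.2 * ∫ z in cell, Real.sin (phase m z) * φ z := by
  have hc := continuous_phase m
  rw [integral_mul_dt (g' := fun z => -Real.sin (phase m z) * m.2) (by fun_prop) (by fun_prop)
    (fun x t => (hasDerivAt_phase_snd m x t).cos)
    (fun x t => by rw [(phase_add_two_pi m x t).2, Real.cos_add_int_mul_two_pi]) hφ hφp,
    ← integral_const_mul, ← integral_neg]
  congr 1 with z
  ring

theorem integral_cos_mul_dx_dx (m : ℤ × ℤ) (hφ : ContDiff ℝ ∞ φ) (hφp : DoublyPeriodic φ) :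
    ∫ z in cell, Real.cos (phase m z) * dx (dx φ) z =
      -((m.1 : ℝ) ^ 2 * ∫ z in cell, Real.cos (phase m z) * φ z) := by
  rw [integral_cos_mul_dx m (contDiff_dx hφ) hφp.dx, integral_sin_mul_dx m hφ hφp]
  ring

end TestFunctions

/-! ### From Fourier equations to weak solutions. -/

section WeakSolutions

open ResonantData

/-- Termwise integration against a test function, in terms of sine coefficients. -/
theorem hasSum_integral_test (k : ℕ) (a : Seq) {φ ψ : ℝ × ℝ → ℝ} (hψ : Continuous ψ)
    {s : ℤ × ℤ → ℝ} (hs : ∀ m, ∫ z in cell, Real.cos (phase m z) * ψ z =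
      s m * ∫ z in cell, Real.sin (phase m z) * φ z) :
    HasSum (fun m => coef k m a * (s m * ∫ z in cell, Real.sin (phase m z) * φ z))
      (∫ z in cell, cosSeries k a z * ψ z) := by
  have h := hasSum_integral_cosSeries k a hψ
  simp only [smul_eq_mul, hs] at h
  exact h

/-- Every derivative on the test function has odd total order, so integrating by parts mode by mode
always leaves the same sine integral. The weak form is therefore a series whose term at `m` is minus
that integral times the Fourier equation at `m`. -/
theorem isWeakSolution_cosSeries {α β γ : ℝ} (k : ℕ) {η u : Seq} (hη : reflXT η = η)
    (hu : reflXT u = u) (h₁ : FirstFourier α β k η u) (h₂ : SecondFourier α β γ k η u) :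
    IsWeakSolution α β γ (cosSeries k η) (cosSeries k u) := by
  intro φ hφ hφp
  have hdx := contDiff_dx hφ
  have hdt := contDiff_dt hφ
  have c1 := hdx.continuous
  have c2 := hdt.continuous
  have c3 := (contDiff_dx (contDiff_dx hdt)).continuous
  have c4 := (contDiff_dx (contDiff_dx hdx)).continuous
  have cη := continuous_cosSeries k η
  have cu := continuous_cosSeries k u
  have s1 : ∀ m, ∫ z in cell, Real.cos (phase m z) * dx φ z =
      m.1 * ∫ z in cell, Real.sin (phase m z) * φ z := fun m => integral_cos_mul_dx m hφ hφp
  have s2 : ∀ m, ∫ z in cell, Real.cos (phase m z) * dt φ z =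
      m.2 * ∫ z in cell, Real.sin (phase m z) * φ z := fun m => integral_cos_mul_dt m hφ hφp
  have s3 : ∀ m, ∫ z in cell, Real.cos (phase m z) * dx (dx (dt φ)) z =
      (-((m.1 : ℝ) ^ 2 * m.2)) * ∫ z in cell, Real.sin (phase m z) * φ z := fun m => by
    rw [integral_cos_mul_dx_dx m hdt hφp.dt, s2]
    ring
  have s4 : ∀ m, ∫ z in cell, Real.cos (phase m z) * dx (dx (dx φ)) z =
      (-((m.1 : ℝ) ^ 2 * m.1)) * ∫ z in cell, Real.sin (phase m z) * φ z := fun m => by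
    rw [integral_cos_mul_dx_dx m hdx hφp.dx, s1]
    ring
  constructor
  · have e : ∀ z, -(cosSeries k η z * dt φ z) - β * (cosSeries k u z * dx φ z)
        + α * (cosSeries k η z * dx (dx (dt φ)) z)
        - β * (cosSeries k u z * cosSeries k η z * dx φ z) =
        -(cosSeries k η z * dt φ z) - β * (cosSeries k u z * dx φ z)
        + α * (cosSeries k η z * dx (dx (dt φ)) z)
        - β * (cosSeries k (conv k u η) z * dx φ z) := fun z => by rw [cosSeries_conv k hu hη]
    have cN := continuous_cosSeries k (conv k u η)
    simp only [e]
    rw [integral_sub (integrableOn_cell (by fun_prop)) (integrableOn_cell (by fun_prop)),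
      integral_add (integrableOn_cell (by fun_prop)) (integrableOn_cell (by fun_prop)),
      integral_sub (integrableOn_cell (by fun_prop)) (integrableOn_cell (by fun_prop)),
      integral_neg, integral_const_mul, integral_const_mul, integral_const_mul]
    refine HasSum.unique ((((hasSum_integral_test k η c2 s2).neg.sub
      ((hasSum_integral_test k u c1 s1).mul_left β)).add
      ((hasSum_integral_test k η c3 s3).mul_left α)).sub
      ((hasSum_integral_test k (conv k u η) c1 s1).mul_left β)) ?_
    convert hasSum_zero with m
    linear_combination (-∫ z in cell, Real.sin (phase m z) * φ z) * h₁ m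
  · have e : ∀ z, -(cosSeries k u z * dt φ z) - β * (cosSeries k η z * dx φ z)
        + γ * α * β * (cosSeries k η z * dx (dx (dx φ)) z)
        + α * (cosSeries k u z * dx (dx (dt φ)) z)
        - β * (cosSeries k u z ^ 2 / 2 * dx φ z) =
        -(cosSeries k u z * dt φ z) - β * (cosSeries k η z * dx φ z)
        + γ * α * β * (cosSeries k η z * dx (dx (dx φ)) z)
        + α * (cosSeries k u z * dx (dx (dt φ)) z)
        - β / 2 * (cosSeries k (conv k u u) z * dx φ z) := fun z => by
      rw [cosSeries_conv k hu hu]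
      ring
    have cN := continuous_cosSeries k (conv k u u)
    simp only [e]
    rw [integral_sub (integrableOn_cell (by fun_prop)) (integrableOn_cell (by fun_prop)),
      integral_add (integrableOn_cell (by fun_prop)) (integrableOn_cell (by fun_prop)),
      integral_add (integrableOn_cell (by fun_prop)) (integrableOn_cell (by fun_prop)),
      integral_sub (integrableOn_cell (by fun_prop)) (integrableOn_cell (by fun_prop)),
      integral_neg, integral_const_mul, integral_const_mul, integral_const_mul,
      integral_const_mul]
    refine HasSum.unique (((((hasSum_integral_test k u c2 s2).neg.sub
      ((hasSum_integral_test k η c1 s1).mul_left β)).add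
      ((hasSum_integral_test k η c4 s4).mul_left (γ * α * β))).add
      ((hasSum_integral_test k u c3 s3).mul_left α)).sub
      ((hasSum_integral_test k (conv k u u) c1 s1).mul_left (β / 2))) ?_
    convert hasSum_zero with m
    linear_combination (-∫ z in cell, Real.sin (phase m z) * φ z) * h₂ m

/-- The shift is moved to the test function as its inverse, by invariance of periodic integrals. -/
theorem IsWeakSolution.timeShift {α β γ : ℝ} {η u : ℝ × ℝ → ℝ} (h : IsWeakSolution α β γ η u)
    (hη : Continuous η) (hu : Continuous u) (hηp : DoublyPeriodic η) (hup : DoublyPeriodic u)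
    (τ : ℝ) : IsWeakSolution α β γ (timeShift τ η) (timeShift τ u) := by
  intro φ hφ hφp
  have hψ : ContDiff ℝ ∞ (BonaSmith.timeShift (-τ) φ) :=
    hφ.comp (by fun_prop : ContDiff ℝ ∞ fun z : ℝ × ℝ => (z.1, z.2 + -τ))
  have hψp := hφp.timeShift (-τ)
  obtain ⟨g₁, g₂⟩ := h _ hψ hψp
  have c1 := (contDiff_dx hψ).continuous
  have c2 := (contDiff_dt hψ).continuous
  have c3 := (contDiff_dx (contDiff_dx (contDiff_dt hψ))).continuous
  have c4 := (contDiff_dx (contDiff_dx (contDiff_dx hψ))).continuous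
  have p1 := hψp.dx
  have p2 := hψp.dt
  have p3 := hψp.dt.dx.dx
  have p4 := hψp.dx.dx.dx
  have hb : ∀ (w : ℝ × ℝ → ℝ) (z : ℝ × ℝ),
      BonaSmith.timeShift (-τ) w (z.1, z.2 + τ) = w z := fun w z => by
    simp [BonaSmith.timeShift]
  constructor
  · refine Eq.trans ?_ ((integral_cell_timeShift (by fun_prop) (fun x t => ?_) τ).trans g₁)
    · simp only [dt_timeShift, dx_timeShift, hb]
      rfl
    · rw [(hηp x t).2, (hup x t).2, (p1 x t).2, (p2 x t).2, (p3 x t).2]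
  · refine Eq.trans ?_ ((integral_cell_timeShift (by fun_prop) (fun x t => ?_) τ).trans g₂)
    · simp only [dt_timeShift, dx_timeShift, hb]
      rfl
    · rw [(hηp x t).2, (hup x t).2, (p1 x t).2, (p2 x t).2, (p3 x t).2, (p4 x t).2]

end WeakSolutions

/-! ### Properties of the solution at a branch point. -/

namespace ResonantData

section BranchPoint

variable {R : ResonantData} {μ ν B ρ A : ℝ} {V Z : Seq}

theorem IsBranchPoint.coef_eq_zero (h : R.IsBranchPoint μ ν B V Z ρ) {m : ℤ × ℤ} (hm : m.1 = 0) :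
    coef R.k m (A • V + A ^ 2 • Z) = 0 := by
  have hV : V m = 0 := (solution_odd h).1 m fun h' =>
    R.disjoint_grades h' ⟨0, by rw [hm, mul_zero]⟩
  have hZ : Z m = 0 := (solution_even h).1 m fun h' => h'.2 hm
  rw [coef_apply, seq_add_apply, seq_smul_apply, seq_smul_apply, hV, hZ]
  ring

/-- The odd equation normalises `V` at the resonance to the coefficient of the kernel vector, and
`Z` has the other grade. -/
theorem IsBranchPoint.coef_m₀ (h : R.IsBranchPoint μ ν B V Z ρ) :
    coef R.k R.m₀ (A • V + A ^ 2 • Z) = A * slope R.α R.γ R.p₀ := by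
  obtain ⟨g₁, -, g₃⟩ := solution_unprojected h
  have hZ : Z R.m₀ = 0 := (solution_even h).1 _ fun h' =>
    R.disjoint_grades R.m₀_mem_oddGrade h'.1
  have hV : coef R.k R.m₀ V = slope R.α R.γ R.p₀ := by
    have h1 := congrArg (coef R.k R.m₀) g₁
    rw [map_add, coef_apply _ _ (_ + _), g₃, mul_zero, add_zero] at h1
    rw [h1, kerVec, map_smul, map_add, coef_modeVec, coef_modeVec, if_pos rfl,
      if_neg R.m₀_ne_neg]
    simp
  rw [map_add, map_smul, map_smul, hV, coef_apply _ _ Z, hZ]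
  simp

theorem IsBranchPoint.reflXT_eq (h : R.IsBranchPoint μ ν B V Z ρ) :
    reflXT (A • V + A ^ 2 • Z) = A • V + A ^ 2 • Z := by
  rw [map_add, map_smul, map_smul, (solution_odd h).2, (solution_even h).2]

variable (R)

theorem reflXT_etaSeq {v : Seq} (hv : reflXT v = v) (B : ℝ) :
    reflXT (etaSeq R B v) = etaSeq R B v := by
  rw [etaSeq, map_add, map_smul, R.reflXT_smoothing (reflXT_evenPart hv), reflXT,
    reindexOp_modeVec R.k (weight_neg R.k), neg_zero]

theorem reflX_etaSeq (v : Seq) (B : ℝ) : reflX (etaSeq R B v) = etaSeq R B v := by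
  have : flipX 0 = 0 := by simp [flipX]
  rw [etaSeq, map_add, map_smul, R.reflX_smoothing (reflX_evenPart v), reflX,
    reindexOp_modeVec R.k (weight_flipX R.k), this]

theorem cosSeries_etaSeq_kerVec (c B : ℝ) (z : ℝ × ℝ) :
    cosSeries R.k (etaSeq R B (c • R.kerVec)) z =
      2 * c * Real.cos (R.q₀ * z.2) * Real.cos (R.p₀ * z.1) + B := by
  have hs : slope R.α R.γ R.p₀ ≠ 0 := (one_pos.trans_le (one_le_slope R.hα R.hγ _)).ne'
  simp only [etaSeq, kerVec, map_smul, map_add, evenPart_modeVec, smoothing, diagonalOp_modeVec,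
    cosSeries_add, cosSeries_smul, cosSeries_modeVec, m₀, flipX, Prod.neg_mk, slope_neg, phase]
  push_cast
  simp only [neg_neg, Prod.fst_zero, Prod.snd_zero, Int.cast_zero, zero_mul, add_zero,
    Real.cos_zero, mul_one, Real.cos_add, neg_mul, Real.cos_neg, Real.sin_neg]
  field_simp
  ring

theorem cosSeries_oddPart_kerVec (c : ℝ) (z : ℝ × ℝ) :
    cosSeries R.k (oddPart (c • R.kerVec)) z =
      2 * slope R.α R.γ R.p₀ * c * Real.sin (R.q₀ * z.2) * Real.sin (R.p₀ * z.1) := by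
  simp only [kerVec, map_smul, map_add, oddPart_modeVec,
    cosSeries_add, cosSeries_sub, cosSeries_smul, cosSeries_modeVec, m₀, flipX, Prod.neg_mk, phase]
  push_cast
  simp only [neg_neg, Real.cos_add, neg_mul, Real.cos_neg, Real.sin_neg]
  ring

theorem average_eq (w : ℝ × ℝ → ℝ) : (average w : ℂ) = fourierCoef w 0 0 := by
  rw [average, fourierCoef]
  push_cast
  congr 1
  simp only [zero_mul, add_zero, mul_zero, neg_zero, Complex.exp_zero, mul_one]
  exact integral_ofReal.symm

variable {R}

theorem IsBranchPoint.memHEvenZero (h : R.IsBranchPoint μ ν B V Z ρ) (τ : ℝ) :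
    MemHEvenZero R.k (timeShift τ (cosSeries R.k (etaSeq R B (A • V + A ^ 2 • Z)))) where
  mem := memH_timeShift_cosSeries R.k (R.reflXT_etaSeq h.reflXT_eq B) τ
  even x t := by
    rw [timeShift, timeShift, cosSeries_flip, reflX_etaSeq]
  zero_modes q hq := by
    have h0 : ((0, q) : ℤ × ℤ) ≠ 0 := fun h' => hq (congrArg Prod.snd h')
    have h1 := fourierCoef_cosSeries R.k (R.reflXT_etaSeq (h.reflXT_eq (A := A)) B) (0, q)
    have h2 : coef R.k (0, q) (etaSeq R B (A • V + A ^ 2 • Z)) = 0 := by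
      rw [etaSeq, map_add, map_smul, coef_modeVec, if_neg h0, smoothing, coef_diagonalOp,
        coef_evenPart, h.coef_eq_zero rfl, h.coef_eq_zero (m := flipX (0, q)) (by simp [flipX])]
      simp
    rw [h2] at h1
    rw [fourierCoef_timeShift (continuous_cosSeries _ _) (doublyPeriodic_cosSeries _ _),
      show fourierCoef _ 0 q = ((0 : ℝ) : ℂ) from h1]
    simp

theorem IsBranchPoint.memHOdd (h : R.IsBranchPoint μ ν B V Z ρ) (τ : ℝ) :
    MemHOdd R.k (timeShift τ (cosSeries R.k (oddPart (A • V + A ^ 2 • Z)))) where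
  mem := memH_timeShift_cosSeries R.k (reflXT_oddPart h.reflXT_eq) τ
  odd x t := by
    rw [timeShift, timeShift, cosSeries_flip, reflX_oddPart]
    exact map_neg _ _

theorem IsBranchPoint.isWeakSolution (h : R.IsBranchPoint μ ν B V Z ρ) (hA : A ^ 2 = ρ) (τ : ℝ) :
    IsWeakSolution (R.α + μ) (R.β + ν) R.γ
      (timeShift τ (cosSeries R.k (etaSeq R B (A • V + A ^ 2 • Z))))
      (timeShift τ (cosSeries R.k (oddPart (A • V + A ^ 2 • Z)))) := by
  obtain ⟨h₁, h₂⟩ := solution_fourier h hA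
  exact (isWeakSolution_cosSeries R.k (R.reflXT_etaSeq h.reflXT_eq B)
    (reflXT_oddPart h.reflXT_eq) h₁ h₂).timeShift (continuous_cosSeries _ _)
    (continuous_cosSeries _ _) (doublyPeriodic_cosSeries _ _) (doublyPeriodic_cosSeries _ _) τ

theorem IsBranchPoint.average_eq (h : R.IsBranchPoint μ ν B V Z ρ) :
    average (cosSeries R.k (etaSeq R B (A • V + A ^ 2 • Z))) = B := by
  have h1 := fourierCoef_cosSeries R.k (R.reflXT_etaSeq (h.reflXT_eq (A := A)) B) 0
  have h2 : coef R.k 0 (etaSeq R B (A • V + A ^ 2 • Z)) = B := by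
    rw [etaSeq, map_add, map_smul, coef_modeVec, if_pos rfl, smoothing, coef_diagonalOp,
      coef_evenPart, h.coef_eq_zero rfl, h.coef_eq_zero (m := flipX 0) (by simp [flipX])]
    simp
  rw [h2] at h1
  have h3 := ResonantData.average_eq (cosSeries R.k (etaSeq R B (A • V + A ^ 2 • Z)))
  rw [show fourierCoef _ 0 0 = (B : ℂ) from h1] at h3
  exact_mod_cast h3

theorem norm_remainder_le (hA : 0 ≤ A) {C δ : ℝ} (hV : ‖V - R.kerVec‖ ≤ C * δ) (hZ : ‖Z‖ ≤ C) :
    ‖A • V + A ^ 2 • Z - A • R.kerVec‖ ≤ C * A * (δ + A) := by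
  have e : A • V + A ^ 2 • Z - A • R.kerVec = A • (V - R.kerVec) + A ^ 2 • Z := by module
  rw [e]
  refine (norm_add_le _ _).trans ?_
  rw [norm_smul, norm_smul, Real.norm_eq_abs, Real.norm_eq_abs, abs_of_nonneg hA,
    abs_of_nonneg (sq_nonneg A)]
  calc A * ‖V - R.kerVec‖ + A ^ 2 * ‖Z‖ ≤ A * (C * δ) + A ^ 2 * C := by gcongr
    _ = C * A * (δ + A) := by ring

theorem IsBranchPoint.eta_remainder (h : R.IsBranchPoint μ ν B V Z ρ) :
    sobolevNorm R.k (fun z => cosSeries R.k (etaSeq R B (A • V + A ^ 2 • Z)) z -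
      (2 * A * Real.cos (R.q₀ * z.2) * Real.cos (R.p₀ * z.1) + B)) ≤
      ‖R.smoothing.comp evenPart‖ * ‖A • V + A ^ 2 • Z - A • R.kerVec‖ := by
  have hr : reflXT (A • V + A ^ 2 • Z - A • R.kerVec) = A • V + A ^ 2 • Z - A • R.kerVec := by
    rw [map_sub, h.reflXT_eq, map_smul, R.reflXT_kerVec]
  have e : (fun z => cosSeries R.k (etaSeq R B (A • V + A ^ 2 • Z)) z -
      (2 * A * Real.cos (R.q₀ * z.2) * Real.cos (R.p₀ * z.1) + B)) =
      cosSeries R.k (R.smoothing (evenPart (A • V + A ^ 2 • Z - A • R.kerVec))) := by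
    funext z
    rw [← cosSeries_etaSeq_kerVec, ← cosSeries_sub]
    congr 1
    simp only [etaSeq, map_sub]
    abel
  rw [e]
  exact (sobolevNorm_cosSeries_le R.k (R.reflXT_smoothing (reflXT_evenPart hr))).trans
    ((R.smoothing.comp evenPart).le_opNorm _)

theorem IsBranchPoint.u_remainder (h : R.IsBranchPoint μ ν B V Z ρ) :
    sobolevNorm R.k (fun z => cosSeries R.k (oddPart (A • V + A ^ 2 • Z)) z -
      2 * slope R.α R.γ R.p₀ * A * Real.sin (R.q₀ * z.2) * Real.sin (R.p₀ * z.1)) ≤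
      ‖oddPart‖ * ‖A • V + A ^ 2 • Z - A • R.kerVec‖ := by
  have hr : reflXT (A • V + A ^ 2 • Z - A • R.kerVec) = A • V + A ^ 2 • Z - A • R.kerVec := by
    rw [map_sub, h.reflXT_eq, map_smul, R.reflXT_kerVec]
  have e : (fun z => cosSeries R.k (oddPart (A • V + A ^ 2 • Z)) z -
      2 * slope R.α R.γ R.p₀ * A * Real.sin (R.q₀ * z.2) * Real.sin (R.p₀ * z.1)) =
      cosSeries R.k (oddPart (A • V + A ^ 2 • Z - A • R.kerVec)) := by
    funext z
    rw [← cosSeries_oddPart_kerVec, ← cosSeries_sub, ← map_sub]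
  rw [e]
  exact (sobolevNorm_cosSeries_le R.k (reflXT_oddPart hr)).trans (oddPart.le_opNorm _)

/-- By continuity, equality almost everywhere is equality everywhere. Then the even and odd parts of
`v` both vanish at `m₀`, hence so does `v`, contradicting its resonant coefficient `A s > 0`. -/
theorem IsBranchPoint.nontrivial (h : R.IsBranchPoint μ ν B V Z ρ) (hA : 0 < A) :
    ¬(cosSeries R.k (etaSeq R B (A • V + A ^ 2 • Z)) =ᵐ[volume] (fun _ => B) ∧
      cosSeries R.k (oddPart (A • V + A ^ 2 • Z)) =ᵐ[volume] fun _ => (0 : ℝ)) := by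
  rintro ⟨h1, h2⟩
  have hv := h.reflXT_eq (A := A)
  have hv0 := h.coef_m₀ (A := A)
  set v := A • V + A ^ 2 • Z
  have h1' := ((continuous_cosSeries _ _).ae_eq_iff_eq volume continuous_const).mp h1
  have h2' := ((continuous_cosSeries _ _).ae_eq_iff_eq volume continuous_const).mp h2
  have hs := one_le_slope R.hα R.hγ R.m₀.1
  have hzero : ∀ a : Seq, reflXT a = a → (∀ z, cosSeries R.k a z = 0) → coef R.k R.m₀ a = 0 := by
    intro a ha h0
    have h3 := fourierCoef_cosSeries R.k ha R.m₀
    rw [show cosSeries R.k a = fun _ => 0 from funext h0] at h3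
    simpa [fourierCoef] using h3.symm
  have e1 : coef R.k R.m₀ (R.smoothing (evenPart v)) = 0 := by
    refine hzero _ (R.reflXT_smoothing (reflXT_evenPart hv)) fun z => ?_
    have h4 := congrFun h1' z
    rw [etaSeq, cosSeries_add, cosSeries_smul, cosSeries_modeVec] at h4
    simpa [phase] using h4
  have e2 : coef R.k R.m₀ (oddPart v) = 0 :=
    hzero _ (reflXT_oddPart hv) fun z => congrFun h2' z
  rw [smoothing, coef_diagonalOp, mul_eq_zero] at e1
  have e3 := e1.resolve_left (inv_ne_zero (one_pos.trans_le hs).ne')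
  rw [coef_evenPart] at e3
  rw [coef_oddPart] at e2
  have e4 : coef R.k R.m₀ v = 0 := by linarith
  rw [e4] at hv0
  have : 0 < A * slope R.α R.γ R.p₀ := mul_pos hA (one_pos.trans_le (one_le_slope R.hα R.hγ _))
  linarith

variable (R)

/-- The linear terms of the bifurcation equation. -/
theorem linear_terms (μ ν B : ℝ) :
    μ * coef R.k R.m₀ (R.op₁ R.kerVec) + ν * coef R.k R.m₀ (R.op₂ R.kerVec) +
      R.β * μ * coef R.k R.m₀ ((R.op₃.comp evenPart) R.kerVec) +
      R.β * B * coef R.k R.m₀ ((R.op₂.comp oddPart) R.kerVec) =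
    R.p₀ / 2 * (-(2 * R.p₀ * R.q₀ * kernelSlope R.α R.γ R.p₀ - R.γ * R.β * (R.p₀ : ℝ) ^ 2) * μ
      + (2 + 2 * R.γ * R.α * (R.p₀ : ℝ) ^ 2) * ν
      + R.β * (1 + R.γ * R.α * (R.p₀ : ℝ) ^ 2) * B) := by
  have hp : R.m₀.1 ≠ 0 := R.p₀_ne_zero
  have hs : slope R.α R.γ R.p₀ ≠ 0 := (one_pos.trans_le (one_le_slope R.hα R.hγ _)).ne'
  have hq : ∀ φ : ℤ × ℤ → ℝ, R.quotSymbol φ R.m₀ = φ R.m₀ := fun φ => by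
    rw [quotSymbol, if_neg hp, R.regSymbol_m₀, div_one]
  have h2 : R.m₀ ≠ flipX R.m₀ := fun h => by
    have := congrArg Prod.fst h
    simp only [flipX] at this
    omega
  have hfl : flipX R.m₀ = (-1 * (R.p₀ : ℤ), -1 * (R.q₀ : ℤ)) := by simp [flipX, m₀]
  have k1 : coef R.k R.m₀ R.kerVec = slope R.α R.γ R.p₀ := by
    have := R.gridCoef_kerVec 1 (-1)
    rw [gridCoef, ← m₀_eq] at this
    simpa using this
  have k2 : coef R.k (flipX R.m₀) R.kerVec = 0 := by
    have := R.gridCoef_kerVec (-1) (-1)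
    rw [gridCoef, ← hfl] at this
    simpa using this
  have hsq := slope_sq R.hα R.hγ R.p₀
  rw [Int.cast_natCast] at hsq
  simp only [ContinuousLinearMap.comp_apply, op₁, op₂, op₃, coef_diagonalOp, hq, coef_evenPart,
    coef_oddPart, k1, k2, R.kernelSlope_eq]
  simp only [num₁, num₂, num₃, m₀]
  push_cast
  rw [show (2 + 2 * R.γ * R.α * (R.p₀ : ℝ) ^ 2) = 2 * slope R.α R.γ R.p₀ ^ 2 by rw [hsq]; ring,
    ← hsq]
  field_simp
  ring

end BranchPoint

end ResonantData

/-! ### The branch and the main theorem. -/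

open ResonantData in
theorem exists_branch (R : ResonantData) (hβ₂ : coefBeta2 R.α R.β R.γ R.p₀ R.q₀ ≠ 0) :
    ∃ ε > 0, ∃ C > 0, ∃ f : ℝ → ℝ → ℝ → ℝ, ∀ μ ν B : ℝ, |μ| + |ν| + |B| < ε →
      |f μ ν B - principalAmplitudeSq R.α R.β R.γ R.p₀ R.q₀ μ ν B| ≤
        C * (|μ| + |ν| + |B|) ^ 2 ∧
      ∃ V Z : Seq, R.IsBranchPoint μ ν B V Z (f μ ν B) ∧
        ‖V - R.kerVec‖ ≤ C * (|μ| + |ν| + |B|) ∧ ‖Z‖ ≤ C := by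
  have hp : (0 : ℝ) < R.p₀ := by exact_mod_cast R.hp₀
  set κ := (R.p₀ : ℝ) / 2 * coefBeta2 R.α R.β R.γ R.p₀ R.q₀ with hκ
  have hκ0 : κ ≠ 0 := mul_ne_zero (by positivity) hβ₂
  obtain ⟨ε, hε, C, hC, ψ, hψ⟩ := exists_bifurcating_branch R.op₁ R.op₂ (R.op₃.comp evenPart)
    (R.op₂.comp oddPart) R.projOdd R.projEven R.quad (coef R.k R.m₀) R.β R.kerVec R.secondOrder
    rfl R.kappa_eq.symm hκ0
  -- The function `f` is the component `ρ = A²`, of either sign; the constant `C / |κ|` arises on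
  -- solving the expansion for `ρ`.
  refine ⟨ε, hε, max C (C / |κ|), lt_max_of_lt_left hC, fun μ ν B => (ψ (μ, ν, B)).2.2,
    fun μ ν B hσ => ?_⟩
  obtain ⟨V, Z, ρ, hρ, h1, h2, h3, h4, h5, h6⟩ := hψ μ ν B hσ
  simp only [hρ]
  refine ⟨?_, V, Z, ⟨h1, h2, h3⟩, h4.trans ?_, h5.trans (le_max_left _ _)⟩
  · rw [R.linear_terms] at h6
    have e : ρ - principalAmplitudeSq R.α R.β R.γ R.p₀ R.q₀ μ ν B = (κ * ρ + R.p₀ / 2 *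
        (-(2 * R.p₀ * R.q₀ * kernelSlope R.α R.γ R.p₀ - R.γ * R.β * (R.p₀ : ℝ) ^ 2) * μ
        + (2 + 2 * R.γ * R.α * (R.p₀ : ℝ) ^ 2) * ν
        + R.β * (1 + R.γ * R.α * (R.p₀ : ℝ) ^ 2) * B)) / κ := by
      rw [principalAmplitudeSq, hκ]
      field_simp
      ring
    rw [e, abs_div, div_le_iff₀ (abs_pos.mpr hκ0)]
    refine h6.trans ?_
    calc C * (|μ| + |ν| + |B|) ^ 2 = C / |κ| * (|μ| + |ν| + |B|) ^ 2 * |κ| := by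
          have := abs_pos.mpr hκ0
          field_simp
      _ ≤ _ := by gcongr; exact le_max_right _ _
  · gcongr
    exact le_max_left _ _

end BonaSmith

end

theorem mainTheorem1 (α₀ β₀ γ₀ : ℝ) (hα : 0 < α₀) (hβ : 0 < β₀) (hγ : 0 < γ₀) (hγ' : γ₀ < 1)
    (p₀ q₀ : ℕ) (hres : BonaSmith.resonanceSet α₀ β₀ γ₀ = {(p₀, q₀)})
    (hinf : ∀ q : ℕ, α₀ * (q : ℝ) ^ 2 ≠ γ₀ * β₀ ^ 2)
    (hβ₂ : BonaSmith.coefBeta2 α₀ β₀ γ₀ p₀ q₀ ≠ 0)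
    (k : ℕ) (hk : 2 ≤ k) :
    ∃ ε : ℝ, 0 < ε ∧ ∃ C : ℝ, 0 < C ∧ ∃ f : ℝ → ℝ → ℝ → ℝ,
      ∀ μ ν B : ℝ, |μ| + |ν| + |B| < ε →
        |f μ ν B - BonaSmith.principalAmplitudeSq α₀ β₀ γ₀ p₀ q₀ μ ν B|
            ≤ C * (|μ| + |ν| + |B|) ^ 2 ∧
        (0 ≤ f μ ν B →
          ∃ η₀ u₀ : ℝ × ℝ → ℝ,
            (∀ τ : ℝ,
              BonaSmith.MemHEvenZero k (BonaSmith.timeShift τ η₀) ∧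
              BonaSmith.MemHOdd k (BonaSmith.timeShift τ u₀) ∧
              BonaSmith.IsWeakSolution (α₀ + μ) (β₀ + ν) γ₀
                (BonaSmith.timeShift τ η₀) (BonaSmith.timeShift τ u₀)) ∧
            BonaSmith.average η₀ = B ∧
            BonaSmith.sobolevNorm k (fun z => η₀ z -
                (2 * Real.sqrt (f μ ν B) * Real.cos (q₀ * z.2) * Real.cos (p₀ * z.1) + B))
              ≤ C * Real.sqrt (f μ ν B) *
                  (|μ| + |ν| + Real.sqrt (f μ ν B) + |B|) ∧
            BonaSmith.sobolevNorm k (fun z => u₀ z -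
                2 * Real.sqrt (1 + γ₀ * α₀ * (p₀ : ℝ) ^ 2) * Real.sqrt (f μ ν B) *
                  Real.sin (q₀ * z.2) * Real.sin (p₀ * z.1))
              ≤ C * Real.sqrt (f μ ν B) *
                  (|μ| + |ν| + Real.sqrt (f μ ν B) + |B|) ∧
            (0 < f μ ν B →
              ¬ (η₀ =ᵐ[MeasureTheory.volume] (fun _ => B) ∧
                u₀ =ᵐ[MeasureTheory.volume] (fun _ => (0 : ℝ)))))  := by
  obtain ⟨c, hc, hbound⟩ := BonaSmith.exists_symbol_lower_bound hα hβ hγ hres hinf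
  have hmem : (p₀, q₀) ∈ BonaSmith.resonanceSet α₀ β₀ γ₀ := by rw [hres]; rfl
  let R : BonaSmith.ResonantData :=
    { α := α₀, β := β₀, γ := γ₀, p₀ := p₀, q₀ := q₀, k := k, c := c, hα := hα, hβ := hβ, hγ := hγ,
      hγ' := hγ', hp₀ := hmem.1, hq₀ := hmem.2.1, hc := hc
      resonance := by
        have h := hmem.2.2
        simp only [BonaSmith.slope, Int.cast_natCast]
        linarith
      bound := hbound }
  obtain ⟨ε, hε, C, hC, f, hf⟩ := BonaSmith.exists_branch R hβ₂
  -- One constant for the two maps sending the remainder of `v` to those of `η` and `u`; the summand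
  -- `1` keeps the bound on `f`.
  let K : ℝ := 1 + ‖R.smoothing.comp BonaSmith.evenPart‖ + ‖BonaSmith.oddPart‖
  have hK1 : 1 ≤ K := by
    have h1 := norm_nonneg (R.smoothing.comp BonaSmith.evenPart)
    have h2 := norm_nonneg BonaSmith.oddPart
    simp only [K]
    linarith
  have hKη : ‖R.smoothing.comp BonaSmith.evenPart‖ ≤ K := by
    have h2 := norm_nonneg BonaSmith.oddPart
    simp only [K]
    linarith
  have hKu : ‖BonaSmith.oddPart‖ ≤ K := by
    have h1 := norm_nonneg (R.smoothing.comp BonaSmith.evenPart)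
    simp only [K]
    linarith
  refine ⟨ε, hε, K * C, by positivity, f, fun μ ν B hσ => ?_⟩
  obtain ⟨h1, V, Z, hbr, hV, hZ⟩ := hf μ ν B hσ
  refine ⟨h1.trans ?_, fun hpos => ?_⟩
  · gcongr
    exact le_mul_of_one_le_left hC.le hK1
  have hA : Real.sqrt (f μ ν B) ^ 2 = f μ ν B := Real.sq_sqrt hpos
  have hA0 : 0 ≤ Real.sqrt (f μ ν B) := Real.sqrt_nonneg _
  have hr := BonaSmith.ResonantData.norm_remainder_le hA0 hV hZ
  refine ⟨_, _, fun τ => ⟨hbr.memHEvenZero (A := Real.sqrt (f μ ν B)) τ, hbr.memHOdd τ,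
    hbr.isWeakSolution hA τ⟩, hbr.average_eq, ?_, ?_, fun hf0 =>
    hbr.nontrivial (Real.sqrt_pos.mpr hf0)⟩
  · refine hbr.eta_remainder.trans ?_
    calc _ ≤ K * (C * Real.sqrt (f μ ν B) * (|μ| + |ν| + |B| + Real.sqrt (f μ ν B))) := by gcongr
      _ = _ := by ring
  · have h2 := hbr.u_remainder (A := Real.sqrt (f μ ν B))
    simp only [BonaSmith.slope, Int.cast_natCast] at h2
    refine h2.trans ?_
    calc _ ≤ K * (C * Real.sqrt (f μ ν B) * (|μ| + |ν| + |B| + Real.sqrt (f μ ν B))) := by gcongr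
      _ = _ := by ring
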